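/- Let $T_2$ be the binary rooted tree, whose vertices are the finite words over $\{0,1\}$, with root the empty word and with $u$ joined to $u0$ and $u1$. Let $\mathrm{Aut}\,T_2$ be the group of graph automorphisms of $T_2$ fixing the root; for $n\ge 0$ let $\mathrm{St}(n)$ be the normal subgroup of the automorphisms fixing every word of length $n$, and give $\mathrm{Aut}\,T_2$ the group topology in which the subgroups $\mathrm{St}(n)$ form a basis of neighbourhoods of $1$. The first Grigorchuk group is $\mathfrak G=\langle a,b,c,d\rangle\le\mathrm{Aut}\,T_2$, where $a$ swaps the two subtrees below the root, and $b,c,d$ fix the first level of the tree and act on the two subtrees below the root according to the recursion $b=(a,c)$, $c=(a,d)$, $d=(1,b)$. Let $\Gamma=\overline{\mathfrak G}$ be its closure in $\mathrm{Aut}\,T_2$. For a subgroup $H$ of $\Gamma$, let $H^2$ be the subgroup generated by the squares of the elements of $H$. Consider the following series of closed subgroups of $\Gamma$: - the lower $2$-central series $\mathcal L=(\gamma_n)_{n\ge1}$, where $\gamma_1=\Gamma$ and $\gamma_{n+1}=\overline{[\gamma_n,\Gamma]\,\gamma_n^2}$ for $n\ge 1$; - the Jennings–Zassenhaus series $\mathcal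 D=(D_n)_{n\ge1}$, where $D_1=\Gamma$ and $D_n=\overline{[D_{n-1},\Gamma]\,D_{\lceil n/2\rceil}^2}$ for $n\ge2$; - the level-stabilizer series $\mathcal S=(\Gamma\cap\mathrm{St}(n))_{n\ge 1}$. For a filtration $\mathcal F=(F_n)_{n\ge1}$ of $\Gamma$, i.e. a descending chain of open normal subgroups with trivial intersection, the Hausdorff dimension of a closed subgroup $H\le\Gamma$ with respect to $\mathcal F$ is $$\mathrm{hdim}^{\mathcal F}_\Gamma(H)=\liminf_{n\to\infty}\frac{\log|HF_n:F_n|}{\log|\Gamma:F_n|},$$ and, for $b\ge1$, the $b$-bounded Hausdorff spectrum $\mathrm{hspec}_b^{\mathcal F}(\Gamma)$ is the set of the numbers $\mathrm{hdim}^{\mathcal F}_\Gamma(H)$, where $H$ runs over the closed subgroups of $\Gamma$ that are topologically generated by at most $b$ elements. Theorem. $\mathcal L$, $\mathcal D$ and $\mathcal S$ are filtrations of $\Gamma$, and there exists an integer $b\ge2$ such that $$\mathrm{hspec}_b^{\mathcal L}(\Gamma)=\mathrm{hspec}_b^{\mathcal D}(\Gamma)=\mathrm{hspec}_b^{\mathcal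 S}(\Gamma)=[0,1].$$ -/

import Mathlib

open Filter Topology

/-! ### The binary rooted tree and its automorphism group -/

/-- The binary rooted tree: its vertices are the finite words over a two-letter alphabet, the root
is the empty word, and the children of `u` are the words `u ++ [x]`. -/
def binaryTree : SimpleGraph (List Bool) where
  Adj u v := (∃ x : Bool, v = u ++ [x]) ∨ (∃ x : Bool, u = v ++ [x])
  symm := ⟨fun _ _ h => h.symm⟩
  loopless := ⟨fun u h => by
    rcases h with ⟨x, h⟩ | ⟨x, h⟩ <;> simpa using congrArg List.length h⟩

/-- The graph automorphisms of the binary tree that fix the root. -/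
def treeAut : Subgroup (binaryTree ≃g binaryTree) where
  carrier := {g | g [] = []}
  one_mem' := rfl
  mul_mem' {g h} hg hh := by
    change g (h []) = []
    rw [show h [] = [] from hh]
    exact hg
  inv_mem' {g} hg := by
    change g.symm [] = []
    rw [RelIso.symm_apply_eq]
    exact hg.symm

theorem treeAut_map_nil (g : treeAut) : g.1 [] = [] := g.2

theorem treeAut_map_append (g : treeAut) (u : List Bool) :
    ∀ x : Bool, ∃ y : Bool, g.1 (u ++ [x]) = g.1 u ++ [y] := by
  induction u using List.reverseRecOn with
  | nil =>
    intro x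
    have h : binaryTree.Adj (g.1 []) (g.1 ([] ++ [x])) := g.1.map_rel_iff.2 (Or.inl ⟨x, rfl⟩)
    rcases h with h | ⟨y, h⟩
    · exact h
    · rw [treeAut_map_nil] at h
      simp at h
  | append_singleton w z ih =>
    intro x
    have h : binaryTree.Adj (g.1 (w ++ [z])) (g.1 (w ++ [z] ++ [x])) :=
      g.1.map_rel_iff.2 (Or.inl ⟨x, rfl⟩)
    rcases h with h | ⟨y, h⟩
    · exact h
    · obtain ⟨t, ht⟩ := ih z
      rw [ht] at h
      have h1 : g.1 w = g.1 (w ++ [z] ++ [x]) := (List.append_inj' h rfl).1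
      have h2 := congrArg List.length (g.1.injective h1)
      simp at h2

theorem treeAut_length (g : treeAut) (u : List Bool) : (g.1 u).length = u.length := by
  induction u using List.reverseRecOn with
  | nil => rw [treeAut_map_nil]
  | append_singleton w z ih =>
    obtain ⟨y, hy⟩ := treeAut_map_append g w z
    rw [hy]
    simp [ih]

/-- The `n`th level stabilizer: the automorphisms that fix every vertex of the `n`th level. -/
def levelStabilizer (n : ℕ) : Subgroup treeAut where
  carrier := {g | ∀ v : List Bool, v.length = n → g.1 v = v}
  one_mem' := fun _ _ => rfl
  mul_mem' {g h} hg hh := fun v hv => by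
    change g.1 (h.1 v) = v
    rw [hh v hv, hg v hv]
  inv_mem' {g} hg := fun v hv => by
    change g.1.symm v = v
    rw [RelIso.symm_apply_eq, hg v hv]

instance levelStabilizer_normal (n : ℕ) : (levelStabilizer n).Normal where
  conj_mem g hg h := fun v hv => by
    change h.1 (g.1 ((h⁻¹).1 v)) = v
    rw [hg _ ((treeAut_length _ _).trans hv)]
    exact h.1.apply_symm_apply v

theorem levelStabilizer_antitone : Antitone levelStabilizer := by
  refine antitone_nat_of_succ_le fun n g hg v hv => ?_
  obtain ⟨y, hy⟩ := treeAut_map_append g v true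
  rw [hg (v ++ [true]) (by simp [hv])] at hy
  exact ((List.append_inj' hy rfl).1).symm

/-- The level stabilizers, as a basis of neighbourhoods of the identity. -/
@[reducible] def congruenceBasis : GroupFilterBasis treeAut where
  sets := Set.range fun n : ℕ => (levelStabilizer n : Set treeAut)
  nonempty := Set.range_nonempty _
  inter_sets := by
    rintro _ _ ⟨m, rfl⟩ ⟨n, rfl⟩
    exact ⟨_, ⟨max m n, rfl⟩, Set.subset_inter
      (levelStabilizer_antitone (le_max_left m n)) (levelStabilizer_antitone (le_max_right m n))⟩
  one' := by
    rintro _ ⟨n, rfl⟩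
    exact (levelStabilizer n).one_mem
  mul' := by
    rintro _ ⟨n, rfl⟩
    refine ⟨_, ⟨n, rfl⟩, ?_⟩
    rintro _ ⟨g, hg, h, hh, rfl⟩
    exact (levelStabilizer n).mul_mem hg hh
  inv' := by
    rintro _ ⟨n, rfl⟩
    exact ⟨_, ⟨n, rfl⟩, fun g hg => (levelStabilizer n).inv_mem hg⟩
  conj' := by
    rintro h _ ⟨n, rfl⟩
    exact ⟨_, ⟨n, rfl⟩, fun g hg => (levelStabilizer_normal n).conj_mem g hg h⟩

/-- The congruence topology on the automorphism group of the tree. -/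
instance treeAut_topologicalSpace : TopologicalSpace treeAut := congruenceBasis.topology

instance treeAut_isTopologicalGroup : IsTopologicalGroup treeAut :=
  congruenceBasis.isTopologicalGroup

/-! ### The first Grigorchuk group -/

/-- The action of the rooted automorphism `a`, which swaps the two subtrees below the root. -/
def actA : List Bool → List Bool
  | [] => []
  | x :: w => (!x) :: w

/- The actions of `b`, `c`, `d`: they fix both vertices of the first level, and their pairs of
sections there are `(a, c)`, `(a, d)` and `(1, b)` respectively. -/
mutual

def actB : List Bool → List Bool
  | [] => []
  | false :: w => false :: actA w
  | true :: w => true :: actC w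

def actC : List Bool → List Bool
  | [] => []
  | false :: w => false :: actA w
  | true :: w => true :: actD w

def actD : List Bool → List Bool
  | [] => []
  | false :: w => false :: w
  | true :: w => true :: actB w

end

theorem actA_invol : ∀ w : List Bool, actA (actA w) = w
  | [] => rfl
  | x :: w => by simp [actA]

theorem actBCD_invol (w : List Bool) :
    actB (actB w) = w ∧ actC (actC w) = w ∧ actD (actD w) = w := by
  induction w with
  | nil => simp [actB, actC, actD]
  | cons x w ih => cases x <;> simp [actB, actC, actD, actA_invol, ih]

theorem actA_append : ∀ (w : List Bool) (x : Bool), ∃ y : Bool, actA (w ++ [x]) = actA w ++ [y]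
  | [], x => ⟨!x, rfl⟩
  | _ :: _, x => ⟨x, rfl⟩

theorem actBCD_append (w : List Bool) (x : Bool) :
    (∃ y : Bool, actB (w ++ [x]) = actB w ++ [y]) ∧
    (∃ y : Bool, actC (w ++ [x]) = actC w ++ [y]) ∧
    (∃ y : Bool, actD (w ++ [x]) = actD w ++ [y]) := by
  induction w with
  | nil => cases x <;> simp [actB, actC, actD, actA]
  | cons z w ih =>
    obtain ⟨hb, hc, hd⟩ := ih
    have ha := actA_append w x
    cases z <;> simp [actB, actC, actD, ha, hb, hc, hd]

/-- An involution of the set of words that maps children to children and fixes the root is a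
rooted automorphism of the tree. -/
def autOfInvol (f : List Bool → List Bool) (h0 : f [] = []) (h2 : ∀ w, f (f w) = w)
    (h1 : ∀ (w : List Bool) (x : Bool), ∃ y : Bool, f (w ++ [x]) = f w ++ [y]) : treeAut :=
  have key : ∀ u v, binaryTree.Adj u v → binaryTree.Adj (f u) (f v) := by
    rintro u v (⟨x, rfl⟩ | ⟨x, rfl⟩)
    · exact Or.inl (h1 u x)
    · exact Or.inr (h1 v x)
  ⟨{ toFun := f
     invFun := f
     left_inv := h2
     right_inv := h2
     map_rel_iff' := fun {u v} =>
       ⟨fun h => by simpa [h2] using key _ _ h, key u v⟩ }, h0⟩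

def grigA : treeAut := autOfInvol actA rfl actA_invol actA_append

def grigB : treeAut :=
  autOfInvol actB (by simp [actB]) (fun w => (actBCD_invol w).1) (fun w x => (actBCD_append w x).1)

def grigC : treeAut :=
  autOfInvol actC (by simp [actC]) (fun w => (actBCD_invol w).2.1)
    (fun w x => (actBCD_append w x).2.1)

def grigD : treeAut :=
  autOfInvol actD (by simp [actD]) (fun w => (actBCD_invol w).2.2)
    (fun w x => (actBCD_append w x).2.2)

/-- The first Grigorchuk group. -/
def grigorchukGroup : Subgroup treeAut := Subgroup.closure {grigA, grigB, grigC, grigD}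

/-- The closure of the first Grigorchuk group in the automorphism group of the tree. -/
def grigorchukClosure : Subgroup treeAut := grigorchukGroup.topologicalClosure

/-- The level-stabilizer series of the closure of the first Grigorchuk group. -/
def grigorchukLevelSeries (n : ℕ) : Subgroup grigorchukClosure :=
  (levelStabilizer n).subgroupOf grigorchukClosure

/-! ### Series and Hausdorff dimension in topological groups -/

section TopologicalGroups

variable {G : Type*} [Group G]

/-- `H²`, the subgroup generated by the squares of the elements of `H`. -/
def squareSubgroup (H : Subgroup G) : Subgroup G :=
  Subgroup.closure ((fun x : G => x ^ 2) '' (H : Set G))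

variable [TopologicalSpace G]

/-- A filtration series: a descending chain of open normal subgroups, starting at the whole group,
with trivial intersection. -/
structure IsFiltrationSeries (F : ℕ → Subgroup G) : Prop where
  zero : F 0 = ⊤
  antitone : Antitone F
  isOpen : ∀ n, IsOpen (F n : Set G)
  normal : ∀ n, (F n).Normal
  iInf_eq : ⨅ n, F n = ⊥

/-- The Hausdorff dimension `liminf log |H Fₙ : Fₙ| / log |G : Fₙ|` of `H` with respect to the
filtration series `F`. -/
noncomputable def hausdorffDim (F : ℕ → Subgroup G) (H : Subgroup G) : ℝ :=
  liminf (fun n : ℕ =>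
    Real.log ((F n).relIndex (H ⊔ F n) : ℝ) / Real.log ((F n).index : ℝ)) atTop

variable [IsTopologicalGroup G]

/-- The lower 2-central series of a topological group, indexed from `1` (the term of index `0` is
the whole group too): `γ₁ = G` and `γₙ₊₁` is the closure of `[γₙ, G] γₙ²`. -/
def lowerTwoCentralSeries (G : Type*) [Group G] [TopologicalSpace G] [IsTopologicalGroup G] :
    ℕ → Subgroup G
  | 0 => ⊤
  | 1 => ⊤
  | n + 2 =>
    (⁅lowerTwoCentralSeries G (n + 1), (⊤ : Subgroup G)⁆ ⊔
      squareSubgroup (lowerTwoCentralSeries G (n + 1))).topologicalClosure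

/-- The Jennings–Zassenhaus series (for the prime 2) of a topological group, indexed from `1` (the
term of index `0` is the whole group too): `D₁ = G` and, for `n ≥ 2`, `Dₙ` is the closure of
`[Dₙ₋₁, G] D_{⌈n/2⌉}²`. Here `⌈(n + 2)/2⌉` is the natural number `(n + 3) / 2`. -/
def jenningsZassenhausSeries (G : Type*) [Group G] [TopologicalSpace G] [IsTopologicalGroup G] :
    ℕ → Subgroup G
  | 0 => ⊤
  | 1 => ⊤
  | n + 2 =>
    (⁅jenningsZassenhausSeries G (n + 1), (⊤ : Subgroup G)⁆ ⊔
      squareSubgroup (jenningsZassenhausSeries G ((n + 3) / 2))).topologicalClosure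
termination_by n => n
decreasing_by all_goals omega

/-- The `b`-bounded Hausdorff spectrum: the set of Hausdorff dimensions of the closed subgroups that
are topologically generated by at most `b` elements. -/
def boundedHausdorffSpectrum (F : ℕ → Subgroup G) (b : ℕ) : Set ℝ :=
  {d | ∃ H : Subgroup G, IsClosed (H : Set G) ∧
    (∃ S : Finset G, S.card ≤ b ∧ (Subgroup.closure (S : Set G)).topologicalClosure = H) ∧
    hausdorffDim F H = d}

end TopologicalGroups

open scoped commutatorElement

/-! ### Tree automorphisms: construction, sections and pairs -/

-- Write `(u, v)` for `pair u v`, and `γₙ` for the lower 2-central series of `Γ`. Everything rests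
-- on a recursion: for `m ≥ 3`, `γ_{2m-1} = γ_m × γ_m`, while `γ_{2m}` consists of the `(u, v)` with
-- `u, v ∈ γ_m` and `uv ∈ γ_{m+1}` (`grigSeries_odd`, `grigSeries_even`). Hence the factors
-- `γₙ/γₙ₊₁` have bounded order, and `γ₃ × γ₃ ≤ γ₃`, so that `Γ` branches over `γ₃`. The
-- Jennings–Zassenhaus series is reached through the Lazard-type formula `Dₙ = γₙ γ_{⌈n/2⌉}²`, whose
-- only ingredient that is not formal is that fourth powers of elements of `γ_j` lie in `γ_{4j}
-- γ_{2j}²` (`fourthPower`). Level stabilizers satisfy `S_{m+1} = S_m × S_m` for large `m`. So in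
-- each of the three filtrations `Fₙ` is, up to bounded index, `F_m × F_m` with `m → ∞` as `n → ∞`
-- (`SelfSimilarSeries`).
--
-- Consequently `log |Γ : Fₙ| = 2 log |Γ : F_m| + O(1)`, and growth rates of subgroups acting on the
-- two subtrees are averaged (`GrowthGE.pairProd`, `GrowthLE.pairProd`). Let `η ∈ [0, 1]` have its
-- binary digits equal to `1` exactly at the indices in `I`. Suppose a closed subgroup `H` lies in
-- the product of copies of `Γ` on the subtrees hanging off the rightmost ray at the indices in `I`,
-- and contains a subgroup of finite index of each of these copies. Cutting the product at depth `l`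
-- and replacing its tail by `1` or by `Γ` changes the growth rate by at most `2⁻ˡ`, so `H` has
-- dimension `∑_{i ∈ I} 2^{-(i+1)} = η` for all three filtrations (`hausdorffDim_eq_of_spineProd`).
-- The finite indices need not be bounded in `i`.
--
-- It remains to generate such an `H` by a number of elements that does not depend on `I`
-- (`exists_subgroup_along_ray`). The generators are the constant sequences along the ray with
-- values in a finite set generating `γ₃` topologically, and the conjugates, by representatives of
-- `Γ/γ₃`, of three sequences `t, x, y` such that the commutator of `x i` with the conjugate of `y
-- i` by `t i ^ 2 ^ m` is a nontrivial `e i` for `i < m` and `1` otherwise. Comparing `m = i + 1`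
-- with `m = i` isolates `e i` at the index `i`. Conjugation then gives all `Γ`-conjugates of `e i`,
-- and the double commutator argument for branch groups produces some `γ_k` at that index
-- (`exists_grigSeries_le_of_conj_mem`).

theorem treeAut_ext {g h : treeAut} (H : ∀ w, g.1 w = h.1 w) : g = h :=
  Subtype.ext (RelIso.ext H)

theorem treeAut_mul_apply (g h : treeAut) (w : List Bool) : (g * h).1 w = g.1 (h.1 w) := rfl

theorem treeAut_one_apply (w : List Bool) : (1 : treeAut).1 w = w := rfl

theorem treeAut_inv_apply_self (g : treeAut) (w : List Bool) : (g⁻¹).1 (g.1 w) = w :=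
  g.1.symm_apply_apply w

theorem treeAut_apply_inv_self (g : treeAut) (w : List Bool) : g.1 ((g⁻¹).1 w) = w :=
  g.1.apply_symm_apply w

/-- A bijection of the set of words that maps children to children in both directions and fixes
the root is a rooted automorphism. -/
def autOfInverse (f f' : List Bool → List Bool) (h0 : f [] = []) (hl : ∀ w, f' (f w) = w)
    (hr : ∀ w, f (f' w) = w)
    (h1 : ∀ (w : List Bool) (x : Bool), ∃ y : Bool, f (w ++ [x]) = f w ++ [y])
    (h2 : ∀ (w : List Bool) (x : Bool), ∃ y : Bool, f' (w ++ [x]) = f' w ++ [y]) : treeAut :=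
  have key : ∀ (k : List Bool → List Bool),
      (∀ (w : List Bool) (x : Bool), ∃ y : Bool, k (w ++ [x]) = k w ++ [y]) →
      ∀ u v, binaryTree.Adj u v → binaryTree.Adj (k u) (k v) := by
    rintro k hk u v (⟨x, rfl⟩ | ⟨x, rfl⟩)
    · exact Or.inl (hk u x)
    · exact Or.inr (hk v x)
  ⟨{ toFun := f
     invFun := f'
     left_inv := hl
     right_inv := hr
     map_rel_iff' := fun {u v} =>
       ⟨fun h => by simpa [hl] using key f' h2 _ _ h, key f h1 u v⟩ }, h0⟩

theorem treeAut_map_append_list (g : treeAut) (u v : List Bool) :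
    ∃ t : List Bool, g.1 (u ++ v) = g.1 u ++ t := by
  induction v using List.reverseRecOn with
  | nil => exact ⟨[], by simp⟩
  | append_singleton w z ih =>
    obtain ⟨t, ht⟩ := ih
    obtain ⟨y, hy⟩ := treeAut_map_append g (u ++ w) z
    refine ⟨t ++ [y], ?_⟩
    rw [← List.append_assoc, hy, ht, List.append_assoc]

theorem treeAut_append_drop (g : treeAut) (u v : List Bool) :
    g.1 (u ++ v) = g.1 u ++ (g.1 (u ++ v)).drop u.length := by
  obtain ⟨t, ht⟩ := treeAut_map_append_list g u v
  rw [ht, ← treeAut_length g u, List.drop_left]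

/-- The section of `g` at the vertex `p`. -/
def treeSection (g : treeAut) (p : List Bool) : treeAut :=
  autOfInverse (fun w => (g.1 (p ++ w)).drop p.length)
    (fun w => ((g⁻¹).1 (g.1 p ++ w)).drop p.length)
    (by
      have := treeAut_length g p
      simp [← this])
    (fun w => by
      rw [← treeAut_append_drop, treeAut_inv_apply_self, List.drop_left])
    (fun w => by
      have h := treeAut_append_drop g⁻¹ (g.1 p) w
      rw [treeAut_inv_apply_self, treeAut_length] at h
      rw [← h, treeAut_apply_inv_self, ← treeAut_length g p, List.drop_left])
    (fun w x => by
      obtain ⟨y, hy⟩ := treeAut_map_append g (p ++ w) x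
      refine ⟨y, ?_⟩
      rw [← List.append_assoc, hy, List.drop_append_of_le_length]
      rw [treeAut_length]; simp)
    (fun w x => by
      obtain ⟨y, hy⟩ := treeAut_map_append g⁻¹ (g.1 p ++ w) x
      refine ⟨y, ?_⟩
      rw [← List.append_assoc, hy, List.drop_append_of_le_length]
      rw [treeAut_length]; simp [treeAut_length])

theorem treeSection_spec (g : treeAut) (p w : List Bool) :
    g.1 (p ++ w) = g.1 p ++ (treeSection g p).1 w :=
  treeAut_append_drop g p w

/-- The automorphism acting on the two subtrees below the root as `g` and `h`. -/
def pair (g h : treeAut) : treeAut :=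
  autOfInverse
    (fun w => match w with
      | [] => []
      | false :: w => false :: g.1 w
      | true :: w => true :: h.1 w)
    (fun w => match w with
      | [] => []
      | false :: w => false :: (g⁻¹).1 w
      | true :: w => true :: (h⁻¹).1 w)
    rfl
    (by rintro (_ | ⟨_ | _, w⟩) <;> simp)
    (by rintro (_ | ⟨_ | _, w⟩) <;> simp)
    (by
      rintro (_ | ⟨_ | _, w⟩) x
      · cases x
        · exact ⟨false, congrArg _ (treeAut_map_nil g)⟩
        · exact ⟨true, congrArg (List.cons true) (treeAut_map_nil h)⟩
      · obtain ⟨y, hy⟩ := treeAut_map_append g w x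
        exact ⟨y, congrArg _ hy⟩
      · obtain ⟨y, hy⟩ := treeAut_map_append h w x
        exact ⟨y, congrArg _ hy⟩)
    (by
      rintro (_ | ⟨_ | _, w⟩) x
      · cases x
        · exact ⟨false, congrArg _ (treeAut_map_nil g⁻¹)⟩
        · exact ⟨true, congrArg (List.cons true) (treeAut_map_nil h⁻¹)⟩
      · obtain ⟨y, hy⟩ := treeAut_map_append g⁻¹ w x
        exact ⟨y, congrArg _ hy⟩
      · obtain ⟨y, hy⟩ := treeAut_map_append h⁻¹ w x
        exact ⟨y, congrArg _ hy⟩)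

@[simp] theorem pair_nil (g h : treeAut) : (pair g h).1 [] = [] := rfl

@[simp] theorem pair_false (g h : treeAut) (w : List Bool) :
    (pair g h).1 (false :: w) = false :: g.1 w := rfl

@[simp] theorem pair_true (g h : treeAut) (w : List Bool) :
    (pair g h).1 (true :: w) = true :: h.1 w := rfl

theorem pair_mul (g h g' h' : treeAut) : pair g h * pair g' h' = pair (g * g') (h * h') := by
  refine treeAut_ext ?_
  rintro (_ | ⟨_ | _, w⟩) <;> rfl

@[simp] theorem pair_one : pair 1 1 = 1 := by
  refine treeAut_ext ?_
  rintro (_ | ⟨_ | _, w⟩) <;> rfl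

/-- `pair` as a homomorphism. -/
def pairHom : treeAut × treeAut →* treeAut where
  toFun p := pair p.1 p.2
  map_one' := pair_one
  map_mul' p q := (pair_mul p.1 p.2 q.1 q.2).symm

theorem pair_inv (g h : treeAut) : (pair g h)⁻¹ = pair g⁻¹ h⁻¹ :=
  (map_inv pairHom (g, h)).symm

theorem pair_pow (g h : treeAut) (n : ℕ) : pair g h ^ n = pair (g ^ n) (h ^ n) :=
  (map_pow pairHom (g, h) n).symm

theorem pair_commutator (g h g' h' : treeAut) :
    ⁅pair g h, pair g' h'⁆ = pair ⁅g, g'⁆ ⁅h, h'⁆ := by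
  simp only [commutatorElement_def, pair_inv, pair_mul]

theorem pair_injective {g h g' h' : treeAut} (H : pair g h = pair g' h') : g = g' ∧ h = h' := by
  constructor
  · refine treeAut_ext fun w => ?_
    have := congrArg (fun s : treeAut => s.1 (false :: w)) H
    simpa using this
  · refine treeAut_ext fun w => ?_
    have := congrArg (fun s : treeAut => s.1 (true :: w)) H
    simpa using this

theorem pairHom_injective : Function.Injective pairHom := fun _ _ h =>
  Prod.ext (pair_injective h).1 (pair_injective h).2

theorem exists_eq_pair {s : treeAut} (hs : s ∈ levelStabilizer 1) : ∃ g h, s = pair g h := by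
  refine ⟨treeSection s [false], treeSection s [true], treeAut_ext ?_⟩
  rintro (_ | ⟨_ | _, w⟩)
  · exact treeAut_map_nil s
  · have := treeSection_spec s [false] w
    rw [hs [false] rfl] at this
    simpa using this
  · have := treeSection_spec s [true] w
    rw [hs [true] rfl] at this
    simpa using this

theorem pair_mem_levelStabilizer_succ {g h : treeAut} {n : ℕ} :
    pair g h ∈ levelStabilizer (n + 1) ↔ g ∈ levelStabilizer n ∧ h ∈ levelStabilizer n := by
  constructor
  · intro H
    constructor
    · intro v hv
      simpa using H (false :: v) (by simp [hv])
    · intro v hv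
      simpa using H (true :: v) (by simp [hv])
  · rintro ⟨hg, hh⟩ (_ | ⟨_ | _, w⟩) hv
    · simp at hv
    · simpa using hg w (by simpa using hv)
    · simpa using hh w (by simpa using hv)

theorem mem_levelStabilizer_zero (g : treeAut) : g ∈ levelStabilizer 0 := by
  intro v hv
  rw [List.length_eq_zero_iff.1 hv]
  exact treeAut_map_nil g

theorem eq_one_of_mem_levelStabilizer {g : treeAut} (h : ∀ n, g ∈ levelStabilizer n) : g = 1 :=
  treeAut_ext fun w => h w.length w rfl

/-! ### The generators -/

theorem grigA_mul_self : grigA * grigA = 1 := treeAut_ext actA_invol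
theorem grigB_mul_self : grigB * grigB = 1 := treeAut_ext fun w => (actBCD_invol w).1
theorem grigC_mul_self : grigC * grigC = 1 := treeAut_ext fun w => (actBCD_invol w).2.1
theorem grigD_mul_self : grigD * grigD = 1 := treeAut_ext fun w => (actBCD_invol w).2.2

theorem grigA_inv : grigA⁻¹ = grigA := inv_eq_of_mul_eq_one_left grigA_mul_self
theorem grigB_inv : grigB⁻¹ = grigB := inv_eq_of_mul_eq_one_left grigB_mul_self
theorem grigC_inv : grigC⁻¹ = grigC := inv_eq_of_mul_eq_one_left grigC_mul_self
theorem grigD_inv : grigD⁻¹ = grigD := inv_eq_of_mul_eq_one_left grigD_mul_self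

theorem grigB_eq : grigB = pair grigA grigC := by
  refine treeAut_ext ?_
  rintro (_ | ⟨_ | _, w⟩) <;> simp [grigB, grigA, grigC, autOfInvol, actB]

theorem grigC_eq : grigC = pair grigA grigD := by
  refine treeAut_ext ?_
  rintro (_ | ⟨_ | _, w⟩) <;> simp [grigD, grigA, grigC, autOfInvol, actC]

theorem grigD_eq : grigD = pair 1 grigB := by
  refine treeAut_ext ?_
  rintro (_ | ⟨_ | _, w⟩) <;> simp [grigD, grigB, autOfInvol, actD]

theorem grigA_conj_pair (g h : treeAut) : grigA * pair g h * grigA = pair h g := by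
  refine treeAut_ext ?_
  rintro (_ | ⟨_ | _, w⟩) <;> rfl

theorem actBCD_comp (w : List Bool) :
    actB (actC w) = actD w ∧ actC (actB w) = actD w ∧ actB (actD w) = actC w ∧
      actD (actB w) = actC w ∧ actC (actD w) = actB w ∧ actD (actC w) = actB w := by
  induction w with
  | nil => simp [actB, actC, actD]
  | cons x w ih =>
    obtain ⟨h1, h2, h3, h4, h5, h6⟩ := ih
    cases x <;> simp [actB, actC, actD, actA_invol, *]

theorem grigB_mul_grigC : grigB * grigC = grigD := treeAut_ext fun w => (actBCD_comp w).1
theorem grigC_mul_grigB : grigC * grigB = grigD := treeAut_ext fun w => (actBCD_comp w).2.1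
theorem grigB_mul_grigD : grigB * grigD = grigC := treeAut_ext fun w => (actBCD_comp w).2.2.1
theorem grigD_mul_grigB : grigD * grigB = grigC := treeAut_ext fun w => (actBCD_comp w).2.2.2.1
theorem grigC_mul_grigD : grigC * grigD = grigB := treeAut_ext fun w => (actBCD_comp w).2.2.2.2.1
theorem grigD_mul_grigC : grigD * grigC = grigB := treeAut_ext fun w => (actBCD_comp w).2.2.2.2.2

/-- For `h = 1` this is the antidiagonal element `pair g g⁻¹`; such elements are what distinguishes
`γ_{2m}` from `γ_{2m+1}`. -/
theorem commutator_pair_grigA (g h : treeAut) :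
    ⁅pair g h, grigA⁆ = pair (g * h⁻¹) (h * g⁻¹) := by
  rw [commutatorElement_def, grigA_inv, pair_inv, mul_assoc (pair g h), mul_assoc (pair g h),
    grigA_conj_pair, pair_mul]

/-! ### The congruence topology -/

theorem treeAut_nhds_hasBasis (g : treeAut) :
    (𝓝 g).HasBasis (fun _ : ℕ => True) fun n => {h | g⁻¹ * h ∈ levelStabilizer n} := by
  refine ⟨fun s => ?_⟩
  have h := (congruenceBasis.nhds_hasBasis g).mem_iff (t := s)
  refine Iff.trans h ?_
  constructor
  · rintro ⟨_, ⟨n, rfl⟩, hn⟩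
    exact ⟨n, trivial, fun y hy => hn ⟨_, hy, by simp⟩⟩
  · rintro ⟨n, -, hn⟩
    refine ⟨_, ⟨n, rfl⟩, ?_⟩
    rintro _ ⟨y, hy, rfl⟩
    exact hn (by simpa using hy)

theorem isOpen_levelStabilizer (n : ℕ) : IsOpen (levelStabilizer n : Set treeAut) := by
  refine Subgroup.isOpen_of_mem_nhds _ (g := 1) ?_
  exact (treeAut_nhds_hasBasis 1).mem_iff.2 ⟨n, trivial, fun y hy => by simpa using hy⟩

theorem mem_closure_treeAut {s : Set treeAut} {g : treeAut} :
    g ∈ closure s ↔ ∀ n, ∃ h ∈ s, g⁻¹ * h ∈ levelStabilizer n := by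
  rw [mem_closure_iff_nhds_basis (treeAut_nhds_hasBasis g)]
  simp

theorem mem_of_approx {s : Set treeAut} (hs : IsClosed s) {g : treeAut}
    (h : ∀ n, ∃ h ∈ s, g⁻¹ * h ∈ levelStabilizer n) : g ∈ s := by
  rw [← hs.closure_eq]
  exact mem_closure_treeAut.2 h

theorem isClosed_of_approx {s : Set treeAut}
    (H : ∀ g, (∀ n, ∃ h ∈ s, g⁻¹ * h ∈ levelStabilizer n) → g ∈ s) : IsClosed s := by
  rw [← closure_subset_iff_isClosed]
  exact fun g hg => H g (mem_closure_treeAut.1 hg)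

instance treeAut_t1 : T1Space treeAut := by
  refine ⟨fun g => isClosed_of_approx fun h hh => ?_⟩
  have : h⁻¹ * g = 1 := eq_one_of_mem_levelStabilizer fun n => by
    obtain ⟨_, rfl, hn⟩ := hh n
    exact hn
  exact (inv_mul_eq_one.1 this)

theorem continuous_pair : Continuous fun p : treeAut × treeAut => pair p.1 p.2 := by
  change Continuous pairHom
  refine continuous_of_continuousAt_one _ ?_
  rw [ContinuousAt, map_one, (treeAut_nhds_hasBasis 1).tendsto_right_iff]
  rintro n -
  have h : (levelStabilizer n : Set treeAut) ×ˢ (levelStabilizer n : Set treeAut) ∈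
      𝓝 (1 : treeAut × treeAut) :=
    prod_mem_nhds ((isOpen_levelStabilizer n).mem_nhds (one_mem _))
      ((isOpen_levelStabilizer n).mem_nhds (one_mem _))
  filter_upwards [h] with p hp
  have : pairHom p ∈ levelStabilizer (n + 1) := pair_mem_levelStabilizer_succ.2 hp
  simpa using levelStabilizer_antitone (Nat.le_succ n) this

/-- If `pair g h` is approximated by elements of a set of pairs, then `(g, h)` is. -/
theorem pair_approx {s : Set (treeAut × treeAut)} {k : treeAut}
    (H : ∀ n, ∃ p ∈ s, k⁻¹ * pair p.1 p.2 ∈ levelStabilizer n) :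
    ∃ g h, k = pair g h ∧ ∀ n, ∃ p ∈ s, g⁻¹ * p.1 ∈ levelStabilizer n ∧
      h⁻¹ * p.2 ∈ levelStabilizer n := by
  have hk : k ∈ levelStabilizer 1 := by
    obtain ⟨p, -, hp⟩ := H 1
    have h1 : pair p.1 p.2 ∈ levelStabilizer 1 :=
      pair_mem_levelStabilizer_succ.2 ⟨mem_levelStabilizer_zero _, mem_levelStabilizer_zero _⟩
    have h2 := (levelStabilizer 1).mul_mem hp ((levelStabilizer 1).inv_mem h1)
    simpa using h2
  obtain ⟨g, h, rfl⟩ := exists_eq_pair hk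
  refine ⟨g, h, rfl, fun n => ?_⟩
  obtain ⟨p, hp, hn⟩ := H (n + 1)
  rw [pair_inv, pair_mul, pair_mem_levelStabilizer_succ] at hn
  exact ⟨p, hp, hn⟩

/-! ### The lower 2-central series of a topological group -/

section Generic

variable {G : Type*} [Group G]

theorem sq_mem_squareSubgroup {H : Subgroup G} {x : G} (hx : x ∈ H) : x ^ 2 ∈ squareSubgroup H :=
  Subgroup.subset_closure ⟨x, hx, rfl⟩

theorem squareSubgroup_le {H M : Subgroup G} (h : ∀ x ∈ H, x ^ 2 ∈ M) : squareSubgroup H ≤ M := by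
  rw [squareSubgroup, Subgroup.closure_le]
  rintro _ ⟨x, hx, rfl⟩
  exact h x hx

instance squareSubgroup_normal (H : Subgroup G) [hH : H.Normal] : (squareSubgroup H).Normal := by
  refine ⟨fun n hn g => ?_⟩
  have : squareSubgroup H ≤ (squareSubgroup H).comap (MulAut.conj g).toMonoidHom := by
    refine squareSubgroup_le fun x hx => ?_
    have := sq_mem_squareSubgroup (hH.conj_mem x hx g)
    rw [conj_pow] at this
    exact this
  exact this hn

variable [TopologicalSpace G] [IsTopologicalGroup G]

theorem lowerTwoCentralSeries_succ {n : ℕ} (hn : 1 ≤ n) :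
    lowerTwoCentralSeries G (n + 1) = (⁅lowerTwoCentralSeries G n, (⊤ : Subgroup G)⁆ ⊔
      squareSubgroup (lowerTwoCentralSeries G n)).topologicalClosure := by
  obtain ⟨k, rfl⟩ := Nat.exists_eq_add_of_le' hn
  rw [lowerTwoCentralSeries]

instance lowerTwoCentralSeries_normal (n : ℕ) : (lowerTwoCentralSeries G n).Normal := by
  induction n with
  | zero => rw [lowerTwoCentralSeries]; infer_instance
  | succ n ih =>
    rcases Nat.eq_zero_or_pos n with rfl | hn
    · rw [lowerTwoCentralSeries]; infer_instance
    · rw [lowerTwoCentralSeries_succ hn]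
      exact Subgroup.is_normal_topologicalClosure _

theorem lowerTwoCentralSeries_isClosed (n : ℕ) :
    IsClosed (lowerTwoCentralSeries G n : Set G) := by
  match n with
  | 0 => rw [lowerTwoCentralSeries]; exact isClosed_univ
  | 1 => rw [lowerTwoCentralSeries]; exact isClosed_univ
  | n + 2 => rw [lowerTwoCentralSeries]; exact Subgroup.isClosed_topologicalClosure _

theorem commutator_mem_lowerTwoCentralSeries_succ {n : ℕ} {u : G}
    (hu : u ∈ lowerTwoCentralSeries G n) (g : G) : ⁅u, g⁆ ∈ lowerTwoCentralSeries G (n + 1) := by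
  rcases Nat.eq_zero_or_pos n with rfl | hn
  · rw [lowerTwoCentralSeries]; trivial
  · rw [lowerTwoCentralSeries_succ hn]
    exact Subgroup.le_topologicalClosure _
      (Subgroup.mem_sup_left (Subgroup.commutator_mem_commutator hu (Subgroup.mem_top g)))

theorem sq_mem_lowerTwoCentralSeries_succ {n : ℕ} {u : G}
    (hu : u ∈ lowerTwoCentralSeries G n) : u ^ 2 ∈ lowerTwoCentralSeries G (n + 1) := by
  rcases Nat.eq_zero_or_pos n with rfl | hn
  · rw [lowerTwoCentralSeries]; trivial
  · rw [lowerTwoCentralSeries_succ hn]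
    exact Subgroup.le_topologicalClosure _ (Subgroup.mem_sup_right (sq_mem_squareSubgroup hu))

theorem lowerTwoCentralSeries_succ_le {n : ℕ} (hn : 1 ≤ n) {M : Subgroup G}
    (hM : IsClosed (M : Set G)) (h1 : ∀ u ∈ lowerTwoCentralSeries G n, ∀ g, ⁅u, g⁆ ∈ M)
    (h2 : ∀ u ∈ lowerTwoCentralSeries G n, u ^ 2 ∈ M) : lowerTwoCentralSeries G (n + 1) ≤ M := by
  rw [lowerTwoCentralSeries_succ hn]
  refine Subgroup.topologicalClosure_minimal _ (sup_le ?_ (squareSubgroup_le h2)) hM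
  rw [Subgroup.commutator_le]
  exact fun u hu g _ => h1 u hu g

theorem lowerTwoCentralSeries_antitone : Antitone (lowerTwoCentralSeries G) := by
  refine antitone_nat_of_succ_le fun n => ?_
  rcases Nat.eq_zero_or_pos n with rfl | hn
  · rw [lowerTwoCentralSeries]; exact le_top
  · refine lowerTwoCentralSeries_succ_le hn (lowerTwoCentralSeries_isClosed n)
      (fun u hu g => ?_) (fun u hu => Subgroup.pow_mem _ hu 2)
    rw [commutatorElement_def, mul_assoc, mul_assoc, ← mul_assoc g]
    exact Subgroup.mul_mem _ hu
      ((lowerTwoCentralSeries_normal n).conj_mem _ (Subgroup.inv_mem _ hu) g)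

/-- The elements that commute with `u` modulo `M`. -/
def centralizerMod (M : Subgroup G) [M.Normal] (u : G) : Subgroup G :=
  (Subgroup.centralizer {(u : G ⧸ M)}).comap (QuotientGroup.mk' M)

omit [TopologicalSpace G] [IsTopologicalGroup G] in
theorem mem_centralizerMod {M : Subgroup G} [M.Normal] {u g : G} :
    g ∈ centralizerMod M u ↔ ⁅u, g⁆ ∈ M := by
  rw [centralizerMod, Subgroup.mem_comap, Subgroup.mem_centralizer_singleton_iff,
    ← QuotientGroup.eq_one_iff, QuotientGroup.mk'_apply, ← QuotientGroup.mk'_apply,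
    ← QuotientGroup.mk'_apply, ← QuotientGroup.mk'_apply, map_commutatorElement,
    commutatorElement_eq_one_iff_mul_comm, eq_comm]

theorem isClosed_centralizerMod {M : Subgroup G} [M.Normal] (hM : IsClosed (M : Set G)) (u : G) :
    IsClosed (centralizerMod M u : Set G) := by
  have : (centralizerMod M u : Set G) = (fun g => ⁅u, g⁆) ⁻¹' (M : Set G) := by
    ext g
    exact mem_centralizerMod
  rw [this]
  refine hM.preimage ?_
  simp only [commutatorElement_def]
  fun_prop

omit [TopologicalSpace G] [IsTopologicalGroup G] in
theorem commutator_sq_right (u y : G) : ⁅u, y ^ 2⁆ = ⁅u, y⁆ ^ 2 * ⁅⁅u, y⁆⁻¹, y⁆ := by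
  simp only [commutatorElement_def, pow_two]
  group

omit [TopologicalSpace G] [IsTopologicalGroup G] in
/-- The three subgroups lemma modulo a normal subgroup. -/
theorem commutator_commutator_le_of_rotate {H₁ H₂ H₃ M : Subgroup G} [M.Normal]
    (h1 : ⁅⁅H₂, H₃⁆, H₁⁆ ≤ M) (h2 : ⁅⁅H₃, H₁⁆, H₂⁆ ≤ M) : ⁅⁅H₁, H₂⁆, H₃⁆ ≤ M := by
  have key : ∀ K : Subgroup G, K ≤ M ↔ K.map (QuotientGroup.mk' M) = ⊥ := fun K => by
    rw [Subgroup.map_eq_bot_iff, QuotientGroup.ker_mk']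
  rw [key] at h1 h2 ⊢
  simp only [Subgroup.map_commutator] at h1 h2 ⊢
  exact Subgroup.commutator_commutator_eq_bot_of_rotate h1 h2

/-- The elements commuting with `u` modulo a closed normal subgroup form a closed subgroup, so it
suffices to treat generators of `γ_{j+1}`: commutators by the three subgroups lemma, squares by
`commutator_sq_right`. -/
theorem commutator_mem_lowerTwoCentralSeries_add {i j : ℕ} {u v : G}
    (hu : u ∈ lowerTwoCentralSeries G i) (hv : v ∈ lowerTwoCentralSeries G j) :
    ⁅u, v⁆ ∈ lowerTwoCentralSeries G (i + j) := by
  induction j generalizing i u v with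
  | zero =>
    rw [commutatorElement_def, mul_assoc, mul_assoc, ← mul_assoc v]
    exact Subgroup.mul_mem _ hu
      ((lowerTwoCentralSeries_normal i).conj_mem _ (Subgroup.inv_mem _ hu) v)
  | succ j ih =>
    rcases Nat.eq_zero_or_pos j with rfl | hj
    · exact commutator_mem_lowerTwoCentralSeries_succ hu v
    have hle : lowerTwoCentralSeries G (j + 1) ≤
        centralizerMod (lowerTwoCentralSeries G (i + (j + 1))) u := by
      refine lowerTwoCentralSeries_succ_le hj
        (isClosed_centralizerMod (lowerTwoCentralSeries_isClosed _) u) (fun y hy g => ?_)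
        (fun y hy => ?_)
      · rw [mem_centralizerMod, ← commutatorElement_inv]
        refine Subgroup.inv_mem _ ?_
        have h : ⁅⁅lowerTwoCentralSeries G j, (⊤ : Subgroup G)⁆, lowerTwoCentralSeries G i⁆ ≤
            lowerTwoCentralSeries G (i + (j + 1)) := by
          refine commutator_commutator_le_of_rotate ?_ ?_
          · rw [Subgroup.commutator_le]
            intro p hp q hq
            have : ⁅(⊤ : Subgroup G), lowerTwoCentralSeries G i⁆ ≤
                lowerTwoCentralSeries G (i + 1) := by
              rw [Subgroup.commutator_comm, Subgroup.commutator_le]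
              exact fun r hr s _ => commutator_mem_lowerTwoCentralSeries_succ hr s
            have h := ih (this hp) hq
            rwa [show i + 1 + j = i + (j + 1) by omega] at h
          · rw [Subgroup.commutator_le]
            intro p hp q _
            have : ⁅lowerTwoCentralSeries G i, lowerTwoCentralSeries G j⁆ ≤
                lowerTwoCentralSeries G (i + j) := by
              rw [Subgroup.commutator_le]
              exact fun r hr s hs => ih hr hs
            exact commutator_mem_lowerTwoCentralSeries_succ (this hp) q
        exact h (Subgroup.commutator_mem_commutator
          (Subgroup.commutator_mem_commutator hy (Subgroup.mem_top g)) hu)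
      · rw [mem_centralizerMod, commutator_sq_right]
        have h := ih hu hy
        exact Subgroup.mul_mem _ (sq_mem_lowerTwoCentralSeries_succ h)
          (commutator_mem_lowerTwoCentralSeries_succ (Subgroup.inv_mem _ h) y)
    exact mem_centralizerMod.1 (hle hv)

/-! ### The Jennings–Zassenhaus series -/

theorem jenningsZassenhausSeries_add_two (n : ℕ) :
    jenningsZassenhausSeries G (n + 2) =
      (⁅jenningsZassenhausSeries G (n + 1), (⊤ : Subgroup G)⁆ ⊔
        squareSubgroup (jenningsZassenhausSeries G ((n + 3) / 2))).topologicalClosure := by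
  rw [jenningsZassenhausSeries]

instance jenningsZassenhausSeries_normal (n : ℕ) : (jenningsZassenhausSeries G n).Normal := by
  induction n using Nat.strong_induction_on with
  | _ n ih =>
    match n with
    | 0 => rw [jenningsZassenhausSeries]; infer_instance
    | 1 => rw [jenningsZassenhausSeries]; infer_instance
    | n + 2 =>
      rw [jenningsZassenhausSeries_add_two]
      have h1 := ih (n + 1) (by omega)
      have h2 := ih ((n + 3) / 2) (by omega)
      exact Subgroup.is_normal_topologicalClosure _

theorem lowerTwoCentralSeries_le_jenningsZassenhausSeries (n : ℕ) :
    lowerTwoCentralSeries G n ≤ jenningsZassenhausSeries G n := by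
  induction n using Nat.strong_induction_on with
  | _ n ih =>
    match n with
    | 0 => rw [jenningsZassenhausSeries]; exact le_top
    | 1 => rw [jenningsZassenhausSeries]; exact le_top
    | n + 2 =>
      rw [jenningsZassenhausSeries_add_two]
      refine lowerTwoCentralSeries_succ_le (by omega) (Subgroup.isClosed_topologicalClosure _)
        (fun u hu g => ?_) (fun u hu => ?_)
      · exact Subgroup.le_topologicalClosure _ (Subgroup.mem_sup_left
          (Subgroup.commutator_mem_commutator (ih _ (by omega) hu) (Subgroup.mem_top g)))
      · exact Subgroup.le_topologicalClosure _ (Subgroup.mem_sup_right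
          (sq_mem_squareSubgroup
            (ih _ (by omega) (lowerTwoCentralSeries_antitone (by omega) hu))))

end Generic

/-! ### The Jennings–Zassenhaus series through the lower 2-central series -/

section Generic

variable {G : Type*} [Group G]

theorem sq_mul_sq_eq (y z : G) : y ^ 2 * z ^ 2 = y * ⁅y, z⁆ * y⁻¹ * (y * z) ^ 2 := by
  simp only [commutatorElement_def, pow_two]
  group

theorem mul_sq_eq (y z : G) : (y * z) ^ 2 = y * ⁅y, z⁆⁻¹ * y⁻¹ * (y ^ 2 * z ^ 2) := by
  simp only [commutatorElement_def, pow_two]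
  group

variable [TopologicalSpace G] [IsTopologicalGroup G]

variable (G) in
/-- The product `γₙ γ_{⌈n/2⌉}²`. -/
def lazardSubgroup (n : ℕ) : Subgroup G where
  carrier := {z | ∃ g ∈ lowerTwoCentralSeries G n,
    ∃ y ∈ lowerTwoCentralSeries G ((n + 1) / 2), z = g * y ^ 2}
  one_mem' := ⟨1, one_mem _, 1, one_mem _, by simp⟩
  mul_mem' := by
    rintro _ _ ⟨g, hg, y, hy, rfl⟩ ⟨h, hh, z, hz, rfl⟩
    -- Squaring is multiplicative on `γ_{⌈n/2⌉}` modulo `γₙ`, because `⁅y, z⁆` has weight `2⌈n/2⌉ ≥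
    -- n`.
    refine ⟨g * (y ^ 2 * h * (y ^ 2)⁻¹) * (y * ⁅y, z⁆ * y⁻¹), ?_, y * z, mul_mem hy hz, ?_⟩
    · refine mul_mem (mul_mem hg ((lowerTwoCentralSeries_normal n).conj_mem _ hh _)) ?_
      exact (lowerTwoCentralSeries_normal n).conj_mem _ (lowerTwoCentralSeries_antitone (by omega)
        (commutator_mem_lowerTwoCentralSeries_add hy hz)) _
    · rw [mul_assoc _ (y * ⁅y, z⁆ * y⁻¹), ← sq_mul_sq_eq]
      group
  inv_mem' := by
    rintro _ ⟨g, hg, y, hy, rfl⟩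
    refine ⟨(y ^ 2)⁻¹ * g⁻¹ * (y ^ 2)⁻¹⁻¹,
      (lowerTwoCentralSeries_normal n).conj_mem _ (inv_mem hg) _, y⁻¹, inv_mem hy, ?_⟩
    group

theorem mem_lazardSubgroup {n : ℕ} {z : G} : z ∈ lazardSubgroup G n ↔
    ∃ g ∈ lowerTwoCentralSeries G n, ∃ y ∈ lowerTwoCentralSeries G ((n + 1) / 2), z = g * y ^ 2 :=
  Iff.rfl

theorem lowerTwoCentralSeries_le_lazardSubgroup (n : ℕ) :
    lowerTwoCentralSeries G n ≤ lazardSubgroup G n :=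
  fun g hg => ⟨g, hg, 1, one_mem _, by simp⟩

theorem sq_mem_lazardSubgroup {n k : ℕ} (h : n ≤ 2 * k) {y : G}
    (hy : y ∈ lowerTwoCentralSeries G k) : y ^ 2 ∈ lazardSubgroup G n :=
  ⟨1, one_mem _, y, lowerTwoCentralSeries_antitone (by omega) hy, by simp⟩

theorem mem_lazardSubgroup_of_mem {n k : ℕ} (h : n ≤ k) {y : G}
    (hy : y ∈ lowerTwoCentralSeries G k) : y ∈ lazardSubgroup G n :=
  lowerTwoCentralSeries_le_lazardSubgroup n (lowerTwoCentralSeries_antitone h hy)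

instance lazardSubgroup_normal (n : ℕ) : (lazardSubgroup G n).Normal := by
  refine ⟨?_⟩
  rintro _ ⟨g, hg, y, hy, rfl⟩ h
  refine ⟨h * g * h⁻¹, (lowerTwoCentralSeries_normal _).conj_mem _ hg _, h * y * h⁻¹,
    (lowerTwoCentralSeries_normal _).conj_mem _ hy _, ?_⟩
  rw [conj_pow]
  group

theorem lazardSubgroup_antitone : Antitone (lazardSubgroup G) := by
  rintro m n hmn _ ⟨g, hg, y, hy, rfl⟩
  exact ⟨g, lowerTwoCentralSeries_antitone hmn hg, y,
    lowerTwoCentralSeries_antitone (by omega) hy, rfl⟩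

theorem lazardSubgroup_le (n : ℕ) : lazardSubgroup G n ≤ lowerTwoCentralSeries G ((n + 1) / 2) := by
  rintro _ ⟨g, hg, y, hy, rfl⟩
  exact mul_mem (lowerTwoCentralSeries_antitone (by omega) hg) (pow_mem hy 2)

/-- Elements of `γ_m` commute with squares of elements of `γ_k` modulo the Lazard subgroup. -/
theorem commutator_sq_mem_lazardSubgroup {m k n : ℕ} (h1 : n ≤ 2 * (m + k)) (h2 : n ≤ m + 2 * k)
    {g y : G} (hg : g ∈ lowerTwoCentralSeries G m) (hy : y ∈ lowerTwoCentralSeries G k) :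
    ⁅g, y ^ 2⁆ ∈ lazardSubgroup G n := by
  have h := commutator_mem_lowerTwoCentralSeries_add hg hy
  rw [commutator_sq_right]
  refine mul_mem (sq_mem_lazardSubgroup h1 h) ?_
  exact mem_lazardSubgroup_of_mem (by omega)
    (commutator_mem_lowerTwoCentralSeries_add (inv_mem h) hy)

theorem commutator_mem_lazardSubgroup_succ {n : ℕ} {z : G} (hz : z ∈ lazardSubgroup G n) (h : G) :
    ⁅z, h⁆ ∈ lazardSubgroup G (n + 1) := by
  obtain ⟨g, hg, y, hy, rfl⟩ := hz
  rw [commutatorElement_mul_left_eq_conj_mul]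
  refine mul_mem ((lazardSubgroup_normal _).conj_mem _ ?_ _)
    (lowerTwoCentralSeries_le_lazardSubgroup _ (commutator_mem_lowerTwoCentralSeries_succ hg h))
  have h' : ⁅h, y⁆ ∈ lowerTwoCentralSeries G ((n + 1) / 2 + 1) := by
    rw [← commutatorElement_inv]
    exact inv_mem (commutator_mem_lowerTwoCentralSeries_succ hy h)
  rw [← commutatorElement_inv, commutator_sq_right]
  refine inv_mem (mul_mem (sq_mem_lazardSubgroup (by omega) h') ?_)
  exact mem_lazardSubgroup_of_mem (by omega)
    (commutator_mem_lowerTwoCentralSeries_add (inv_mem h') hy)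

/-- The square of `g y²` is `g² ⁅g⁻¹, y²⁆ y⁴`. The first two factors are controlled by weights
alone; the hypothesis `R` supplies exactly the third. -/
theorem sq_mem_lazardSubgroup_two_mul
    (R : ∀ j, 1 ≤ j → ∀ y ∈ lowerTwoCentralSeries G j, y ^ 4 ∈ lazardSubgroup G (4 * j))
    {m : ℕ} (hm : 1 ≤ m) {z : G} (hz : z ∈ lazardSubgroup G m) :
    z ^ 2 ∈ lazardSubgroup G (2 * m) := by
  obtain ⟨g, hg, y, hy, rfl⟩ := hz
  have h1 : (g * y ^ 2) ^ 2 = g ^ 2 * ⁅g⁻¹, y ^ 2⁆ * y ^ 4 := by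
    rw [show y ^ 4 = y ^ 2 * y ^ 2 by rw [← pow_add]]
    generalize y ^ 2 = w
    simp only [commutatorElement_def, pow_two]
    group
  rw [h1]
  refine mul_mem (mul_mem (sq_mem_lazardSubgroup le_rfl hg) ?_) ?_
  · exact commutator_sq_mem_lazardSubgroup (by omega) (by omega) (inv_mem hg) hy
  · exact lazardSubgroup_antitone (by omega) (R _ (by omega) y hy)

/-- The products `γₙ γ_{⌈n/2⌉}²` absorb the commutators and squares that define `Dₙ`, and conversely
`γₙ ≤ Dₙ` puts both factors in `Dₙ`. Openness of `γₙ` makes the product closed. -/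
theorem jenningsZassenhausSeries_eq_lazardSubgroup
    (hopen : ∀ n, IsOpen (lowerTwoCentralSeries G n : Set G))
    (R : ∀ j, 1 ≤ j → ∀ y ∈ lowerTwoCentralSeries G j, y ^ 4 ∈ lazardSubgroup G (4 * j))
    (n : ℕ) : jenningsZassenhausSeries G n = lazardSubgroup G n := by
  induction n using Nat.strong_induction_on with
  | _ n ih =>
    match n with
    | 0 =>
      rw [jenningsZassenhausSeries, eq_comm, eq_top_iff]
      refine le_trans ?_ (lowerTwoCentralSeries_le_lazardSubgroup 0)
      rw [lowerTwoCentralSeries]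
    | 1 =>
      rw [jenningsZassenhausSeries, eq_comm, eq_top_iff]
      refine le_trans ?_ (lowerTwoCentralSeries_le_lazardSubgroup 1)
      rw [lowerTwoCentralSeries]
    | n + 2 =>
      apply le_antisymm
      · rw [jenningsZassenhausSeries_add_two, ih (n + 1) (by omega), ih ((n + 3) / 2) (by omega)]
        refine Subgroup.topologicalClosure_minimal _ (sup_le ?_ ?_) ?_
        · rw [Subgroup.commutator_le]
          exact fun z hz g _ => commutator_mem_lazardSubgroup_succ hz g
        · exact squareSubgroup_le fun z hz =>
            lazardSubgroup_antitone (by omega) (sq_mem_lazardSubgroup_two_mul R (by omega) hz)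
        · exact Subgroup.isClosed_of_isOpen _
            (Subgroup.isOpen_mono (lowerTwoCentralSeries_le_lazardSubgroup _) (hopen _))
      · rintro _ ⟨g, hg, y, hy, rfl⟩
        refine mul_mem (lowerTwoCentralSeries_le_jenningsZassenhausSeries _ hg) ?_
        rw [jenningsZassenhausSeries_add_two]
        exact Subgroup.le_topologicalClosure _ (Subgroup.mem_sup_right
          (sq_mem_squareSubgroup (lowerTwoCentralSeries_le_jenningsZassenhausSeries _ hy)))

/-- The fourth power map is multiplicative on `γ_i` modulo the Lazard subgroup of index `4i`. -/
theorem mul_pow_four_mem_lazardSubgroup {i : ℕ} {y z : G}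
    (hy : y ∈ lowerTwoCentralSeries G i) (hz : z ∈ lowerTwoCentralSeries G i)
    (hy4 : y ^ 4 ∈ lazardSubgroup G (4 * i)) (hz4 : z ^ 4 ∈ lazardSubgroup G (4 * i)) :
    (y * z) ^ 4 ∈ lazardSubgroup G (4 * i) := by
  set P := lazardSubgroup G (4 * i) with hP
  have hcomm : ⁅y, z⁆⁻¹ ∈ lowerTwoCentralSeries G (i + i) :=
    inv_mem (commutator_mem_lowerTwoCentralSeries_add hy hz)
  set t := y * ⁅y, z⁆⁻¹ * y⁻¹ with ht
  have htm : t ∈ lowerTwoCentralSeries G (i + i) :=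
    (lowerTwoCentralSeries_normal _).conj_mem _ hcomm _
  have ht2 : t ^ 2 ∈ P := sq_mem_lazardSubgroup (by omega) htm
  have hty : ⁅t, y ^ 2⁆ ∈ P := commutator_sq_mem_lazardSubgroup (by omega) (by omega) htm hy
  have htz : ⁅t, z ^ 2⁆ ∈ P := commutator_sq_mem_lazardSubgroup (by omega) (by omega) htm hz
  -- With `f = ⁅z, y⁆`, of weight `2i`, the commutator `⁅z, y²⁆` is `f² ⁅f⁻¹, y⁆`. Here `f²` lies in
  -- `P`, and a further commutator of `⁅f⁻¹, y⁆` has weight `4i`.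
  have hyz : ⁅y ^ 2, z ^ 2⁆ ∈ P := by
    have hf : ⁅z, y⁆ ∈ lowerTwoCentralSeries G (i + i) :=
      commutator_mem_lowerTwoCentralSeries_add hz hy
    have hh : ⁅⁅z, y⁆⁻¹, y⁆ ∈ lowerTwoCentralSeries G (i + i + i) :=
      commutator_mem_lowerTwoCentralSeries_add (inv_mem hf) hy
    have he : ⁅y ^ 2, z⁆⁻¹ = ⁅z, y⁆ ^ 2 * ⁅⁅z, y⁆⁻¹, y⁆ := by
      rw [commutatorElement_inv, commutator_sq_right]
    have hem : ⁅y ^ 2, z⁆⁻¹ ∈ lowerTwoCentralSeries G (i + i) := by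
      rw [he]
      exact mul_mem (pow_mem hf 2) (lowerTwoCentralSeries_antitone (by omega) hh)
    rw [commutator_sq_right]
    refine mul_mem (sq_mem_lazardSubgroup (k := i + i) (by omega) (inv_mem_iff.1 hem)) ?_
    rw [he, commutatorElement_mul_left_eq_conj_mul]
    refine mul_mem ((lazardSubgroup_normal _).conj_mem _ ?_ _) ?_
    · exact mem_lazardSubgroup_of_mem (by omega) (commutator_mem_lowerTwoCentralSeries_add hh hz)
    · rw [commutatorElement_def, mul_assoc, mul_assoc, ← mul_assoc z]
      have hf2 : ⁅z, y⁆ ^ 2 ∈ P := sq_mem_lazardSubgroup (by omega) hf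
      exact mul_mem hf2 ((lazardSubgroup_normal _).conj_mem _ (inv_mem hf2) _)
  rw [← QuotientGroup.eq_one_iff] at *
  have c1 : Commute (t : G ⧸ P) ((y : G ⧸ P) ^ 2) := by
    rw [← commutatorElement_eq_one_iff_commute]
    exact hty
  have c2 : Commute (t : G ⧸ P) ((z : G ⧸ P) ^ 2) := by
    rw [← commutatorElement_eq_one_iff_commute]
    exact htz
  have c3 : Commute ((y : G ⧸ P) ^ 2) ((z : G ⧸ P) ^ 2) := by
    rw [← commutatorElement_eq_one_iff_commute]
    exact hyz
  -- Modulo `P` the elements `t`, `y²`, `z²` commute and `t²` vanishes, so squaring `(yz)² = t y²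
  -- z²` leaves `y⁴ z⁴`.
  have e1 : (y * z) ^ 4 = (t * (y ^ 2 * z ^ 2)) ^ 2 := by
    rw [ht, ← mul_sq_eq, ← pow_mul]
  rw [e1]
  simp only [QuotientGroup.mk_pow, QuotientGroup.mk_mul] at *
  rw [(c1.mul_right c2).mul_pow, c3.mul_pow, ht2, ← pow_mul, ← pow_mul, hy4, hz4]
  simp

/-! ### Bounded coverings by cosets -/

omit [TopologicalSpace G] [IsTopologicalGroup G] in
/-- `H` is covered by at most `C` left cosets of `K`. -/
def CosetCover (H K : Subgroup G) (C : ℕ) : Prop :=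
  ∃ R : Finset G, R.card ≤ C ∧ ∀ h ∈ H, ∃ r ∈ R, r⁻¹ * h ∈ K

omit [TopologicalSpace G] [IsTopologicalGroup G] in
theorem CosetCover.mono {H K : Subgroup G} {C C' : ℕ} (h : CosetCover H K C) (hC : C ≤ C') :
    CosetCover H K C' :=
  ⟨h.choose, h.choose_spec.1.trans hC, h.choose_spec.2⟩

omit [TopologicalSpace G] [IsTopologicalGroup G] in
theorem CosetCover.trans {H K L : Subgroup G} {C C' : ℕ} (h : CosetCover H K C)
    (h' : CosetCover K L C') : CosetCover H L (C * C') := by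
  classical
  obtain ⟨R, hR, h⟩ := h
  obtain ⟨R', hR', h'⟩ := h'
  refine ⟨(R ×ˢ R').image fun p => p.1 * p.2, ?_, fun x hx => ?_⟩
  · refine Finset.card_image_le.trans ?_
    rw [Finset.card_product]
    exact Nat.mul_le_mul hR hR'
  · obtain ⟨r, hr, h1⟩ := h x hx
    obtain ⟨r', hr', h2⟩ := h' _ h1
    refine ⟨r * r', Finset.mem_image.2 ⟨(r, r'), Finset.mem_product.2 ⟨hr, hr'⟩, rfl⟩, ?_⟩
    rwa [mul_inv_rev, mul_assoc]

omit [TopologicalSpace G] [IsTopologicalGroup G] in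
theorem CosetCover.relIndex {H K : Subgroup G} {C : ℕ} (h : CosetCover H K C) :
    K.relIndex H ≠ 0 ∧ K.relIndex H ≤ C := by
  classical
  obtain ⟨R, hR, h⟩ := h
  choose! r hr hrK using h
  have hinj : ∀ x y : H, r x = r y → (x : H ⧸ K.subgroupOf H) = y := by
    intro x y hxy
    rw [QuotientGroup.eq, Subgroup.mem_subgroupOf]
    have h1 := hrK x x.2
    have h2 := hrK y y.2
    rw [hxy] at h1
    have := mul_mem (inv_mem h1) h2
    simpa [mul_assoc] using this
  let f : H ⧸ K.subgroupOf H → R := fun q => ⟨r q.out, hr _ q.out.2⟩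
  have hf : Function.Injective f := by
    intro p q hpq
    have := hinj p.out q.out (congrArg Subtype.val hpq)
    simpa using this
  have hfin : Finite (H ⧸ K.subgroupOf H) := Finite.of_injective f hf
  refine ⟨(Subgroup.finiteIndex_of_finite_quotient (H := K.subgroupOf H)).index_ne_zero, ?_⟩
  refine le_trans ?_ hR
  have := Nat.card_le_card_of_injective f hf
  simpa [Subgroup.relIndex, Subgroup.index] using this

omit [TopologicalSpace G] [IsTopologicalGroup G] in
theorem CosetCover.of_relIndex {H K : Subgroup G} (h : K.relIndex H ≠ 0) :
    CosetCover H K (K.relIndex H) := by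
  classical
  have hfin : Finite (H ⧸ K.subgroupOf H) :=
    Subgroup.finiteIndex_iff_finite_quotient.1 ⟨h⟩
  have := Fintype.ofFinite (H ⧸ K.subgroupOf H)
  refine ⟨(Finset.univ : Finset (H ⧸ K.subgroupOf H)).image fun q => (q.out : G), ?_, fun x hx => ?_⟩
  · refine Finset.card_image_le.trans ?_
    rw [Finset.card_univ, Subgroup.relIndex, Subgroup.index, Nat.card_eq_fintype_card]
  · refine ⟨_, Finset.mem_image.2 ⟨((⟨x, hx⟩ : H) : H ⧸ K.subgroupOf H), Finset.mem_univ _, rfl⟩, ?_⟩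
    have h1 := QuotientGroup.out_eq' ((⟨x, hx⟩ : H) : H ⧸ K.subgroupOf H)
    rw [QuotientGroup.eq, Subgroup.mem_subgroupOf] at h1
    exact h1

/-- Products `s r²` of representatives for the two factors suffice: if `y = r y'` with `y'` in the
next term, then `y² ≡ r² y'²`, since `⁅r, y'⁆` has weight at least `n + 1`. -/
theorem CosetCover.lazardSubgroup {n C : ℕ}
    (h1 : CosetCover (lowerTwoCentralSeries G n) (lowerTwoCentralSeries G (n + 1)) C)
    (h2 : CosetCover (lowerTwoCentralSeries G ((n + 1) / 2))
      (lowerTwoCentralSeries G ((n + 1) / 2 + 1)) C) :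
    CosetCover (lazardSubgroup G n) (lazardSubgroup G (n + 1)) (C * C) := by
  classical
  obtain ⟨R, hR, h1⟩ := h1
  obtain ⟨S, hS, h2⟩ := h2
  refine ⟨(R ×ˢ S).image fun p => p.1 * p.2 ^ 2, ?_, ?_⟩
  · refine Finset.card_image_le.trans ?_
    rw [Finset.card_product]
    exact Nat.mul_le_mul hR hS
  · rintro _ ⟨g, hg, y, hy, rfl⟩
    obtain ⟨s, hs, hg'⟩ := h1 g hg
    obtain ⟨r, hr, hy'⟩ := h2 y hy
    refine ⟨s * r ^ 2, Finset.mem_image.2 ⟨(s, r), Finset.mem_product.2 ⟨hs, hr⟩, rfl⟩, ?_⟩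
    have hrm : r ∈ lowerTwoCentralSeries G ((n + 1) / 2) := by
      have := mul_mem hy (inv_mem (lowerTwoCentralSeries_antitone (Nat.le_succ _) hy'))
      simpa using this
    have e : (s * r ^ 2)⁻¹ * (g * y ^ 2) = ((r ^ 2)⁻¹ * ((s⁻¹ * g) *
        (r * ⁅r, r⁻¹ * y⁆⁻¹ * r⁻¹)) * (r ^ 2)⁻¹⁻¹) * (r⁻¹ * y) ^ 2 := by
      simp only [commutatorElement_def, pow_two]
      group
    rw [e]
    refine mul_mem ((lazardSubgroup_normal _).conj_mem _ (mul_mem ?_ ?_) _)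
      (sq_mem_lazardSubgroup (by omega) hy')
    · exact lowerTwoCentralSeries_le_lazardSubgroup _ hg'
    · refine (lazardSubgroup_normal _).conj_mem _ (inv_mem ?_) _
      exact mem_lazardSubgroup_of_mem (by omega) (commutator_mem_lowerTwoCentralSeries_add hrm hy')

end Generic

local notation "Γ" => grigorchukClosure

/-! ### The closure of the Grigorchuk group -/

theorem isClosed_grigorchukClosure : IsClosed (Γ : Set treeAut) :=
  Subgroup.isClosed_topologicalClosure _

theorem grigorchukGroup_le_closure : grigorchukGroup ≤ Γ := Subgroup.le_topologicalClosure _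

theorem grigA_mem_group : grigA ∈ grigorchukGroup := Subgroup.subset_closure (by simp)
theorem grigB_mem_group : grigB ∈ grigorchukGroup := Subgroup.subset_closure (by simp)
theorem grigC_mem_group : grigC ∈ grigorchukGroup := Subgroup.subset_closure (by simp)
theorem grigD_mem_group : grigD ∈ grigorchukGroup := Subgroup.subset_closure (by simp)

theorem grigA_mem : grigA ∈ Γ := grigorchukGroup_le_closure grigA_mem_group
theorem grigB_mem : grigB ∈ Γ := grigorchukGroup_le_closure grigB_mem_group
theorem grigC_mem : grigC ∈ Γ := grigorchukGroup_le_closure grigC_mem_group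
theorem grigD_mem : grigD ∈ Γ := grigorchukGroup_le_closure grigD_mem_group

theorem grigorchukClosure_le {M : Subgroup treeAut} (hM : IsClosed (M : Set treeAut))
    (ha : grigA ∈ M) (hb : grigB ∈ M) (hc : grigC ∈ M) (hd : grigD ∈ M) : Γ ≤ M := by
  refine Subgroup.topologicalClosure_minimal _ ?_ hM
  rw [grigorchukGroup, Subgroup.closure_le]
  rintro _ (rfl | rfl | rfl | rfl) <;> assumption

/-- The pairs of elements of `N`, as a subgroup of the automorphism group of the tree. -/
def pairLift (N : Subgroup treeAut) : Subgroup treeAut := (N.prod N).map pairHom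

theorem mem_pairLift {N : Subgroup treeAut} {s : treeAut} :
    s ∈ pairLift N ↔ ∃ u ∈ N, ∃ v ∈ N, s = pair u v := by
  constructor
  · rintro ⟨⟨u, v⟩, ⟨hu, hv⟩, rfl⟩
    exact ⟨u, hu, v, hv, rfl⟩
  · rintro ⟨u, hu, v, hv, rfl⟩
    exact ⟨(u, v), ⟨hu, hv⟩, rfl⟩

theorem pair_mem_pairLift {N : Subgroup treeAut} {u v : treeAut} :
    pair u v ∈ pairLift N ↔ u ∈ N ∧ v ∈ N := by
  rw [mem_pairLift]
  constructor
  · rintro ⟨u', hu, v', hv, h⟩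
    obtain ⟨rfl, rfl⟩ := pair_injective h
    exact ⟨hu, hv⟩
  · rintro ⟨hu, hv⟩
    exact ⟨u, hu, v, hv, rfl⟩

theorem pairLift_mono {N M : Subgroup treeAut} (h : N ≤ M) : pairLift N ≤ pairLift M := by
  intro s hs
  obtain ⟨u, hu, v, hv, rfl⟩ := mem_pairLift.1 hs
  exact pair_mem_pairLift.2 ⟨h hu, h hv⟩

theorem isClosed_pairLift {N : Subgroup treeAut} (hN : IsClosed (N : Set treeAut)) :
    IsClosed (pairLift N : Set treeAut) := by
  refine isClosed_of_approx fun s hs => ?_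
  obtain ⟨u, v, rfl, h⟩ := pair_approx (s := (N : Set treeAut) ×ˢ (N : Set treeAut)) (k := s)
    fun n => by
      obtain ⟨t, ht, hn⟩ := hs n
      obtain ⟨u, hu, v, hv, rfl⟩ := mem_pairLift.1 ht
      exact ⟨(u, v), ⟨hu, hv⟩, hn⟩
  refine pair_mem_pairLift.2 ⟨mem_of_approx hN fun n => ?_, mem_of_approx hN fun n => ?_⟩
  · obtain ⟨p, hp, h1, -⟩ := h n
    exact ⟨p.1, hp.1, h1⟩
  · obtain ⟨p, hp, -, h2⟩ := h n
    exact ⟨p.2, hp.2, h2⟩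

/-- The automorphisms of the tree whose sections at the first level lie in `N`. -/
def wreathLift (N : Subgroup treeAut) : Subgroup treeAut where
  carrier := {s | s ∈ pairLift N ∨ grigA * s ∈ pairLift N}
  one_mem' := Or.inl (one_mem _)
  mul_mem' := by
    have key : ∀ s ∈ pairLift N, grigA * s * grigA ∈ pairLift N := by
      intro s hs
      obtain ⟨u, hu, v, hv, rfl⟩ := mem_pairLift.1 hs
      rw [grigA_conj_pair]
      exact pair_mem_pairLift.2 ⟨hv, hu⟩
    rintro s t (hs | hs) (ht | ht)
    · exact Or.inl (mul_mem hs ht)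
    · refine Or.inr ?_
      have := mul_mem (key s hs) ht
      simpa [mul_assoc, ← mul_assoc grigA grigA, grigA_mul_self] using this
    · refine Or.inr ?_
      rw [← mul_assoc]
      exact mul_mem hs ht
    · refine Or.inl ?_
      have := mul_mem (key _ hs) ht
      simpa [mul_assoc, ← mul_assoc grigA grigA, grigA_mul_self] using this
  inv_mem' := by
    rintro s (hs | hs)
    · exact Or.inl (inv_mem hs)
    · refine Or.inr ?_
      obtain ⟨u, hu, v, hv, h⟩ := mem_pairLift.1 (inv_mem hs)
      have : grigA * s⁻¹ = pair v u := by
        rw [← grigA_conj_pair u v, ← h, mul_inv_rev, grigA_inv]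
        simp [mul_assoc, grigA_mul_self]
      rw [this]
      exact pair_mem_pairLift.2 ⟨hv, hu⟩

theorem isClosed_wreathLift {N : Subgroup treeAut} (hN : IsClosed (N : Set treeAut)) :
    IsClosed (wreathLift N : Set treeAut) :=
  (isClosed_pairLift hN).union ((isClosed_pairLift hN).preimage (continuous_const_mul grigA))

/-- Self-similarity of `Γ`: the sections of the generators at the first level are again generators
or trivial, and having sections in the closed group `Γ` is a closed condition. -/
theorem grigorchukClosure_le_wreathLift : Γ ≤ wreathLift Γ := by
  refine grigorchukClosure_le (isClosed_wreathLift isClosed_grigorchukClosure) ?_ ?_ ?_ ?_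
  · exact Or.inr (by rw [grigA_mul_self]; exact one_mem _)
  · exact Or.inl (by rw [grigB_eq]; exact pair_mem_pairLift.2 ⟨grigA_mem, grigC_mem⟩)
  · exact Or.inl (by rw [grigC_eq]; exact pair_mem_pairLift.2 ⟨grigA_mem, grigD_mem⟩)
  · exact Or.inl (by rw [grigD_eq]; exact pair_mem_pairLift.2 ⟨one_mem _, grigB_mem⟩)

theorem exists_pair_of_mem {s : treeAut} (hs : s ∈ Γ) :
    ∃ u ∈ Γ, ∃ v ∈ Γ, s = pair u v ∨ s = grigA * pair u v := by
  rcases grigorchukClosure_le_wreathLift hs with h | h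
  · obtain ⟨u, hu, v, hv, h⟩ := mem_pairLift.1 h
    exact ⟨u, hu, v, hv, Or.inl h⟩
  · obtain ⟨u, hu, v, hv, h⟩ := mem_pairLift.1 h
    refine ⟨u, hu, v, hv, Or.inr ?_⟩
    rw [← h, ← mul_assoc, grigA_mul_self, one_mul]

theorem mem_of_pair_mem {u v : treeAut} (h : pair u v ∈ Γ) : u ∈ Γ ∧ v ∈ Γ := by
  rcases grigorchukClosure_le_wreathLift h with h | h
  · exact pair_mem_pairLift.1 h
  · obtain ⟨u', hu, v', hv, h⟩ := mem_pairLift.1 h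
    have := congrArg (fun s : treeAut => s.1 [false]) h
    simp [treeAut_map_nil, grigA, autOfInvol, actA] at this

theorem pair_grigA_grigC_mem : pair grigA grigC ∈ grigorchukGroup := grigB_eq ▸ grigB_mem_group

theorem pair_grigB_one_mem : pair grigB 1 ∈ grigorchukGroup := by
  rw [← grigA_conj_pair, ← grigD_eq]
  exact mul_mem (mul_mem grigA_mem_group grigD_mem_group) grigA_mem_group

theorem pair_grigC_grigA_mem : pair grigC grigA ∈ grigorchukGroup := by
  rw [← grigA_conj_pair, ← grigB_eq]
  exact mul_mem (mul_mem grigA_mem_group grigB_mem_group) grigA_mem_group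

theorem pair_grigD_grigA_mem : pair grigD grigA ∈ grigorchukGroup := by
  rw [← grigA_conj_pair, ← grigC_eq]
  exact mul_mem (mul_mem grigA_mem_group grigC_mem_group) grigA_mem_group

/-- The stabilizer of the vertex `0` acts on the subtree below it as the whole group. This makes
`leftPart M` normal and the action level-transitive. -/
theorem exists_pair_mem_group {g : treeAut} (hg : g ∈ grigorchukGroup) :
    ∃ h, pair g h ∈ grigorchukGroup := by
  induction hg using Subgroup.closure_induction with
  | mem s hs =>
    rcases hs with rfl | rfl | rfl | rfl
    exacts [⟨_, pair_grigA_grigC_mem⟩, ⟨_, pair_grigB_one_mem⟩, ⟨_, pair_grigC_grigA_mem⟩,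
      ⟨_, pair_grigD_grigA_mem⟩]
  | one => exact ⟨1, by rw [pair_one]; exact one_mem _⟩
  | mul x y _ _ hx hy =>
    obtain ⟨h, hh⟩ := hx
    obtain ⟨k, hk⟩ := hy
    exact ⟨h * k, by rw [← pair_mul]; exact mul_mem hh hk⟩
  | inv x _ hx =>
    obtain ⟨h, hh⟩ := hx
    exact ⟨h⁻¹, by rw [← pair_inv]; exact inv_mem hh⟩

/-! ### Closed normal subgroups -/

/-- Closed subgroups of the automorphism group of the tree that are contained in `Γ` and normalized
by `Γ`. -/
structure ClosedNormal (M : Subgroup treeAut) : Prop where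
  isClosed : IsClosed (M : Set treeAut)
  le : M ≤ Γ
  conj : ∀ g ∈ Γ, ∀ m ∈ M, g * m * g⁻¹ ∈ M

theorem ClosedNormal.commutator_mem {M : Subgroup treeAut} (hM : ClosedNormal M) {m g : treeAut}
    (hm : m ∈ M) (hg : g ∈ Γ) : ⁅m, g⁆ ∈ M := by
  rw [commutatorElement_def, mul_assoc, mul_assoc, ← mul_assoc g]
  exact mul_mem hm (hM.conj g hg _ (inv_mem hm))

theorem ClosedNormal.pair_swap_mem {M : Subgroup treeAut} (hM : ClosedNormal M) {u v : treeAut}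
    (h : pair u v ∈ M) : pair v u ∈ M := by
  have := hM.conj grigA grigA_mem _ h
  rwa [grigA_inv, grigA_conj_pair] at this

theorem ClosedNormal.mem_of_conj_mem {M : Subgroup treeAut} (hM : ClosedNormal M) {g m : treeAut}
    (hg : g ∈ Γ) (h : g * m * g⁻¹ ∈ M) : m ∈ M := by
  have := hM.conj g⁻¹ (inv_mem hg) _ h
  simpa [mul_assoc] using this

theorem closedNormal_grigorchukClosure : ClosedNormal Γ :=
  ⟨isClosed_grigorchukClosure, le_rfl, fun _ hg _ hm => mul_mem (mul_mem hg hm) (inv_mem hg)⟩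

theorem conj_mem_of_isClosed {M K : Subgroup treeAut} (hM : IsClosed (M : Set treeAut))
    {S : Set treeAut} (h : ∀ g ∈ Subgroup.closure S, ∀ m ∈ M, g * m * g⁻¹ ∈ M)
    (hK : (Subgroup.closure S).topologicalClosure = K) : ∀ g ∈ K, ∀ m ∈ M, g * m * g⁻¹ ∈ M := by
  subst hK
  intro g hg m hm
  have hcl : IsClosed {g : treeAut | g * m * g⁻¹ ∈ M} :=
    hM.preimage (f := fun g : treeAut => g * m * g⁻¹) (by fun_prop)
  exact closure_minimal (fun g hg => h g hg m hm) hcl hg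

theorem conj_mem_of_generators {M : Subgroup treeAut} {S : Set treeAut}
    (h : ∀ g ∈ S, ∀ m ∈ M, g * m * g⁻¹ ∈ M ∧ g⁻¹ * m * g ∈ M) :
    ∀ g ∈ Subgroup.closure S, ∀ m ∈ M, g * m * g⁻¹ ∈ M := by
  suffices H : ∀ g ∈ Subgroup.closure S, ∀ m ∈ M, g * m * g⁻¹ ∈ M ∧ g⁻¹ * m * g ∈ M from
    fun g hg m hm => (H g hg m hm).1
  intro g hg
  induction hg using Subgroup.closure_induction with
  | mem s hs => exact h s hs
  | one => simp
  | mul x y _ _ hx hy =>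
    intro m hm
    constructor
    · have := (hx _ (hy m hm).1).1
      simpa [mul_assoc] using this
    · have := (hy _ (hx m hm).2).2
      simpa [mul_assoc] using this
  | inv x _ hx =>
    intro m hm
    simpa using (hx m hm).symm

theorem ClosedNormal.of_generators {M : Subgroup treeAut} (hcl : IsClosed (M : Set treeAut))
    (hle : M ≤ Γ) (ha : ∀ m ∈ M, grigA * m * grigA ∈ M) (hb : ∀ m ∈ M, grigB * m * grigB ∈ M)
    (hc : ∀ m ∈ M, grigC * m * grigC ∈ M) (hd : ∀ m ∈ M, grigD * m * grigD ∈ M) :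
    ClosedNormal M := by
  refine ⟨hcl, hle, conj_mem_of_isClosed hcl (conj_mem_of_generators ?_) rfl⟩
  rintro g (rfl | rfl | rfl | rfl) m hm
  · rw [grigA_inv]; exact ⟨ha m hm, ha m hm⟩
  · rw [grigB_inv]; exact ⟨hb m hm, hb m hm⟩
  · rw [grigC_inv]; exact ⟨hc m hm, hc m hm⟩
  · rw [grigD_inv]; exact ⟨hd m hm, hd m hm⟩

theorem ClosedNormal.pairLift {N : Subgroup treeAut} (hN : ClosedNormal N) (hle : pairLift N ≤ Γ) :
    ClosedNormal (pairLift N) := by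
  have key : ∀ {p q : treeAut}, p ∈ Γ → q ∈ Γ → ∀ m ∈ _root_.pairLift N,
      pair p q * m * (pair p q)⁻¹ ∈ _root_.pairLift N := by
    intro p q hp hq m hm
    obtain ⟨u, hu, v, hv, rfl⟩ := mem_pairLift.1 hm
    rw [pair_inv, pair_mul, pair_mul]
    exact pair_mem_pairLift.2 ⟨hN.conj p hp u hu, hN.conj q hq v hv⟩
  refine ClosedNormal.of_generators (isClosed_pairLift hN.isClosed) hle ?_ ?_ ?_ ?_
  · intro m hm
    obtain ⟨u, hu, v, hv, rfl⟩ := mem_pairLift.1 hm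
    rw [grigA_conj_pair]
    exact pair_mem_pairLift.2 ⟨hv, hu⟩
  · have := @key _ _ grigA_mem grigC_mem
    rwa [← grigB_eq, grigB_inv] at this
  · have := @key _ _ grigA_mem grigD_mem
    rwa [← grigC_eq, grigC_inv] at this
  · have := @key _ _ (one_mem _) grigB_mem
    rwa [← grigD_eq, grigD_inv] at this

/-- The elements `w` of `Γ` with `pair w 1` in `M`. -/
def leftPart (M : Subgroup treeAut) : Subgroup treeAut :=
  (M.comap (pairHom.comp (MonoidHom.inl treeAut treeAut))) ⊓ Γ

theorem ClosedNormal.mem_leftPart {M : Subgroup treeAut} (hM : ClosedNormal M) {w : treeAut} :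
    w ∈ leftPart M ↔ pair w 1 ∈ M :=
  ⟨And.left, fun h => ⟨h, (mem_of_pair_mem (hM.le h)).1⟩⟩

/-- Conjugating `pair w 1` by an element `pair g h` of the group conjugates `w` by `g`, and every
`g` in the Grigorchuk group occurs; closedness extends this to `Γ`. -/
theorem ClosedNormal.leftPart {M : Subgroup treeAut} (hM : ClosedNormal M) :
    ClosedNormal (leftPart M) := by
  have hcl : IsClosed (_root_.leftPart M : Set treeAut) := by
    refine IsClosed.inter (hM.isClosed.preimage (f := fun w => pair w 1) ?_)
      isClosed_grigorchukClosure
    exact continuous_pair.comp (continuous_id.prodMk continuous_const)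
  refine ⟨hcl, inf_le_right, conj_mem_of_isClosed hcl (S := {grigA, grigB, grigC, grigD})
    (fun g hg m hm => ?_) rfl⟩
  obtain ⟨h, hh⟩ := exists_pair_mem_group hg
  rw [hM.mem_leftPart] at *
  have := hM.conj _ (grigorchukGroup_le_closure hh) _ hm
  simpa [pair_inv, pair_mul] using this

/-- Every closed normal subgroup that contains `X` contains `N`. -/
def GeneratedBy (X : Set treeAut) (N : Subgroup treeAut) : Prop :=
  ∀ M, ClosedNormal M → X ⊆ M → N ≤ M

/-! ### The lower 2-central series of the closure of the Grigorchuk group -/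

/-- The lower 2-central series of `Γ`, as subgroups of the automorphism group of the tree. -/
def grigSeries (n : ℕ) : Subgroup treeAut := (lowerTwoCentralSeries Γ n).map (Subgroup.subtype Γ)

theorem mem_grigSeries {n : ℕ} {g : treeAut} :
    g ∈ grigSeries n ↔ ∃ h : g ∈ Γ, (⟨g, h⟩ : Γ) ∈ lowerTwoCentralSeries Γ n := by
  constructor
  · rintro ⟨g, hg, rfl⟩
    exact ⟨g.2, hg⟩
  · rintro ⟨h, hg⟩
    exact ⟨_, hg, rfl⟩

theorem coe_mem_grigSeries {n : ℕ} {g : Γ} :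
    (g : treeAut) ∈ grigSeries n ↔ g ∈ lowerTwoCentralSeries Γ n := by
  rw [mem_grigSeries]
  exact ⟨fun h => h.2, fun h => ⟨g.2, h⟩⟩

theorem grigSeries_le (n : ℕ) : grigSeries n ≤ Γ := fun _ hg => (mem_grigSeries.1 hg).1

theorem grigSeries_one : grigSeries 1 = Γ := by
  refine le_antisymm (grigSeries_le 1) fun g hg => mem_grigSeries.2 ⟨hg, ?_⟩
  rw [lowerTwoCentralSeries]
  trivial

theorem grigSeries_antitone : Antitone grigSeries := fun _ _ h =>
  Subgroup.map_mono (lowerTwoCentralSeries_antitone h)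

theorem isClosed_map_grigorchukClosure {M : Subgroup Γ} (hM : IsClosed (M : Set Γ)) :
    IsClosed (M.map (Subgroup.subtype Γ) : Set treeAut) :=
  (isClosed_grigorchukClosure.isClosedEmbedding_subtypeVal.isClosedMap) _ hM

theorem closedNormal_map {M : Subgroup Γ} (hM : IsClosed (M : Set Γ)) (hn : M.Normal) :
    ClosedNormal (M.map (Subgroup.subtype Γ)) := by
  refine ⟨isClosed_map_grigorchukClosure hM, ?_, ?_⟩
  · rintro _ ⟨g, -, rfl⟩
    exact g.2
  · rintro g hg _ ⟨m, hm, rfl⟩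
    exact Subgroup.mem_map.2 ⟨(⟨g, hg⟩ : Γ) * m * (⟨g, hg⟩ : Γ)⁻¹, hn.conj_mem m hm _, by simp⟩

theorem closedNormal_grigSeries (n : ℕ) : ClosedNormal (grigSeries n) :=
  closedNormal_map (lowerTwoCentralSeries_isClosed n) (lowerTwoCentralSeries_normal n)

theorem commutator_mem_grigSeries {n : ℕ} {u g : treeAut} (hu : u ∈ grigSeries n) (hg : g ∈ Γ) :
    ⁅u, g⁆ ∈ grigSeries (n + 1) := by
  obtain ⟨u, hu, rfl⟩ := hu
  exact ⟨⁅u, ⟨g, hg⟩⁆, commutator_mem_lowerTwoCentralSeries_succ hu _, rfl⟩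

theorem sq_mem_grigSeries {n : ℕ} {u : treeAut} (hu : u ∈ grigSeries n) :
    u ^ 2 ∈ grigSeries (n + 1) := by
  obtain ⟨u, hu, rfl⟩ := hu
  exact ⟨u ^ 2, sq_mem_lowerTwoCentralSeries_succ hu, rfl⟩

theorem commutator_mem_grigSeries_add {i j : ℕ} {u v : treeAut} (hu : u ∈ grigSeries i)
    (hv : v ∈ grigSeries j) : ⁅u, v⁆ ∈ grigSeries (i + j) := by
  obtain ⟨u, hu, rfl⟩ := hu
  obtain ⟨v, hv, rfl⟩ := hv
  exact ⟨⁅u, v⁆, commutator_mem_lowerTwoCentralSeries_add hu hv, rfl⟩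

theorem grigSeries_succ_le {n : ℕ} (hn : 1 ≤ n) {M : Subgroup treeAut}
    (hM : IsClosed (M : Set treeAut)) (h1 : ∀ u ∈ grigSeries n, ∀ g ∈ Γ, ⁅u, g⁆ ∈ M)
    (h2 : ∀ u ∈ grigSeries n, u ^ 2 ∈ M) : grigSeries (n + 1) ≤ M := by
  rw [grigSeries, Subgroup.map_le_iff_le_comap]
  refine lowerTwoCentralSeries_succ_le hn (hM.preimage continuous_subtype_val)
    (fun u hu g => ?_) (fun u hu => ?_)
  · exact h1 u (coe_mem_grigSeries.2 hu) g g.2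
  · exact h2 u (coe_mem_grigSeries.2 hu)

/-- For `u` in `Γ`, commutators `⁅u, g⁆` lie in `M` as soon as they do for the generators `g`. -/
theorem ClosedNormal.commutator_mem_of_generators {M : Subgroup treeAut} (hM : ClosedNormal M)
    {u : treeAut} (ha : ⁅u, grigA⁆ ∈ M) (hb : ⁅u, grigB⁆ ∈ M)
    (hc : ⁅u, grigC⁆ ∈ M) (hd : ⁅u, grigD⁆ ∈ M) {g : treeAut} (hg : g ∈ Γ) : ⁅u, g⁆ ∈ M := by
  let C : Subgroup treeAut :=
    { carrier := {g | g ∈ Γ ∧ ⁅u, g⁆ ∈ M}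
      one_mem' := ⟨one_mem _, by rw [commutatorElement_one_right]; exact one_mem _⟩
      mul_mem' := by
        rintro g h ⟨hg, hg'⟩ ⟨hh, hh'⟩
        refine ⟨mul_mem hg hh, ?_⟩
        have : ⁅u, g * h⁆ = ⁅u, g⁆ * (g * ⁅u, h⁆ * g⁻¹) := by
          simp only [commutatorElement_def]; group
        rw [this]
        exact mul_mem hg' (hM.conj g hg _ hh')
      inv_mem' := by
        rintro g ⟨hg, hg'⟩
        refine ⟨inv_mem hg, ?_⟩
        have : ⁅u, g⁻¹⁆ = g⁻¹ * ⁅u, g⁆⁻¹ * g⁻¹⁻¹ := by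
          simp only [commutatorElement_def]; group
        rw [this]
        exact hM.conj _ (inv_mem hg) _ (inv_mem hg') }
  have hC : IsClosed (C : Set treeAut) := by
    refine isClosed_grigorchukClosure.inter (hM.isClosed.preimage (f := fun g => ⁅u, g⁆) ?_)
    simp only [commutatorElement_def]
    fun_prop
  exact (grigorchukClosure_le hC ⟨grigA_mem, ha⟩ ⟨grigB_mem, hb⟩ ⟨grigC_mem, hc⟩
    ⟨grigD_mem, hd⟩ hg).2

/-- The next term of the lower 2-central series, from normal generators of the previous one. -/
theorem GeneratedBy.grigSeries_succ_le {X : Set treeAut} {n : ℕ} (hn : 1 ≤ n)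
    (hX : GeneratedBy X (grigSeries n)) {M : Subgroup treeAut} (hM : ClosedNormal M)
    (h : ∀ u ∈ X, u ∈ Γ ∧ u ^ 2 ∈ M ∧ ⁅u, grigA⁆ ∈ M ∧ ⁅u, grigB⁆ ∈ M ∧ ⁅u, grigC⁆ ∈ M ∧
      ⁅u, grigD⁆ ∈ M) : grigSeries (n + 1) ≤ M := by
  -- `Z` consists of the elements that are central with trivial square modulo `M`. It is closed and
  -- normal, so it contains `γₙ` once it contains `X`.
  let Z : Subgroup treeAut :=
    { carrier := {z | z ∈ Γ ∧ z ^ 2 ∈ M ∧ ∀ g ∈ Γ, ⁅z, g⁆ ∈ M}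
      one_mem' := ⟨one_mem _, by simp, fun g _ => by
        rw [commutatorElement_one_left]; exact one_mem _⟩
      mul_mem' := by
        rintro y z ⟨hy, hy2, hyc⟩ ⟨hz, hz2, hzc⟩
        refine ⟨mul_mem hy hz, ?_, fun g hg => ?_⟩
        · rw [mul_sq_eq]
          exact mul_mem (hM.conj _ hy _ (inv_mem (hyc z hz))) (mul_mem hy2 hz2)
        · rw [commutatorElement_mul_left_eq_conj_mul]
          exact mul_mem (hM.conj y hy _ (hzc g hg)) (hyc g hg)
      inv_mem' := by
        rintro y ⟨hy, hy2, hyc⟩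
        refine ⟨inv_mem hy, by rw [inv_pow]; exact inv_mem hy2, fun g hg => ?_⟩
        have : ⁅y⁻¹, g⁆ = y⁻¹ * ⁅y, g⁆⁻¹ * y⁻¹⁻¹ := by
          simp only [commutatorElement_def]; group
        rw [this]
        exact hM.conj _ (inv_mem hy) _ (inv_mem (hyc g hg)) }
  have hZ : ClosedNormal Z := by
    refine ⟨?_, fun z hz => hz.1, ?_⟩
    · have : (Z : Set treeAut) = (Γ : Set treeAut) ∩ ((fun z => z ^ 2) ⁻¹' (M : Set treeAut) ∩
          ⋂ g ∈ (Γ : Set treeAut), (fun z => ⁅z, g⁆) ⁻¹' (M : Set treeAut)) := by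
        ext z
        simp [Z]
      rw [this]
      refine isClosed_grigorchukClosure.inter ((hM.isClosed.preimage (by fun_prop)).inter
        (isClosed_biInter fun g _ => hM.isClosed.preimage ?_))
      simp only [commutatorElement_def]
      fun_prop
    · rintro g hg z ⟨hz, hz2, hzc⟩
      refine ⟨mul_mem (mul_mem hg hz) (inv_mem hg), ?_, fun k hk => ?_⟩
      · rw [conj_pow]
        exact hM.conj g hg _ hz2
      · have : ⁅g * z * g⁻¹, k⁆ = g * ⁅z, g⁻¹ * k * g⁆ * g⁻¹ := by
          simp only [commutatorElement_def]; group
        rw [this]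
        exact hM.conj g hg _ (hzc _ (mul_mem (mul_mem (inv_mem hg) hk) hg))
  have hle : grigSeries n ≤ Z := hX Z hZ fun u hu => by
    obtain ⟨h0, h1, h2, h3, h4, h5⟩ := h u hu
    exact ⟨h0, h1, fun g hg => hM.commutator_mem_of_generators h2 h3 h4 h5 hg⟩
  exact _root_.grigSeries_succ_le hn hM.isClosed (fun u hu g hg => (hle hu).2.2 g hg)
    (fun u hu => (hle hu).2.1)

/-! ### The first terms of the lower 2-central series -/

theorem grigA_mul_cancel (g : treeAut) : grigA * (grigA * g) = g := by
  rw [← mul_assoc, grigA_mul_self, one_mul]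

theorem grigB_mul_cancel (g : treeAut) : grigB * (grigB * g) = g := by
  rw [← mul_assoc, grigB_mul_self, one_mul]

/-- The commutator `[a, b]`. -/
def grigX : treeAut := ⁅grigA, grigB⁆

/-- The commutator `[a, d]`. -/
def grigY : treeAut := ⁅grigA, grigD⁆

theorem grigX_eq : grigX = pair (grigC * grigA) (grigA * grigC) := by
  rw [grigX, commutatorElement_def, grigA_inv, grigB_inv, grigB_eq, grigA_conj_pair, pair_mul]

theorem grigY_eq : grigY = pair grigB grigB := by
  rw [grigY, commutatorElement_def, grigA_inv, grigD_inv, grigD_eq, grigA_conj_pair, pair_mul,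
    one_mul, mul_one]

theorem grigX_inv_eq : grigX⁻¹ = ⁅grigB, grigA⁆ := commutatorElement_inv _ _

theorem commutator_grigX_grigA : ⁅grigX, grigA⁆ = grigX ^ 2 := by
  simp only [commutatorElement_def, grigX, mul_inv_rev, grigA_inv, grigB_inv, mul_assoc, pow_two]
  simp [grigA_mul_self]

theorem commutator_grigX_grigB : ⁅grigX, grigB⁆ = grigX ^ 2 := by
  simp only [commutatorElement_def, grigX, mul_inv_rev, grigA_inv, grigB_inv, mul_assoc,
    grigB_mul_cancel, pow_two]

theorem commutator_grigA_grigX_inv : ⁅grigX⁻¹, grigA⁆ = (grigX ^ 2)⁻¹ := by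
  simp only [commutatorElement_def, grigX, mul_inv_rev, grigA_inv, grigB_inv, mul_assoc,
    grigA_mul_cancel, pow_two]

theorem commutator_grigA_mul_grigC_grigB : ⁅grigA * grigC, grigB⁆ = grigX := by
  simp only [commutatorElement_def, grigX, mul_inv_rev, grigA_inv, grigB_inv, grigC_inv, mul_assoc]
  rw [← mul_assoc grigC grigB, grigC_mul_grigB, ← mul_assoc grigD grigC, grigD_mul_grigC]

theorem commutator_grigX_grigD : ⁅grigX, grigD⁆ = pair 1 grigX := by
  rw [grigX_eq, grigD_eq, pair_commutator, commutatorElement_one_right,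
    commutator_grigA_mul_grigC_grigB, grigX_eq]

theorem commutator_grigC_eq (u : treeAut) :
    ⁅u, grigC⁆ = ⁅u, grigB⁆ * (grigB * ⁅u, grigD⁆ * grigB⁻¹) := by
  rw [← grigB_mul_grigD]
  simp only [commutatorElement_def]
  group

theorem commutator_grigA_mul_grigC_eq (u : treeAut) :
    ⁅u, grigA * grigC⁆ = ⁅u, grigA⁆ * (grigA * ⁅u, grigC⁆ * grigA⁻¹) := by
  simp only [commutatorElement_def]
  group

theorem commutator_grigB_grigC : ⁅grigB, grigC⁆ = 1 := by
  rw [commutatorElement_eq_one_iff_mul_comm, grigB_mul_grigC, grigC_mul_grigB]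

theorem commutator_grigB_grigD : ⁅grigB, grigD⁆ = 1 := by
  rw [commutatorElement_eq_one_iff_mul_comm, grigB_mul_grigD, grigD_mul_grigB]

theorem commutator_grigC_grigD : ⁅grigC, grigD⁆ = 1 := by
  rw [commutatorElement_eq_one_iff_mul_comm, grigC_mul_grigD, grigD_mul_grigC]

theorem grigY_sq : grigY ^ 2 = 1 := by
  rw [grigY_eq, pair_pow, pow_two, grigB_mul_self, pair_one]

theorem commutator_grigY_grigA : ⁅grigY, grigA⁆ = 1 := by
  rw [grigY_eq, commutator_pair_grigA, mul_inv_cancel, pair_one]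

theorem commutator_grigY_grigB : ⁅grigY, grigB⁆ = pair grigX⁻¹ 1 := by
  rw [grigY_eq]
  nth_rewrite 3 [grigB_eq]
  rw [pair_commutator, commutator_grigB_grigC, grigX_inv_eq]

theorem commutator_grigY_grigC : ⁅grigY, grigC⁆ = pair grigX⁻¹ 1 := by
  rw [grigY_eq, grigC_eq, pair_commutator, commutator_grigB_grigD, grigX_inv_eq]

theorem commutator_grigY_grigD : ⁅grigY, grigD⁆ = 1 := by
  rw [grigY_eq, grigD_eq, pair_commutator, commutatorElement_one_right, commutatorElement_self,
    pair_one]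

theorem GeneratedBy.self (N : Subgroup treeAut) : GeneratedBy (N : Set treeAut) N :=
  fun _ _ h => h

theorem generatedBy_grigSeries_one :
    GeneratedBy {grigA, grigB, grigC, grigD} (grigSeries 1) := by
  intro M hM h
  rw [grigSeries_one]
  exact grigorchukClosure_le hM.isClosed (h (by simp)) (h (by simp)) (h (by simp)) (h (by simp))

theorem grigX_mem : grigX ∈ grigSeries 2 :=
  commutator_mem_grigSeries (grigSeries_one ▸ grigA_mem) grigB_mem

theorem grigY_mem : grigY ∈ grigSeries 2 :=
  commutator_mem_grigSeries (grigSeries_one ▸ grigA_mem) grigD_mem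

theorem commutator_grigA_grigC_mem : ⁅grigA, grigC⁆ ∈ grigSeries 2 :=
  commutator_mem_grigSeries (grigSeries_one ▸ grigA_mem) grigC_mem

/-- The generators are involutions and `b, c, d` commute, so only commutators with `a` remain; `⁅a,
c⁆` is redundant because `c = bd`. -/
theorem generatedBy_grigSeries_two : GeneratedBy {grigX, grigY} (grigSeries 2) := by
  intro M hM h
  have hx : ⁅grigA, grigB⁆ ∈ M := h (by simp [grigX])
  have hy : ⁅grigA, grigD⁆ ∈ M := h (by simp [grigY])
  have hz : ⁅grigA, grigC⁆ ∈ M := by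
    rw [commutator_grigC_eq]
    exact mul_mem hx (hM.conj _ grigB_mem _ hy)
  have hinv : ∀ {u v : treeAut}, ⁅u, v⁆ ∈ M → ⁅v, u⁆ ∈ M := fun {u v} h => by
    rw [← commutatorElement_inv]; exact inv_mem h
  have one_of : ∀ {u v : treeAut}, ⁅u, v⁆ = 1 → ⁅u, v⁆ ∈ M := fun h => h ▸ one_mem M
  refine generatedBy_grigSeries_one.grigSeries_succ_le le_rfl hM ?_
  rintro u (rfl | rfl | rfl | rfl)
  · exact ⟨grigA_mem, by rw [pow_two, grigA_mul_self]; exact one_mem _,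
      one_of (commutatorElement_self _), hx, hz, hy⟩
  · exact ⟨grigB_mem, by rw [pow_two, grigB_mul_self]; exact one_mem _, hinv hx,
      one_of (commutatorElement_self _), one_of commutator_grigB_grigC,
      one_of commutator_grigB_grigD⟩
  · exact ⟨grigC_mem, by rw [pow_two, grigC_mul_self]; exact one_mem _, hinv hz,
      hinv (one_of commutator_grigB_grigC), one_of (commutatorElement_self _),
      one_of commutator_grigC_grigD⟩
  · exact ⟨grigD_mem, by rw [pow_two, grigD_mul_self]; exact one_mem _, hinv hy,
      hinv (one_of commutator_grigB_grigD), hinv (one_of commutator_grigC_grigD),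
      one_of (commutatorElement_self _)⟩

theorem pair_grigX_one_mem : pair grigX 1 ∈ grigSeries 3 := by
  have := inv_mem (commutator_mem_grigSeries grigY_mem grigB_mem)
  rwa [commutator_grigY_grigB, pair_inv, inv_inv, inv_one] at this

theorem grigX_sq_mem : grigX ^ 2 ∈ grigSeries 3 := sq_mem_grigSeries grigX_mem

/-- The commutators of `grigX` and `grigY` with the generators reduce to `grigX ^ 2` and to copies
of `grigX` on one subtree, from `⁅grigX, d⁆ = (1, grigX)` and `⁅grigY, b⁆ = (grigX⁻¹, 1)`. -/
theorem generatedBy_grigSeries_three :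
    GeneratedBy {grigX ^ 2, pair grigX 1} (grigSeries 3) := by
  intro M hM h
  have h1 : grigX ^ 2 ∈ M := h (by simp)
  have h2 : pair grigX 1 ∈ M := h (by simp)
  have h3 : pair grigX⁻¹ 1 ∈ M := by
    have := inv_mem h2
    rwa [pair_inv, inv_one] at this
  have h4 : ⁅grigX, grigD⁆ ∈ M := by
    rw [commutator_grigX_grigD]
    exact hM.pair_swap_mem h2
  refine generatedBy_grigSeries_two.grigSeries_succ_le (by norm_num) hM ?_
  rintro u (rfl | rfl)
  · refine ⟨grigSeries_le 2 grigX_mem, h1, ?_, ?_, ?_, h4⟩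
    · rw [commutator_grigX_grigA]; exact h1
    · rw [commutator_grigX_grigB]; exact h1
    · rw [commutator_grigC_eq, commutator_grigX_grigB]
      exact mul_mem h1 (hM.conj _ grigB_mem _ h4)
  · refine ⟨grigSeries_le 2 grigY_mem, ?_, ?_, ?_, ?_, ?_⟩
    · rw [grigY_sq]; exact one_mem _
    · rw [commutator_grigY_grigA]; exact one_mem _
    · rw [commutator_grigY_grigB]; exact h3
    · rw [commutator_grigY_grigC]; exact h3
    · rw [commutator_grigY_grigD]; exact one_mem _

theorem pair_grigX_grigX_inv_mem : pair grigX grigX⁻¹ ∈ grigSeries 4 := by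
  have := commutator_mem_grigSeries pair_grigX_one_mem grigA_mem
  rwa [commutator_pair_grigA, inv_one, mul_one, one_mul] at this

/-- To show that `pair w 1` lies in `M` for all `w` in the third term, it suffices to check this
for `grigX ^ 2` and for `⁅grigX, grigD⁆`. -/
theorem ClosedNormal.pair_one_mem_of_grigSeries_three {M : Subgroup treeAut} (hM : ClosedNormal M)
    (h1 : pair (grigX ^ 2) 1 ∈ M) (h2 : pair ⁅grigX, grigD⁆ 1 ∈ M) {w : treeAut}
    (hw : w ∈ grigSeries 3) : pair w 1 ∈ M := by
  refine (generatedBy_grigSeries_three _ hM.leftPart ?_ hw).1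
  rintro u (rfl | rfl)
  · exact hM.mem_leftPart.2 h1
  · refine hM.leftPart.pair_swap_mem ?_
    rw [← commutator_grigX_grigD]
    exact hM.mem_leftPart.2 h2

/-- It is enough to place the normal generators of `γ₃` in one coordinate. Commutators of `(grigX⁻¹,
grigX) ∈ γ₄` with `d` and `b` give `(1, grigX²)` and `(grigX⁻², ⁅grigX, c⁆)`; from these `⁅grigX,
d⁆` in one coordinate is extracted using `c = bd`. -/
theorem pairLift_grigSeries_three_le : pairLift (grigSeries 3) ≤ grigSeries 5 := by
  have hM := closedNormal_grigSeries 5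
  have h0 : pair grigX⁻¹ grigX ∈ grigSeries 4 :=
    (closedNormal_grigSeries 4).pair_swap_mem pair_grigX_grigX_inv_mem
  have h1 : pair (grigX ^ 2) 1 ∈ grigSeries 5 := by
    refine hM.pair_swap_mem ?_
    have := commutator_mem_grigSeries h0 grigD_mem
    rwa [grigD_eq, pair_commutator, commutator_grigX_grigB, commutatorElement_one_right] at this
  have h2 : pair 1 ⁅grigX, grigC⁆ ∈ grigSeries 5 := by
    have := commutator_mem_grigSeries h0 grigB_mem
    rw [grigB_eq, pair_commutator, commutator_grigA_grigX_inv] at this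
    have := mul_mem h1 this
    rwa [pair_mul, mul_inv_cancel, one_mul] at this
  have h3 : pair ⁅grigX, grigD⁆ 1 ∈ grigSeries 5 := by
    have h2' := hM.mem_leftPart.2 (hM.pair_swap_mem h2)
    rw [commutator_grigC_eq, commutator_grigX_grigB] at h2'
    have := mul_mem (inv_mem (hM.mem_leftPart.2 h1)) h2'
    rw [inv_mul_cancel_left] at this
    exact (hM.leftPart.mem_of_conj_mem grigB_mem this).1
  intro s hs
  obtain ⟨u, hu, v, hv, rfl⟩ := mem_pairLift.1 hs
  have hu' := hM.pair_one_mem_of_grigSeries_three h1 h3 hu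
  have hv' := hM.pair_swap_mem (hM.pair_one_mem_of_grigSeries_three h1 h3 hv)
  have := mul_mem hu' hv'
  rwa [pair_mul, mul_one, one_mul] at this

theorem closedNormal_pairLift_grigSeries_three : ClosedNormal (pairLift (grigSeries 3)) :=
  (closedNormal_grigSeries 3).pairLift (pairLift_grigSeries_three_le.trans (grigSeries_le 5))

theorem grigA_mul_grigC_sq : (grigA * grigC) ^ 2 = ⁅grigA, grigC⁆ := by
  rw [pow_two, commutatorElement_def, grigA_inv, grigC_inv]
  group

theorem grigA_mul_grigC_sq_mem : (grigA * grigC) ^ 2 ∈ grigSeries 2 := by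
  rw [grigA_mul_grigC_sq]
  exact commutator_grigA_grigC_mem

theorem grigC_mul_grigA_eq_inv : grigC * grigA = (grigA * grigC)⁻¹ := by
  rw [mul_inv_rev, grigA_inv, grigC_inv]

theorem generatedBy_grigSeries_four :
    GeneratedBy (insert (pair grigX grigX⁻¹) (pairLift (grigSeries 3) : Set treeAut))
      (grigSeries 4) := by
  intro M hM h
  have hl : ∀ {u v : treeAut}, u ∈ grigSeries 3 → v ∈ grigSeries 3 → pair u v ∈ M :=
    fun hu hv => h (Set.mem_insert_of_mem _ (pair_mem_pairLift.2 ⟨hu, hv⟩))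
  have hx : pair grigX grigX⁻¹ ∈ M := h (Set.mem_insert _ _)
  have h3 := closedNormal_grigSeries 3
  have hx4 : (grigX ^ 2) ^ 2 ∈ M := by
    have hac : ((grigA * grigC) ^ 2) ^ 2 ∈ grigSeries 3 := sq_mem_grigSeries grigA_mul_grigC_sq_mem
    rw [grigX_eq, pair_pow, pair_pow]
    refine hl ?_ hac
    rw [grigC_mul_grigA_eq_inv, inv_pow, inv_pow]
    exact inv_mem hac
  have hsq : ∀ u v : treeAut, ⁅u ^ 2, v⁆ = u * ⁅u, v⁆ * u⁻¹ * ⁅u, v⁆ := fun u v => by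
    simp only [commutatorElement_def, pow_two]; group
  have hconj : ∀ k : ℕ, grigX * grigX ^ k * grigX⁻¹ = grigX ^ k := fun k => by
    rw [← pow_succ', pow_succ, mul_inv_cancel_right]
  have hxd : ⁅grigX ^ 2, grigD⁆ ∈ M := by
    rw [grigX_eq, pair_pow, grigD_eq, pair_commutator, commutatorElement_one_right]
    exact hl (one_mem _) (commutator_mem_grigSeries grigA_mul_grigC_sq_mem grigB_mem)
  have hxb : ⁅grigX ^ 2, grigB⁆ ∈ M := by
    rw [hsq, commutator_grigX_grigB, hconj, ← pow_two]
    exact hx4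
  refine generatedBy_grigSeries_three.grigSeries_succ_le (by norm_num) hM ?_
  rintro u (rfl | rfl)
  · refine ⟨grigSeries_le 3 grigX_sq_mem, hx4, ?_, hxb, ?_, hxd⟩
    · rw [hsq, commutator_grigX_grigA, hconj, ← pow_two]
      exact hx4
    · rw [commutator_grigC_eq]
      exact mul_mem hxb (hM.conj _ grigB_mem _ hxd)
  · have hxa : ⁅grigX, grigA⁆ ∈ grigSeries 3 := commutator_mem_grigSeries grigX_mem grigA_mem
    refine ⟨grigSeries_le 3 pair_grigX_one_mem, ?_, ?_, ?_, ?_, ?_⟩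
    · rw [pair_pow, one_pow]
      exact hl grigX_sq_mem (one_mem _)
    · rw [commutator_pair_grigA, inv_one, mul_one, one_mul]
      exact hx
    · rw [grigB_eq, pair_commutator, commutatorElement_one_left]
      exact hl hxa (one_mem _)
    · rw [grigC_eq, pair_commutator, commutatorElement_one_left]
      exact hl hxa (one_mem _)
    · rw [grigD_eq, pair_commutator, commutatorElement_one_left, commutatorElement_one_right,
        pair_one]
      exact one_mem _

/-- Base of the recursion. For each normal generator `(u, v)` of `γ₄`, both coordinates are central
of exponent two modulo `γ₃` and `u ≡ v`, so its square and its commutators fall into `γ₃ × γ₃`. -/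
theorem grigSeries_five : grigSeries 5 = pairLift (grigSeries 3) := by
  refine le_antisymm ?_ pairLift_grigSeries_three_le
  refine generatedBy_grigSeries_four.grigSeries_succ_le (by norm_num)
    closedNormal_pairLift_grigSeries_three ?_
  have h3 := closedNormal_grigSeries 3
  have hx : ∀ {g : treeAut}, g ∈ Γ → ⁅grigX, g⁆ ∈ grigSeries 3 :=
    fun hg => commutator_mem_grigSeries grigX_mem hg
  have hx' : ∀ {g : treeAut}, g ∈ Γ → ⁅grigX⁻¹, g⁆ ∈ grigSeries 3 :=
    fun hg => commutator_mem_grigSeries (inv_mem grigX_mem) hg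
  have main : ∀ {u v : treeAut}, pair u v ∈ Γ → u ^ 2 ∈ grigSeries 3 → v ^ 2 ∈ grigSeries 3 →
      u * v⁻¹ ∈ grigSeries 3 → (∀ {g : treeAut}, g ∈ Γ → ⁅u, g⁆ ∈ grigSeries 3) →
      (∀ {g : treeAut}, g ∈ Γ → ⁅v, g⁆ ∈ grigSeries 3) → pair u v ∈ Γ ∧
      pair u v ^ 2 ∈ pairLift (grigSeries 3) ∧ ⁅pair u v, grigA⁆ ∈ pairLift (grigSeries 3) ∧
      ⁅pair u v, grigB⁆ ∈ pairLift (grigSeries 3) ∧ ⁅pair u v, grigC⁆ ∈ pairLift (grigSeries 3) ∧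
      ⁅pair u v, grigD⁆ ∈ pairLift (grigSeries 3) := by
    intro u v h h1 h2 h3 h4 h5
    refine ⟨h, ?_, ?_, ?_, ?_, ?_⟩
    · rw [pair_pow]; exact pair_mem_pairLift.2 ⟨h1, h2⟩
    · rw [commutator_pair_grigA]
      exact pair_mem_pairLift.2 ⟨h3, by simpa using inv_mem h3⟩
    · rw [grigB_eq, pair_commutator]
      exact pair_mem_pairLift.2 ⟨h4 grigA_mem, h5 grigC_mem⟩
    · rw [grigC_eq, pair_commutator]
      exact pair_mem_pairLift.2 ⟨h4 grigA_mem, h5 grigD_mem⟩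
    · rw [grigD_eq, pair_commutator]
      exact pair_mem_pairLift.2 ⟨h4 (one_mem _), h5 grigB_mem⟩
  rintro u (rfl | hu)
  · refine main (grigSeries_le 4 pair_grigX_grigX_inv_mem) grigX_sq_mem ?_ ?_ hx hx'
    · rw [inv_pow]; exact inv_mem grigX_sq_mem
    · rw [inv_inv, ← pow_two]; exact grigX_sq_mem
  · obtain ⟨u, hu', v, hv, rfl⟩ := mem_pairLift.1 hu
    exact main (closedNormal_pairLift_grigSeries_three.le hu)
      (pow_mem hu' 2) (pow_mem hv 2) (mul_mem hu' (inv_mem hv)) (h3.commutator_mem hu')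
      (h3.commutator_mem hv)

/-! ### The recursive structure of the lower 2-central series -/

/-- Modulo the next term, the commutators of `γ_m` with `b` and `ac` generate `γ_{m+1}`. -/
def CommutatorGenerated (m : ℕ) : Prop :=
  ∀ M, ClosedNormal M → grigSeries (m + 2) ≤ M →
    (∀ n ∈ grigSeries m, ⁅n, grigB⁆ ∈ M ∧ ⁅n, grigA * grigC⁆ ∈ M) → grigSeries (m + 1) ≤ M

theorem grigSeries_five_pair_mem {u v : treeAut} (hu : u ∈ grigSeries 3) (hv : v ∈ grigSeries 3) :
    pair u v ∈ grigSeries 5 := by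
  rw [grigSeries_five]
  exact pair_mem_pairLift.2 ⟨hu, hv⟩

/-- The generator `(grigX, grigX⁻¹)` of `γ₄` modulo `γ₅` is `⁅(grigX, 1), a⁆`, which differs from
the commutator with `ac` by an element of `γ₅`. -/
theorem commutatorGenerated_three : CommutatorGenerated 3 := by
  intro M hM h5 h
  refine generatedBy_grigSeries_four M hM ?_
  rintro u (rfl | hu)
  · have h1 := (h _ pair_grigX_one_mem).2
    rw [commutator_grigA_mul_grigC_eq, commutator_pair_grigA, inv_one, mul_one, one_mul] at h1
    refine (Subgroup.mul_mem_cancel_right _ (hM.conj _ grigA_mem _ (h5 ?_))).1 h1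
    rw [grigC_eq, pair_commutator, commutatorElement_one_left]
    exact grigSeries_five_pair_mem (commutator_mem_grigSeries grigX_mem grigA_mem) (one_mem _)
  · exact h5 (pairLift_grigSeries_three_le hu)

/-- Commutators of `(grigX⁻¹, grigX)` with `b` and `ac` show that `⁅grigX, c⁆` and `⁅grigX, d⁆` both
agree with `grigX²` modulo `leftPart M`. As `c = bd` and `⁅grigX, b⁆ = grigX²`, the first relation
forces `⁅grigX, d⁆`, and then the second forces `grigX²`, into `leftPart M`. -/
theorem commutatorGenerated_four : CommutatorGenerated 4 := by
  intro M hM h6 h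
  have h0 : pair grigX⁻¹ grigX ∈ grigSeries 4 :=
    (closedNormal_grigSeries 4).pair_swap_mem pair_grigX_grigX_inv_mem
  have hdiag : pair (grigX ^ 2) (grigX ^ 2)⁻¹ ∈ M := by
    have := commutator_mem_grigSeries
      (grigSeries_five_pair_mem grigX_sq_mem (one_mem _)) grigA_mem
    rw [commutator_pair_grigA, inv_one, mul_one, one_mul] at this
    exact h6 this
  have hML := hM.leftPart
  have h1 : ⁅grigX, grigC⁆ * (grigX ^ 2)⁻¹ ∈ leftPart M := by
    refine hM.mem_leftPart.2 (hM.pair_swap_mem ?_)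
    have := (h _ h0).1
    rw [grigB_eq, pair_commutator, commutator_grigA_grigX_inv] at this
    have := mul_mem this hdiag
    rwa [pair_mul, inv_mul_cancel] at this
  have h2 : ⁅grigX, grigD⁆ * (grigX ^ 2)⁻¹ ∈ leftPart M := by
    refine hM.mem_leftPart.2 (hM.pair_swap_mem ?_)
    have := (h _ h0).2
    rw [commutator_grigA_mul_grigC_eq, commutator_pair_grigA] at this
    have e : pair (grigX⁻¹ * grigX⁻¹) (grigX * grigX⁻¹⁻¹) =
        (pair (grigX ^ 2) (grigX ^ 2)⁻¹)⁻¹ := by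
      rw [pair_inv, inv_inv, inv_inv, pow_two, mul_inv_rev]
    rw [e] at this
    have := hM.mem_of_conj_mem grigA_mem
      ((Subgroup.mul_mem_cancel_left _ (inv_mem hdiag)).1 this)
    rw [grigC_eq, pair_commutator, commutator_grigA_grigX_inv] at this
    have := mul_mem this hdiag
    rwa [pair_mul, inv_mul_cancel] at this
  have h3 : ⁅grigX, grigD⁆ ∈ leftPart M := by
    rw [commutator_grigC_eq, commutator_grigX_grigB] at h1
    exact hML.mem_of_conj_mem grigB_mem
      (hML.mem_of_conj_mem (pow_mem (grigSeries_le 2 grigX_mem) 2) h1)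
  have h4 : grigX ^ 2 ∈ leftPart M :=
    inv_mem_iff.1 ((Subgroup.mul_mem_cancel_left _ h3).1 h2)
  rw [grigSeries_five]
  intro s hs
  obtain ⟨u, hu, v, hv, rfl⟩ := mem_pairLift.1 hs
  have hu' := hM.pair_one_mem_of_grigSeries_three h4.1 h3.1 hu
  have hv' := hM.pair_swap_mem (hM.pair_one_mem_of_grigSeries_three h4.1 h3.1 hv)
  have := mul_mem hu' hv'
  rwa [pair_mul, mul_one, one_mul] at this

/-- A criterion for `pair w 1` to lie in `M` for all `w` in `γ_{m+1}`. -/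
theorem CommutatorGenerated.pair_one_mem {m : ℕ} (Q : CommutatorGenerated m)
    {M : Subgroup treeAut} (hM : ClosedNormal M)
    (hdiag : ∀ w ∈ grigSeries (m + 1), pair w w⁻¹ ∈ M)
    (hlow : ∀ w ∈ grigSeries (m + 2), pair w 1 ∈ M)
    (h : ∀ n ∈ grigSeries m, ⁅pair n n⁻¹, grigB⁆ ∈ M ∧ ⁅pair n n⁻¹, grigC⁆ ∈ M) :
    ∀ w ∈ grigSeries (m + 1), pair w 1 ∈ M := by
  have hML := hM.leftPart
  have hle : grigSeries (m + 2) ≤ leftPart M := fun w hw => hM.mem_leftPart.2 (hlow w hw)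
  have aux : ∀ {u v : treeAut}, v ∈ grigSeries (m + 1) → pair u v ∈ M → u * v ∈ leftPart M := by
    intro u v hv huv
    have := mul_mem huv (hdiag v hv)
    rw [pair_mul, mul_inv_cancel] at this
    exact hM.mem_leftPart.2 this
  have hp : ∀ n ∈ grigSeries m, ⁅n, grigA⁆ * ⁅n⁻¹, grigC⁆ ∈ leftPart M := by
    intro n hn
    have := (h n hn).1
    rw [grigB_eq, pair_commutator] at this
    exact aux (commutator_mem_grigSeries (inv_mem hn) grigC_mem) this
  have hr : ∀ n ∈ grigSeries m, ⁅n, grigA⁆ * ⁅n⁻¹, grigD⁆ ∈ leftPart M := by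
    intro n hn
    have := (h n hn).2
    rw [grigC_eq, pair_commutator] at this
    exact aux (commutator_mem_grigSeries (inv_mem hn) grigD_mem) this
  have hB : ∀ n ∈ grigSeries m, ⁅n⁻¹, grigB⁆ ∈ leftPart M := by
    intro n hn
    have hD : ⁅n⁻¹, grigD⁆⁻¹ ∈ grigSeries (m + 1) :=
      inv_mem (commutator_mem_grigSeries (inv_mem hn) grigD_mem)
    -- Since `c = bd`, dividing the relation with `d` by the one with `c` leaves the inverse of
    -- `⁅n⁻¹, b⁆` modulo `γ_{m+2}`.
    have h1 := mul_mem (inv_mem (hp n hn)) (hr n hn)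
    have e : (⁅n, grigA⁆ * ⁅n⁻¹, grigC⁆)⁻¹ * (⁅n, grigA⁆ * ⁅n⁻¹, grigD⁆) =
        ⁅⁅n⁻¹, grigD⁆⁻¹, grigB⁆⁻¹ * (⁅n⁻¹, grigD⁆⁻¹ * ⁅n⁻¹, grigB⁆⁻¹ * ⁅n⁻¹, grigD⁆⁻¹⁻¹) := by
      rw [commutator_grigC_eq]
      generalize ⁅n⁻¹, grigD⁆ = p
      generalize ⁅n⁻¹, grigB⁆ = q
      generalize ⁅n, grigA⁆ = r
      simp only [commutatorElement_def]
      group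
    rw [e] at h1
    have h2 := (Subgroup.mul_mem_cancel_left _
      (inv_mem (hle (commutator_mem_grigSeries hD grigB_mem)))).1 h1
    exact inv_mem_iff.1 (hML.mem_of_conj_mem (grigSeries_le _ hD) h2)
  intro w hw
  refine (Q _ hML hle (fun n hn => ⟨?_, ?_⟩) hw).1
  · have := hB n⁻¹ (inv_mem hn)
    rwa [inv_inv] at this
  · have hC : ⁅n, grigC⁆ ∈ grigSeries (m + 1) := commutator_mem_grigSeries hn grigC_mem
    -- Modulo `γ_{m+2}`, `⁅n, ac⁆` is `⁅n, a⁆⁅n, c⁆`, and `⁅n, c⁆` may be replaced by `⁅n⁻¹, c⁆`,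
    -- because the factor `γ_{m+1}/γ_{m+2}` is central of exponent two.
    have e : ⁅n, grigA * grigC⁆ = (⁅n, grigA⁆ * ⁅n⁻¹, grigC⁆) *
        (⁅n, grigC⁆ * (⁅⁅n, grigC⁆⁻¹, n⁻¹⁆ * ⁅⁅n, grigC⁆, grigA⁆⁻¹) * ⁅n, grigC⁆⁻¹ *
          ⁅n, grigC⁆ ^ 2) := by
      simp only [commutatorElement_def, pow_two]
      group
    rw [e]
    refine mul_mem (hp n hn) (mul_mem (hML.conj _ (grigSeries_le _ hC) _ (mul_mem ?_ ?_)) ?_)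
    · exact hle (commutator_mem_grigSeries (inv_mem hC) (inv_mem (grigSeries_le _ hn)))
    · exact inv_mem (hle (commutator_mem_grigSeries hC grigA_mem))
    · exact hle (sq_mem_grigSeries hC)

/-- The pairs `(u, v)` of elements of `γ_m` with `uv` in `γ_{m+1}`. -/
def diagLift (m : ℕ) : Subgroup treeAut where
  carrier := {s | ∃ u ∈ grigSeries m, ∃ v ∈ grigSeries m, u * v ∈ grigSeries (m + 1) ∧ s = pair u v}
  one_mem' := ⟨1, one_mem _, 1, one_mem _, by simp, by simp⟩
  mul_mem' := by
    rintro _ _ ⟨u, hu, v, hv, h, rfl⟩ ⟨u', hu', v', hv', h', rfl⟩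
    refine ⟨u * u', mul_mem hu hu', v * v', mul_mem hv hv', ?_, pair_mul _ _ _ _⟩
    have e : u * u' * (v * v') = u * v * ⁅v⁻¹, u'⁆ * (u' * v') := by
      simp only [commutatorElement_def]
      group
    rw [e]
    exact mul_mem (mul_mem h
      (commutator_mem_grigSeries (inv_mem hv) (grigSeries_le _ hu'))) h'
  inv_mem' := by
    rintro _ ⟨u, hu, v, hv, h, rfl⟩
    refine ⟨u⁻¹, inv_mem hu, v⁻¹, inv_mem hv, ?_, pair_inv _ _⟩
    have := (closedNormal_grigSeries (m + 1)).conj v (grigSeries_le _ hv) _ h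
    have := inv_mem this
    simpa [mul_assoc] using this

theorem pair_mem_diagLift {m : ℕ} {u v : treeAut} : pair u v ∈ diagLift m ↔
    u ∈ grigSeries m ∧ v ∈ grigSeries m ∧ u * v ∈ grigSeries (m + 1) := by
  constructor
  · rintro ⟨u', hu, v', hv, h, e⟩
    obtain ⟨rfl, rfl⟩ := pair_injective e
    exact ⟨hu, hv, h⟩
  · rintro ⟨hu, hv, h⟩
    exact ⟨u, hu, v, hv, h, rfl⟩

theorem diagLift_le (m : ℕ) : diagLift m ≤ pairLift (grigSeries m) := by
  rintro _ ⟨u, hu, v, hv, -, rfl⟩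
  exact pair_mem_pairLift.2 ⟨hu, hv⟩

theorem isClosed_diagLift (m : ℕ) : IsClosed (diagLift m : Set treeAut) := by
  refine isClosed_of_approx fun s hs => ?_
  obtain ⟨u, v, rfl, h⟩ := pair_approx (k := s)
    (s := {p | p.1 ∈ grigSeries m ∧ p.2 ∈ grigSeries m ∧ p.1 * p.2 ∈ grigSeries (m + 1)})
    fun n => by
      obtain ⟨t, ⟨u, hu, v, hv, h, rfl⟩, hn⟩ := hs n
      exact ⟨(u, v), ⟨hu, hv, h⟩, hn⟩
  refine pair_mem_diagLift.2 ⟨mem_of_approx (closedNormal_grigSeries m).isClosed fun n => ?_,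
    mem_of_approx (closedNormal_grigSeries m).isClosed fun n => ?_,
    mem_of_approx (closedNormal_grigSeries (m + 1)).isClosed fun n => ?_⟩
  · obtain ⟨p, hp, h1, -⟩ := h n
    exact ⟨p.1, hp.1, h1⟩
  · obtain ⟨p, hp, -, h2⟩ := h n
    exact ⟨p.2, hp.2.1, h2⟩
  · obtain ⟨p, hp, h1, h2⟩ := h n
    refine ⟨p.1 * p.2, hp.2.2, ?_⟩
    have e : (u * v)⁻¹ * (p.1 * p.2) = v⁻¹ * (u⁻¹ * p.1) * v⁻¹⁻¹ * (v⁻¹ * p.2) := by group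
    rw [e]
    exact mul_mem ((levelStabilizer_normal n).conj_mem _ h1 _) h2

theorem closedNormal_diagLift {m : ℕ} (h : pairLift (grigSeries m) ≤ Γ) :
    ClosedNormal (diagLift m) := by
  have hc := closedNormal_grigSeries m
  have key : ∀ {p q : treeAut}, p ∈ Γ → q ∈ Γ → ∀ s ∈ diagLift m,
      pair p q * s * (pair p q)⁻¹ ∈ diagLift m := by
    rintro p q hp hq _ ⟨u, hu, v, hv, h, rfl⟩
    rw [pair_inv, pair_mul, pair_mul]
    refine pair_mem_diagLift.2 ⟨hc.conj p hp u hu, hc.conj q hq v hv, ?_⟩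
    have e : p * u * p⁻¹ * (q * v * q⁻¹) = ⁅u, p⁆⁻¹ * (u * ⁅v, q⁆⁻¹ * u⁻¹) * (u * v) := by
      simp only [commutatorElement_def]
      group
    rw [e]
    exact mul_mem (mul_mem (inv_mem (commutator_mem_grigSeries hu hp))
      ((closedNormal_grigSeries (m + 1)).conj _ (grigSeries_le _ hu) _
        (inv_mem (commutator_mem_grigSeries hv hq)))) h
  refine ClosedNormal.of_generators (isClosed_diagLift m) ((diagLift_le m).trans h) ?_ ?_ ?_ ?_
  · rintro _ ⟨u, hu, v, hv, h, rfl⟩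
    rw [grigA_conj_pair]
    refine pair_mem_diagLift.2 ⟨hv, hu, ?_⟩
    have := (closedNormal_grigSeries (m + 1)).conj v (grigSeries_le _ hv) _ h
    simpa [mul_assoc] using this
  · have := @key _ _ grigA_mem grigC_mem
    rwa [← grigB_eq, grigB_inv] at this
  · have := @key _ _ grigA_mem grigD_mem
    rwa [← grigC_eq, grigC_inv] at this
  · have := @key _ _ (one_mem _) grigB_mem
    rwa [← grigD_eq, grigD_inv] at this

section Step

variable {m : ℕ} (hm : 3 ≤ m) (E : grigSeries (2 * m - 1) = pairLift (grigSeries m))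

include E in
theorem pairLift_le_of_eq : pairLift (grigSeries m) ≤ Γ := E ▸ grigSeries_le _

include hm E in
theorem grigSeries_even_le : grigSeries (2 * m) ≤ diagLift m := by
  have hcn := closedNormal_diagLift (pairLift_le_of_eq E)
  have h := (GeneratedBy.self (grigSeries (2 * m - 1))).grigSeries_succ_le (by omega) hcn ?_
  · rwa [show 2 * m - 1 + 1 = 2 * m by omega] at h
  have hle := grigSeries_antitone (Nat.le_succ m)
  intro s hs
  refine ⟨grigSeries_le _ hs, ?_⟩
  rw [E] at hs
  obtain ⟨u, hu, v, hv, rfl⟩ := mem_pairLift.1 hs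
  have hsub : ∀ {p q : treeAut}, p ∈ grigSeries (m + 1) → q ∈ grigSeries (m + 1) →
      pair p q ∈ diagLift m :=
    fun hp hq => pair_mem_diagLift.2 ⟨hle hp, hle hq, mul_mem hp hq⟩
  have hc : ∀ {p q : treeAut}, p ∈ Γ → q ∈ Γ → ⁅pair u v, pair p q⁆ ∈ diagLift m := by
    intro p q hp hq
    rw [pair_commutator]
    exact hsub (commutator_mem_grigSeries hu hp) (commutator_mem_grigSeries hv hq)
  refine ⟨?_, ?_, ?_, ?_, ?_⟩
  · rw [pair_pow]
    exact hsub (sq_mem_grigSeries hu) (sq_mem_grigSeries hv)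
  · rw [commutator_pair_grigA]
    exact pair_mem_diagLift.2 ⟨mul_mem hu (inv_mem hv), mul_mem hv (inv_mem hu), by
      simp⟩
  · rw [grigB_eq]; exact hc grigA_mem grigC_mem
  · rw [grigC_eq]; exact hc grigA_mem grigD_mem
  · rw [grigD_eq]; exact hc (one_mem _) grigB_mem

include hm E in
theorem pair_inv_mem_grigSeries_even {u : treeAut} (hu : u ∈ grigSeries m) :
    pair u u⁻¹ ∈ grigSeries (2 * m) := by
  have h : pair u 1 ∈ grigSeries (2 * m - 1) := E ▸ pair_mem_pairLift.2 ⟨hu, one_mem _⟩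
  have := commutator_mem_grigSeries h grigA_mem
  rwa [commutator_pair_grigA, inv_one, mul_one, one_mul,
    show 2 * m - 1 + 1 = 2 * m by omega] at this

/-- If `pair n 1` lies in `γ_k` for all `n` in `γ_m`, then `pair n 1` lies in `γ_{k+1}` for all `n`
in `γ_{m+1}`. -/
theorem pair_one_mem_succ {m k : ℕ} (hm : 1 ≤ m) (h : ∀ n ∈ grigSeries m, pair n 1 ∈ grigSeries k)
    {n : treeAut} (hn : n ∈ grigSeries (m + 1)) : pair n 1 ∈ grigSeries (k + 1) := by
  have hM := closedNormal_grigSeries (k + 1)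
  have key : ∀ {p q : treeAut}, pair p q ∈ grigorchukGroup → ∀ {n : treeAut},
      n ∈ grigSeries m → ⁅n, p⁆ ∈ leftPart (grigSeries (k + 1)) := by
    intro p q hpq n hn
    refine hM.mem_leftPart.2 ?_
    have := commutator_mem_grigSeries (h n hn) (grigorchukGroup_le_closure hpq)
    rwa [pair_commutator, commutatorElement_one_left] at this
  refine ((GeneratedBy.self (grigSeries m)).grigSeries_succ_le hm hM.leftPart
    (fun n hn => ⟨grigSeries_le _ hn, ?_, ?_, ?_, ?_, ?_⟩) hn).1
  · refine hM.mem_leftPart.2 ?_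
    have := sq_mem_grigSeries (h n hn)
    rwa [pair_pow, one_pow] at this
  · exact key pair_grigA_grigC_mem hn
  · exact key pair_grigB_one_mem hn
  · exact key pair_grigC_grigA_mem hn
  · exact key pair_grigD_grigA_mem hn

include hm E in
theorem pair_one_mem_grigSeries_even {w : treeAut} (hw : w ∈ grigSeries (m + 1)) :
    pair w 1 ∈ grigSeries (2 * m) := by
  have := pair_one_mem_succ (m := m) (k := 2 * m - 1) (by omega)
    (fun n hn => E ▸ pair_mem_pairLift.2 ⟨hn, one_mem _⟩) hw
  rwa [show 2 * m - 1 + 1 = 2 * m by omega] at this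

-- The decomposition `(u, v) = (u, u⁻¹)(1, uv)` splits an element of `diagLift m` into a commutator
-- of `(u, 1) ∈ γ_{2m-1}` with `a` and an element of `γ_{m+1}` placed in one coordinate.
include hm E in
theorem grigSeries_even_eq : grigSeries (2 * m) = diagLift m := by
  refine le_antisymm (grigSeries_even_le hm E) ?_
  rintro _ ⟨u, hu, v, hv, h, rfl⟩
  have h1 := pair_inv_mem_grigSeries_even hm E hu
  have h2 := (closedNormal_grigSeries _).pair_swap_mem (pair_one_mem_grigSeries_even hm E h)
  have := mul_mem h1 h2
  simpa [pair_mul] using this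

-- The delicate inclusion is that `(w, 1)` lies in `γ_{2m+1}` for `w ∈ γ_{m+1}`. Commutators of `(n,
-- n⁻¹)` with `b` and `c` only give mixed products such as `⁅n, a⁆⁅n⁻¹, c⁆` in one coordinate; `Q`
-- says that what is extracted from them still generates `γ_{m+1}`.
include hm E in
theorem grigSeries_odd_eq (Q : CommutatorGenerated m) :
    grigSeries (2 * m + 1) = pairLift (grigSeries (m + 1)) := by
  have hM := closedNormal_grigSeries (2 * m + 1)
  have heven := grigSeries_even_eq hm E
  have h1 : ∀ w ∈ grigSeries (m + 1), pair w 1 ∈ grigSeries (2 * m + 1) := by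
    refine Q.pair_one_mem hM ?_ ?_ ?_
    · intro w hw
      have := commutator_mem_grigSeries (pair_one_mem_grigSeries_even hm E hw) grigA_mem
      rwa [commutator_pair_grigA, inv_one, mul_one, one_mul] at this
    · intro w hw
      exact pair_one_mem_succ (m := m + 1) (by omega)
        (fun n hn => pair_one_mem_grigSeries_even hm E hn) hw
    · intro n hn
      have := pair_inv_mem_grigSeries_even hm E hn
      exact ⟨commutator_mem_grigSeries this grigB_mem, commutator_mem_grigSeries this grigC_mem⟩
  have hge : pairLift (grigSeries (m + 1)) ≤ grigSeries (2 * m + 1) := by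
    intro s hs
    obtain ⟨u, hu, v, hv, rfl⟩ := mem_pairLift.1 hs
    have := mul_mem (h1 u hu) (hM.pair_swap_mem (h1 v hv))
    rwa [pair_mul, mul_one, one_mul] at this
  refine le_antisymm ?_ hge
  have hcn := (closedNormal_grigSeries (m + 1)).pairLift (hge.trans (grigSeries_le _))
  refine (GeneratedBy.self (grigSeries (2 * m))).grigSeries_succ_le (by omega) hcn ?_
  intro s hs
  refine ⟨grigSeries_le _ hs, ?_⟩
  rw [heven] at hs
  obtain ⟨u, hu, v, hv, h, rfl⟩ := hs
  have hc : ∀ {p q : treeAut}, p ∈ Γ → q ∈ Γ →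
      ⁅pair u v, pair p q⁆ ∈ pairLift (grigSeries (m + 1)) := by
    intro p q hp hq
    rw [pair_commutator]
    exact pair_mem_pairLift.2 ⟨commutator_mem_grigSeries hu hp, commutator_mem_grigSeries hv hq⟩
  refine ⟨?_, ?_, ?_, ?_, ?_⟩
  · rw [pair_pow]
    exact pair_mem_pairLift.2 ⟨sq_mem_grigSeries hu, sq_mem_grigSeries hv⟩
  · rw [commutator_pair_grigA]
    have huv : u * v⁻¹ ∈ grigSeries (m + 1) := by
      have := mul_mem h (inv_mem (sq_mem_grigSeries hv))
      have e : u * v * (v ^ 2)⁻¹ = u * v⁻¹ := by rw [pow_two]; group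
      rwa [e] at this
    exact pair_mem_pairLift.2 ⟨huv, by simpa using inv_mem huv⟩
  · rw [grigB_eq]; exact hc grigA_mem grigC_mem
  · rw [grigC_eq]; exact hc grigA_mem grigD_mem
  · rw [grigD_eq]; exact hc (one_mem _) grigB_mem

-- Modulo `γ_{m+1} × γ_{m+1} = γ_{2m+1}`, an element of `γ_{2m}` is some `(u, u⁻¹)`, and this is the
-- commutator of `(u, 1)` with `ac`.
include hm E in
theorem CommutatorGenerated.odd (Q : CommutatorGenerated m) :
    CommutatorGenerated (2 * m - 1) := by
  intro M hM hle h
  rw [show 2 * m - 1 + 2 = 2 * m + 1 by omega, grigSeries_odd_eq hm E Q] at hle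
  rw [show 2 * m - 1 + 1 = 2 * m by omega, grigSeries_even_eq hm E]
  rintro _ ⟨u, hu, v, hv, huv, rfl⟩
  have h1 : pair u u⁻¹ ∈ M := by
    have := (h (pair u 1) (E ▸ pair_mem_pairLift.2 ⟨hu, one_mem _⟩)).2
    rw [commutator_grigA_mul_grigC_eq, commutator_pair_grigA, inv_one, mul_one, one_mul] at this
    refine (Subgroup.mul_mem_cancel_right _ (hM.conj _ grigA_mem _ (hle ?_))).1 this
    rw [grigC_eq, pair_commutator, commutatorElement_one_left]
    exact pair_mem_pairLift.2 ⟨commutator_mem_grigSeries hu grigA_mem, one_mem _⟩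
  have := mul_mem h1 (hle (pair_mem_pairLift.2 ⟨one_mem _, huv⟩))
  simpa [pair_mul] using this

-- The argument for `γ_{2m+1}` is repeated with `M` in its place. The commutator with `c` is
-- recovered from that with `ac`, because `⁅(n, n⁻¹), a⁆ = (n², n⁻²)` already lies in `γ_{2m+2}`.
include hm E in
theorem CommutatorGenerated.even (Q : CommutatorGenerated m) :
    CommutatorGenerated (2 * m) := by
  intro M hM hle h
  have E' : grigSeries (2 * (m + 1) - 1) = pairLift (grigSeries (m + 1)) := by
    rw [show 2 * (m + 1) - 1 = 2 * m + 1 by omega]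
    exact grigSeries_odd_eq hm E Q
  have hdiag : ∀ w ∈ grigSeries (m + 1), pair w w⁻¹ ∈ M := fun w hw =>
    hle (pair_inv_mem_grigSeries_even (by omega) E' hw)
  have h1 : ∀ w ∈ grigSeries (m + 1), pair w 1 ∈ M := by
    refine Q.pair_one_mem hM hdiag
      (fun w hw => hle (pair_one_mem_grigSeries_even (by omega) E' hw)) (fun n hn => ?_)
    have hmem := pair_inv_mem_grigSeries_even hm E hn
    refine ⟨(h _ hmem).1, ?_⟩
    have h2 := (h _ hmem).2
    rw [commutator_grigA_mul_grigC_eq, commutator_pair_grigA] at h2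
    have e : pair (n * n⁻¹⁻¹) (n⁻¹ * n⁻¹) = pair (n ^ 2) (n ^ 2)⁻¹ := by
      rw [inv_inv, pow_two, mul_inv_rev]
    rw [e] at h2
    exact hM.mem_of_conj_mem grigA_mem
      ((Subgroup.mul_mem_cancel_left _ (hdiag _ (sq_mem_grigSeries hn))).1 h2)
  rw [grigSeries_odd_eq hm E Q]
  intro s hs
  obtain ⟨u, hu, v, hv, rfl⟩ := mem_pairLift.1 hs
  have := mul_mem (h1 u hu) (hM.pair_swap_mem (h1 v hv))
  rwa [pair_mul, mul_one, one_mul] at this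

end Step

/-- The two assertions need each other: the decomposition at `m` comes from both assertions at `m -
1`, and `CommutatorGenerated m` comes from both at `⌈m/2⌉`. For the latter, the values `3` and `4`
must be done by hand, because halving would leave the range `m ≥ 3`. -/
theorem grigSeries_structure (m : ℕ) (hm : 3 ≤ m) :
    grigSeries (2 * m - 1) = pairLift (grigSeries m) ∧ CommutatorGenerated m := by
  induction m using Nat.strong_induction_on with
  | _ m ih =>
    constructor
    · rcases hm.eq_or_lt with rfl | hm'
      · exact grigSeries_five
      · obtain ⟨k, rfl⟩ : ∃ k, m = k + 1 := ⟨m - 1, by omega⟩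
        obtain ⟨E, Q⟩ := ih k (by omega) (by omega)
        rw [show 2 * (k + 1) - 1 = 2 * k + 1 by omega]
        exact grigSeries_odd_eq (by omega) E Q
    · rcases (show m = 3 ∨ m = 4 ∨ 5 ≤ m by omega) with rfl | rfl | hm'
      · exact commutatorGenerated_three
      · exact commutatorGenerated_four
      · obtain ⟨k, rfl | rfl⟩ : ∃ k, m = 2 * k - 1 ∨ m = 2 * k := ⟨(m + 1) / 2, by omega⟩
        · obtain ⟨E, Q⟩ := ih k (by omega) (by omega)
          exact Q.odd (by omega) E
        · obtain ⟨E, Q⟩ := ih k (by omega) (by omega)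
          exact Q.even (by omega) E

theorem grigSeries_odd {m : ℕ} (hm : 3 ≤ m) :
    grigSeries (2 * m - 1) = pairLift (grigSeries m) := (grigSeries_structure m hm).1

theorem commutatorGenerated {m : ℕ} (hm : 3 ≤ m) : CommutatorGenerated m :=
  (grigSeries_structure m hm).2

theorem grigSeries_even {m : ℕ} (hm : 3 ≤ m) : grigSeries (2 * m) = diagLift m :=
  grigSeries_even_eq hm (grigSeries_odd hm)

/-! ### Openness and finite index -/

instance grigorchukGroup_fg : Group.FG grigorchukGroup := by
  rw [Group.fg_iff_subgroup_fg, Subgroup.fg_iff]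
  exact ⟨_, rfl, by simp⟩

/-- By induction each term is of finite index in the abstract finitely generated group, hence
finitely generated; its quotient by the next term is then a finitely generated abelian torsion
group, so finite. -/
theorem grigSeries_subgroupOf_index_ne_zero (n : ℕ) :
    ((grigSeries n).subgroupOf grigorchukGroup).index ≠ 0 := by
  induction n with
  | zero =>
    have : (grigSeries 0).subgroupOf grigorchukGroup = ⊤ := by
      rw [Subgroup.subgroupOf_eq_top]
      refine grigorchukGroup_le_closure.trans ?_
      rw [← grigSeries_one]
      exact grigSeries_antitone zero_le_one
    rw [this, Subgroup.index_top]
    exact one_ne_zero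
  | succ n ih =>
    set U := (grigSeries n).subgroupOf grigorchukGroup with hU
    set V := (grigSeries (n + 1)).subgroupOf grigorchukGroup with hV
    have hVU : V ≤ U := Subgroup.comap_mono (grigSeries_antitone (Nat.le_succ n))
    have : U.FiniteIndex := ⟨ih⟩
    have hfg : Group.FG U := inferInstance
    have hnormal : (V.subgroupOf U).Normal := by
      refine ⟨fun x hx g => ?_⟩
      exact (closedNormal_grigSeries (n + 1)).conj _
        (grigorchukGroup_le_closure (g : grigorchukGroup).2) _ hx
    have hcomm : ∀ x y : U ⧸ V.subgroupOf U, x * y = y * x := by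
      intro x y
      obtain ⟨x, rfl⟩ := QuotientGroup.mk_surjective x
      obtain ⟨y, rfl⟩ := QuotientGroup.mk_surjective y
      rw [← commutatorElement_eq_one_iff_mul_comm]
      refine (QuotientGroup.eq_one_iff ⁅x, y⁆).2 ?_
      exact commutator_mem_grigSeries x.2 (grigorchukGroup_le_closure (y : grigorchukGroup).2)
    let : CommGroup (U ⧸ V.subgroupOf U) := { mul_comm := hcomm }
    have htors : ∀ x : U ⧸ V.subgroupOf U, IsOfFinOrder x := by
      intro x
      obtain ⟨x, rfl⟩ := QuotientGroup.mk_surjective x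
      refine isOfFinOrder_iff_pow_eq_one.2 ⟨2, by norm_num, ?_⟩
      refine (QuotientGroup.eq_one_iff (x ^ 2)).2 ?_
      exact sq_mem_grigSeries x.2
    have hfin : Finite (U ⧸ V.subgroupOf U) := CommGroup.finite_of_fg_isMulTorsion _ htors
    have h1 : V.relIndex U ≠ 0 :=
      (Subgroup.finiteIndex_of_finite_quotient (H := V.subgroupOf U)).index_ne_zero
    rw [← Subgroup.relIndex_mul_index hVU]
    exact mul_ne_zero h1 ih

/-- Finitely many closed cosets of `M` cover the dense subgroup `grigorchukGroup`, hence all of `Γ`.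
-/
theorem ClosedNormal.relIndex_ne_zero {M : Subgroup treeAut} (hM : ClosedNormal M)
    (h : (M.subgroupOf grigorchukGroup).index ≠ 0) : M.relIndex Γ ≠ 0 := by
  obtain ⟨R, hR, hc⟩ := CosetCover.of_relIndex (H := grigorchukGroup) (K := M) h
  refine (CosetCover.relIndex (C := R.card) ⟨R, le_rfl, fun g hg => ?_⟩).1
  have hcl : IsClosed (⋃ r ∈ R, {g : treeAut | r⁻¹ * g ∈ M}) :=
    Set.Finite.isClosed_biUnion R.finite_toSet fun r _ =>
      hM.isClosed.preimage (f := fun g => r⁻¹ * g) (by fun_prop)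
  have hsub : (grigorchukGroup : Set treeAut) ⊆ ⋃ r ∈ R, {g : treeAut | r⁻¹ * g ∈ M} := by
    intro g hg
    obtain ⟨r, hr, h⟩ := hc g hg
    exact Set.mem_biUnion hr h
  have := closure_minimal hsub hcl hg
  simpa using this

theorem grigSeries_relIndex_ne_zero (n : ℕ) : (grigSeries n).relIndex Γ ≠ 0 :=
  (closedNormal_grigSeries n).relIndex_ne_zero (grigSeries_subgroupOf_index_ne_zero n)

theorem grigSeries_subgroupOf (n : ℕ) :
    (grigSeries n).subgroupOf Γ = lowerTwoCentralSeries Γ n := by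
  ext g
  rw [Subgroup.mem_subgroupOf, coe_mem_grigSeries]

theorem isOpen_lowerTwoCentralSeries (n : ℕ) :
    IsOpen (lowerTwoCentralSeries Γ n : Set Γ) := by
  have h := grigSeries_relIndex_ne_zero n
  rw [Subgroup.relIndex, grigSeries_subgroupOf] at h
  have : (lowerTwoCentralSeries Γ n).FiniteIndex := ⟨h⟩
  exact Subgroup.isOpen_of_isClosed_of_finiteIndex _ (lowerTwoCentralSeries_isClosed n)

theorem exists_levelStabilizer_le {M : Subgroup Γ} (hM : IsOpen (M : Set Γ)) :
    ∃ k, ∀ g : Γ, (g : treeAut) ∈ levelStabilizer k → g ∈ M := by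
  have h1 : (M : Set Γ) ∈ 𝓝 (1 : Γ) := hM.mem_nhds (one_mem M)
  rw [nhds_subtype_eq_comap, mem_comap] at h1
  obtain ⟨t, ht, hsub⟩ := h1
  obtain ⟨k, -, hk⟩ := (treeAut_nhds_hasBasis _).mem_iff.1 ht
  refine ⟨k, fun g hg => hsub (hk ?_)⟩
  simpa using hg

theorem levelStabilizer_index_ne_zero (n : ℕ) : (levelStabilizer n).index ≠ 0 := by
  have hfin : Finite {v : List Bool // v.length = n} :=
    inferInstanceAs (Finite (List.Vector Bool n))
  let f : treeAut → {v : List Bool // v.length = n} → {v : List Bool // v.length = n} :=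
    fun g v => ⟨g.1 v.1, (treeAut_length g v.1).trans v.2⟩
  have hf : ∀ g h, f g = f h → g⁻¹ * h ∈ levelStabilizer n := by
    intro g h hgh v hv
    have := congrArg Subtype.val (congrFun hgh ⟨v, hv⟩)
    change (g⁻¹).1 (h.1 v) = v
    rw [← show g.1 v = h.1 v from this]
    exact treeAut_inv_apply_self g v
  have : Function.Injective fun q : treeAut ⧸ levelStabilizer n => f q.out := by
    intro p q hpq
    have := QuotientGroup.eq.2 (hf _ _ hpq)
    simpa using this
  have hq : Finite (treeAut ⧸ levelStabilizer n) := Finite.of_injective _ this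
  exact (Subgroup.finiteIndex_of_finite_quotient (H := levelStabilizer n)).index_ne_zero

theorem index_ne_zero_of_isOpen {M : Subgroup Γ} (hM : IsOpen (M : Set Γ)) : M.index ≠ 0 := by
  obtain ⟨k, hk⟩ := exists_levelStabilizer_le hM
  have h1 : (levelStabilizer k).relIndex Γ ≠ 0 := fun h =>
    levelStabilizer_index_ne_zero k (Subgroup.index_eq_zero_of_relIndex_eq_zero h)
  have h2 : (levelStabilizer k).subgroupOf Γ ≤ M := fun g hg => hk g hg
  exact fun h => h1 (Nat.eq_zero_of_zero_dvd (h ▸ Subgroup.index_dvd_of_le h2))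

/-! ### Bounded width -/

/-- The factors `γ_{2k-1}/γ_{2k}` and `γ_{2k}/γ_{2k+1}` are both copies of `γ_k/γ_{k+1}`, through
`(u, v) ↦ uv` and `(u, v) ↦ u`. So the bound for the first five factors persists. -/
theorem cosetCover_grigSeries : ∃ C, ∀ m, CosetCover (grigSeries m) (grigSeries (m + 1)) C := by
  have hfin : ∀ m, (grigSeries (m + 1)).relIndex (grigSeries m) ≠ 0 := fun m h =>
    grigSeries_relIndex_ne_zero (m + 1)
      (Subgroup.relIndex_eq_zero_of_le_right (grigSeries_le m) h)
  set C := ∑ m ∈ Finset.range 5, (grigSeries (m + 1)).relIndex (grigSeries m) with hC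
  refine ⟨C, fun m => ?_⟩
  induction m using Nat.strong_induction_on with
  | _ m ih =>
    classical
    rcases lt_or_ge m 5 with hm | hm
    · refine (CosetCover.of_relIndex (hfin m)).mono ?_
      exact Finset.single_le_sum (f := fun m => (grigSeries (m + 1)).relIndex (grigSeries m))
        (fun _ _ => Nat.zero_le _) (Finset.mem_range.2 hm)
    · obtain ⟨k, hk | rfl⟩ : ∃ k, m = 2 * k - 1 ∨ m = 2 * k := ⟨(m + 1) / 2, by omega⟩
      · obtain ⟨R, hR, h⟩ := ih k (by omega)
        refine ⟨R.image fun r => pair r 1, Finset.card_image_le.trans hR, fun s hs => ?_⟩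
        rw [hk, grigSeries_odd (by omega)] at hs
        obtain ⟨u, hu, v, hv, rfl⟩ := mem_pairLift.1 hs
        obtain ⟨r, hr, hrm⟩ := h (u * v) (mul_mem hu hv)
        refine ⟨_, Finset.mem_image.2 ⟨r, hr, rfl⟩, ?_⟩
        rw [show m + 1 = 2 * k by omega, grigSeries_even (by omega), pair_inv, pair_mul]
        have hrm' := grigSeries_antitone (Nat.le_succ k) hrm
        refine pair_mem_diagLift.2 ⟨?_, by simpa using hv, by simpa [mul_assoc] using hrm⟩
        have := mul_mem hrm' (inv_mem hv)
        simpa [mul_assoc] using this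
      · obtain ⟨R, hR, h⟩ := ih k (by omega)
        refine ⟨R.image fun r => pair r r⁻¹, Finset.card_image_le.trans hR, fun s hs => ?_⟩
        rw [grigSeries_even (by omega)] at hs
        obtain ⟨u, hu, v, hv, huv, rfl⟩ := hs
        obtain ⟨r, hr, hrm⟩ := h u hu
        refine ⟨_, Finset.mem_image.2 ⟨r, hr, rfl⟩, ?_⟩
        rw [show 2 * k + 1 = 2 * (k + 1) - 1 by omega, grigSeries_odd (by omega), pair_inv,
          pair_mul, inv_inv]
        refine pair_mem_pairLift.2 ⟨hrm, ?_⟩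
        have hrk : r ∈ grigSeries k := by
          have := mul_mem hu (inv_mem (grigSeries_antitone (Nat.le_succ k) hrm))
          simpa using this
        have h1 := (closedNormal_grigSeries (k + 1)).conj r (grigSeries_le _ hrk) _ (inv_mem hrm)
        have := mul_mem h1 huv
        simpa [mul_assoc] using this

/-! ### Fourth powers -/

/-- The subgroups `γₙ γ_{⌈n/2⌉}²` of `Γ`, as subgroups of the automorphism group of the tree. -/
def grigLazard (n : ℕ) : Subgroup treeAut := (lazardSubgroup Γ n).map (Subgroup.subtype Γ)

theorem mem_grigLazard {n : ℕ} {z : treeAut} : z ∈ grigLazard n ↔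
    ∃ g ∈ grigSeries n, ∃ y ∈ grigSeries ((n + 1) / 2), z = g * y ^ 2 := by
  constructor
  · rintro ⟨_, ⟨g, hg, y, hy, rfl⟩, rfl⟩
    exact ⟨g, coe_mem_grigSeries.2 hg, y, coe_mem_grigSeries.2 hy, rfl⟩
  · rintro ⟨_, ⟨g, hg, rfl⟩, _, ⟨y, hy, rfl⟩, rfl⟩
    exact Subgroup.mem_map.2 ⟨g * y ^ 2, mem_lazardSubgroup.2 ⟨g, hg, y, hy, rfl⟩, by simp⟩

theorem coe_mem_grigLazard {n : ℕ} {z : Γ} :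
    (z : treeAut) ∈ grigLazard n ↔ z ∈ lazardSubgroup Γ n := by
  constructor
  · rintro ⟨y, hy, h⟩
    rwa [← Subtype.ext h]
  · intro h
    exact ⟨z, h, rfl⟩

theorem closedNormal_grigLazard (n : ℕ) : ClosedNormal (grigLazard n) :=
  closedNormal_map (Subgroup.isClosed_of_isOpen _
    (Subgroup.isOpen_mono (lowerTwoCentralSeries_le_lazardSubgroup n)
      (isOpen_lowerTwoCentralSeries n))) (lazardSubgroup_normal n)

theorem grigLazard_antitone : Antitone grigLazard := fun _ _ h =>
  Subgroup.map_mono (lazardSubgroup_antitone h)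

/-- The elements of `γ_j` whose fourth power lies in the Lazard subgroup of index `4j`. -/
def fourthPowerSubgroup (j : ℕ) : Subgroup treeAut where
  carrier := {y | y ∈ grigSeries j ∧ y ^ 4 ∈ grigLazard (4 * j)}
  one_mem' := ⟨one_mem _, by simp⟩
  mul_mem' := by
    rintro _ _ ⟨⟨y, hy, rfl⟩, hy4⟩ ⟨⟨z, hz, rfl⟩, hz4⟩
    refine ⟨coe_mem_grigSeries.2 (mul_mem hy hz), ?_⟩
    have h1 : y ^ 4 ∈ lazardSubgroup Γ (4 * j) := coe_mem_grigLazard.1 hy4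
    have h2 : z ^ 4 ∈ lazardSubgroup Γ (4 * j) := coe_mem_grigLazard.1 hz4
    exact coe_mem_grigLazard.2 (mul_pow_four_mem_lazardSubgroup hy hz h1 h2)
  inv_mem' := by
    rintro y ⟨hy, hy4⟩
    exact ⟨inv_mem hy, by rw [inv_pow]; exact inv_mem hy4⟩

theorem closedNormal_fourthPowerSubgroup (j : ℕ) : ClosedNormal (fourthPowerSubgroup j) := by
  refine ⟨?_, fun y hy => grigSeries_le _ hy.1, fun g hg y hy => ⟨?_, ?_⟩⟩
  · exact (closedNormal_grigSeries j).isClosed.inter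
      ((closedNormal_grigLazard _).isClosed.preimage (f := fun y => y ^ 4) (by fun_prop))
  · exact (closedNormal_grigSeries j).conj g hg y hy.1
  · rw [conj_pow]
    exact (closedNormal_grigLazard _).conj g hg _ hy.2

/-- Fourth powers of elements of `γ_j` lie in the Lazard subgroup of index `4j`. -/
def FourthPower (j : ℕ) : Prop := ∀ y ∈ grigSeries j, y ^ 4 ∈ grigLazard (4 * j)

theorem GeneratedBy.fourthPower {X : Set treeAut} {j : ℕ} (h : GeneratedBy X (grigSeries j))
    (hX : ∀ y ∈ X, y ∈ grigSeries j ∧ y ^ 4 ∈ grigLazard (4 * j)) : FourthPower j :=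
  fun _ hy => (h _ (closedNormal_fourthPowerSubgroup j) (fun y hy => hX y hy) hy).2

theorem fourthPower_one : FourthPower 1 := by
  intro y hy
  exact mem_grigLazard.2 ⟨1, one_mem _, y ^ 2, sq_mem_grigSeries hy, by rw [one_mul, ← pow_mul]⟩

theorem grigX_pow_four_eq : grigX ^ 4 =
    pair (((grigA * grigC) ^ 2) ^ 2)⁻¹ (((grigA * grigC) ^ 2) ^ 2) := by
  rw [grigX_eq, pair_pow, grigC_mul_grigA_eq_inv, inv_pow, ← pow_mul]

/-- One has `grigX⁴ = (p⁻¹, p)` with `p = (ac)⁴`, and `p ≡ grigX²` modulo `γ₄`. Hence `grigX⁴` is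
the square of `(grigX⁻¹, grigX) ∈ γ₄` up to a factor in `γ₈`. -/
theorem grigX_pow_four_mem : grigX ^ 4 ∈ grigLazard 8 := by
  set y' := grigB * grigY * grigB⁻¹ with hy'
  have hy'm : y' ∈ grigSeries 2 := (closedNormal_grigSeries 2).conj _ grigB_mem _ grigY_mem
  set p := ((grigA * grigC) ^ 2) ^ 2 with hp
  set e := grigX * ⁅grigX, y'⁆⁻¹ * grigX⁻¹ with he
  have hem : e ∈ grigSeries 4 := (closedNormal_grigSeries 4).conj _ (grigSeries_le _ grigX_mem) _
    (inv_mem (commutator_mem_grigSeries_add grigX_mem hy'm))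
  have hpe : p = e * grigX ^ 2 := by
    have h1 : (grigA * grigC) ^ 2 = grigX * y' := by
      rw [grigA_mul_grigC_sq, commutator_grigC_eq, hy', grigX, grigY]
    rw [hp, h1, mul_sq_eq, ← he, hy', conj_pow, grigY_sq, mul_one, mul_inv_cancel, mul_one]
  refine mem_grigLazard.2 ⟨pair (p⁻¹ * grigX ^ 2) (p * (grigX ^ 2)⁻¹), ?_, pair grigX⁻¹ grigX,
    (closedNormal_grigSeries 4).pair_swap_mem pair_grigX_grigX_inv_mem, ?_⟩
  · rw [show 8 = 2 * 4 from rfl, grigSeries_even (by norm_num)]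
    refine pair_mem_diagLift.2 ⟨?_, ?_, ?_⟩
    · rw [hpe]
      have := (closedNormal_grigSeries 4).conj (grigX ^ 2)⁻¹
        (inv_mem (pow_mem (grigSeries_le _ grigX_mem) 2)) _ (inv_mem hem)
      simpa [mul_assoc] using this
    · rw [hpe, mul_inv_cancel_right]
      exact hem
    · have : p⁻¹ * grigX ^ 2 * (p * (grigX ^ 2)⁻¹) = ⁅p⁻¹, grigX ^ 2⁆ := by
        simp only [commutatorElement_def, inv_inv, mul_assoc]
      rw [this]
      refine grigSeries_antitone (show 4 + 1 ≤ 3 + 3 by norm_num)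
        (commutator_mem_grigSeries_add (inv_mem ?_) grigX_sq_mem)
      exact sq_mem_grigSeries grigA_mul_grigC_sq_mem
  · rw [grigX_pow_four_eq, ← hp, pair_pow, pair_mul]
    simp

theorem grigA_mul_grigC_pow_four : ((grigA * grigC) ^ 2) ^ 2 = pair grigY grigY := by
  have h2 : (grigA * grigD) ^ 2 = grigY := by
    rw [pow_two, grigY, commutatorElement_def, grigA_inv, grigD_inv]
    group
  have h1 : (grigA * grigC) ^ 2 = pair (grigA * grigD)⁻¹ (grigA * grigD) := by
    rw [pow_two, ← mul_assoc]
    nth_rewrite 1 [grigC_eq]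
    rw [grigA_conj_pair, grigC_eq, pair_mul, mul_inv_rev, grigA_inv, grigD_inv]
  have h3 : grigY⁻¹ = grigY := inv_eq_of_mul_eq_one_left (by rw [← pow_two, grigY_sq])
  rw [h1, pair_pow, inv_pow, h2, h3]

theorem grigX_pow_eight : grigX ^ 8 = 1 := by
  rw [show 8 = 4 * 2 from rfl, pow_mul, grigX_pow_four_eq, grigA_mul_grigC_pow_four, pair_pow,
    inv_pow, pair_pow, grigY_sq, pair_one, inv_one, pair_one]

theorem fourthPower_two : FourthPower 2 := by
  refine generatedBy_grigSeries_two.fourthPower ?_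
  rintro y (rfl | rfl)
  · exact ⟨grigX_mem, grigX_pow_four_mem⟩
  · refine ⟨grigY_mem, ?_⟩
    rw [show 4 = 2 * 2 from rfl, pow_mul, grigY_sq, one_pow]
    exact one_mem _

/-- Using a single coordinate costs a little: `y ∈ γ_{2m}` only gives `(y, 1) ∈ γ_{4m-1}`, whence
the index `8m - 2`. This suffices for fourth powers in `γ_{2m-1}`, but not in `γ_{2m}`. -/
theorem pair_one_mem_grigLazard {m : ℕ} (hm : 2 ≤ m) {z : treeAut} (hz : z ∈ grigLazard (4 * m)) :
    pair z 1 ∈ grigLazard (8 * m - 2) := by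
  obtain ⟨g, hg, y, hy, rfl⟩ := mem_grigLazard.1 hz
  refine mem_grigLazard.2 ⟨pair g 1, ?_, pair y 1, ?_, ?_⟩
  · refine grigSeries_antitone (show 8 * m - 2 ≤ 2 * (4 * m) - 1 by omega) ?_
    rw [grigSeries_odd (by omega)]
    exact pair_mem_pairLift.2 ⟨hg, one_mem _⟩
  · rw [show (8 * m - 2 + 1) / 2 = 2 * (2 * m) - 1 by omega, grigSeries_odd (by omega)]
    rw [show (4 * m + 1) / 2 = 2 * m by omega] at hy
    exact pair_mem_pairLift.2 ⟨hy, one_mem _⟩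
  · rw [pair_pow, pair_mul, one_pow, one_mul]

/-- On the diagonal nothing is lost: `(y, y)` lies in `γ_{4m}`, because `y²` lies one term deeper
than `y`. -/
theorem pair_self_mem_grigLazard {m : ℕ} (hm : 2 ≤ m) {z : treeAut} (hz : z ∈ grigLazard (4 * m)) :
    pair z z ∈ grigLazard (8 * m) := by
  obtain ⟨g, hg, y, hy, rfl⟩ := mem_grigLazard.1 hz
  rw [show (4 * m + 1) / 2 = 2 * m by omega] at hy
  refine mem_grigLazard.2 ⟨pair g g, ?_, pair y y, ?_, ?_⟩
  · rw [show 8 * m = 2 * (4 * m) by omega, grigSeries_even (by omega)]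
    exact pair_mem_diagLift.2 ⟨hg, hg, by rw [← pow_two]; exact sq_mem_grigSeries hg⟩
  · rw [show (8 * m + 1) / 2 = 2 * (2 * m) by omega, grigSeries_even (by omega)]
    exact pair_mem_diagLift.2 ⟨hy, hy, by rw [← pow_two]; exact sq_mem_grigSeries hy⟩
  · rw [pair_pow, pair_mul]

theorem FourthPower.pair_pow_mem {m n : ℕ} (hm : 2 ≤ m) (R : FourthPower m) (hn : n ≤ 8 * m - 2)
    {u v : treeAut} (hu : u ∈ grigSeries m) (hv : v ∈ grigSeries m) :
    pair u v ^ 4 ∈ grigLazard n := by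
  refine grigLazard_antitone hn ?_
  have h1 := pair_one_mem_grigLazard hm (R u hu)
  have h2 := (closedNormal_grigLazard _).pair_swap_mem (pair_one_mem_grigLazard hm (R v hv))
  have := mul_mem h1 h2
  rwa [pair_mul, mul_one, one_mul, ← pair_pow] at this

theorem fourthPower_three : FourthPower 3 := by
  refine generatedBy_grigSeries_three.fourthPower ?_
  rintro y (rfl | rfl)
  · refine ⟨grigX_sq_mem, ?_⟩
    rw [← pow_mul, grigX_pow_eight]
    exact one_mem _
  · exact ⟨pair_grigX_one_mem,
      fourthPower_two.pair_pow_mem le_rfl (by norm_num) grigX_mem (one_mem _)⟩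

/-- Factor `(u, v) = (u, u)(1, u⁻¹v)`. The diagonal factor loses nothing, and `u⁻¹v ∈ γ_{m+1}` gives
the index `8(m + 1) - 2 ≥ 8m` for the other; `fourthPowerSubgroup` recombines them. -/
theorem FourthPower.pair_pow_mem_of_mul_mem {m : ℕ} (hm : 2 ≤ m) (R : FourthPower m)
    (R' : FourthPower (m + 1)) {u v : treeAut} (hu : u ∈ grigSeries m)
    (huv : u * v ∈ grigSeries (m + 1)) (huu : pair u v ∈ grigSeries (2 * m)) :
    pair u v ^ 4 ∈ grigLazard (4 * (2 * m)) := by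
  have hw : u⁻¹ * v ∈ grigSeries (m + 1) := by
    have := mul_mem (inv_mem (sq_mem_grigSeries hu)) huv
    have e : (u ^ 2)⁻¹ * (u * v) = u⁻¹ * v := by rw [pow_two]; group
    rwa [e] at this
  have h1 : pair 1 (u⁻¹ * v) ∈ grigSeries (2 * m) := by
    refine grigSeries_antitone (show 2 * m ≤ 2 * (m + 1) - 1 by omega) ?_
    rw [grigSeries_odd (by omega)]
    exact pair_mem_pairLift.2 ⟨one_mem _, hw⟩
  have h2 : pair u u ∈ grigSeries (2 * m) := by
    have := mul_mem huu (inv_mem h1)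
    simpa [pair_inv, pair_mul] using this
  have h3 : pair u u ∈ fourthPowerSubgroup (2 * m) := by
    refine ⟨h2, ?_⟩
    rw [pair_pow, show 4 * (2 * m) = 8 * m by omega]
    exact pair_self_mem_grigLazard hm (R u hu)
  have h4 : pair 1 (u⁻¹ * v) ∈ fourthPowerSubgroup (2 * m) :=
    ⟨h1, R'.pair_pow_mem (by omega) (by omega) (one_mem _) hw⟩
  have := mul_mem h3 h4
  rw [pair_mul, mul_one, mul_inv_cancel_left] at this
  exact this.2

theorem fourthPower_four : FourthPower 4 := by
  refine generatedBy_grigSeries_four.fourthPower ?_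
  rintro y (rfl | hy)
  · refine ⟨pair_grigX_grigX_inv_mem, ?_⟩
    exact fourthPower_two.pair_pow_mem_of_mul_mem le_rfl fourthPower_three grigX_mem
      (by rw [mul_inv_cancel]; exact one_mem _) pair_grigX_grigX_inv_mem
  · refine ⟨grigSeries_antitone (by norm_num) (pairLift_grigSeries_three_le hy), ?_⟩
    obtain ⟨u, hu, v, hv, rfl⟩ := mem_pairLift.1 hy
    exact fourthPower_three.pair_pow_mem (by norm_num) (by norm_num) hu hv

theorem fourthPower {j : ℕ} (hj : 1 ≤ j) : FourthPower j := by
  induction j using Nat.strong_induction_on with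
  | _ j ih =>
    rcases (show j = 1 ∨ j = 2 ∨ j = 3 ∨ j = 4 ∨ 5 ≤ j by omega) with
      rfl | rfl | rfl | rfl | hj'
    · exact fourthPower_one
    · exact fourthPower_two
    · exact fourthPower_three
    · exact fourthPower_four
    · obtain ⟨m, hm | rfl⟩ : ∃ m, j = 2 * m - 1 ∨ j = 2 * m := ⟨(j + 1) / 2, by omega⟩
      · intro y hy
        rw [hm, grigSeries_odd (by omega)] at hy
        obtain ⟨u, hu, v, hv, rfl⟩ := mem_pairLift.1 hy
        exact (ih m (by omega) (by omega)).pair_pow_mem (by omega) (by omega) hu hv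
      · intro y hy
        have hy' := hy
        rw [grigSeries_even (by omega)] at hy
        obtain ⟨u, hu, v, hv, huv, rfl⟩ := hy
        exact (ih m (by omega) (by omega)).pair_pow_mem_of_mul_mem (by omega)
          (ih (m + 1) (by omega) (by omega)) hu huv hy'

theorem jenningsZassenhausSeries_grigorchukClosure (n : ℕ) :
    jenningsZassenhausSeries Γ n = lazardSubgroup Γ n := by
  refine jenningsZassenhausSeries_eq_lazardSubgroup isOpen_lowerTwoCentralSeries
    (fun j hj y hy => ?_) n
  exact coe_mem_grigLazard.1 (fourthPower hj y (coe_mem_grigSeries.2 hy))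

/-- Since `k` is odd, both `γ_{2k-1}` and `γ_k`, which is the term of index `⌈(2k-1)/2⌉`, are
products of two copies of earlier terms. -/
theorem grigLazard_odd {k : ℕ} (hk : 5 ≤ k) (hodd : k % 2 = 1) :
    grigLazard (2 * k - 1) = pairLift (grigLazard k) := by
  have hj : 2 * ((k + 1) / 2) - 1 = k := by omega
  have hj' : (2 * k - 1 + 1) / 2 = k := by omega
  have hE := grigSeries_odd (m := (k + 1) / 2) (by omega)
  rw [hj] at hE
  apply le_antisymm
  · intro z hz
    obtain ⟨g, hg, y, hy, rfl⟩ := mem_grigLazard.1 hz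
    rw [hj', hE] at hy
    rw [grigSeries_odd (by omega)] at hg
    obtain ⟨p, hp, q, hq, rfl⟩ := mem_pairLift.1 hg
    obtain ⟨u, hu, v, hv, rfl⟩ := mem_pairLift.1 hy
    rw [pair_pow, pair_mul]
    exact pair_mem_pairLift.2 ⟨mem_grigLazard.2 ⟨p, hp, u, hu, rfl⟩,
      mem_grigLazard.2 ⟨q, hq, v, hv, rfl⟩⟩
  · intro z hz
    obtain ⟨_, hp', _, hq', rfl⟩ := mem_pairLift.1 hz
    obtain ⟨p, hp, u, hu, rfl⟩ := mem_grigLazard.1 hp'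
    obtain ⟨q, hq, v, hv, rfl⟩ := mem_grigLazard.1 hq'
    refine mem_grigLazard.2 ⟨pair p q, ?_, pair u v, ?_, ?_⟩
    · rw [grigSeries_odd (by omega)]
      exact pair_mem_pairLift.2 ⟨hp, hq⟩
    · rw [hj', hE]
      exact pair_mem_pairLift.2 ⟨hu, hv⟩
    · rw [pair_pow, pair_mul]

/-! ### Indices in products of subgroups -/

theorem Subgroup.relIndex_prod {G G' : Type*} [Group G] [Group G'] (V A : Subgroup G)
    (W B : Subgroup G') : (V.prod W).relIndex (A.prod B) = V.relIndex A * W.relIndex B := by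
  have h1 : A.prod B = (⊤ : Subgroup (A × B)).map (A.subtype.prodMap B.subtype) := by
    ext ⟨x, y⟩
    simp [Subgroup.mem_prod]
  have h2 : (V.prod W).comap (A.subtype.prodMap B.subtype) =
      (V.subgroupOf A).prod (W.subgroupOf B) := by
    ext ⟨x, y⟩
    simp [Subgroup.mem_prod, Subgroup.mem_subgroupOf]
  rw [h1, ← Subgroup.relIndex_comap, h2, Subgroup.relIndex_top_right, Subgroup.index_prod]
  rfl

/-- The elements of `A × B`, acting on the two subtrees below the root. -/
def pairProd (A B : Subgroup treeAut) : Subgroup treeAut := (A.prod B).map pairHom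

theorem mem_pairProd {A B : Subgroup treeAut} {s : treeAut} :
    s ∈ pairProd A B ↔ ∃ u ∈ A, ∃ v ∈ B, s = pair u v := by
  constructor
  · rintro ⟨⟨u, v⟩, ⟨hu, hv⟩, rfl⟩
    exact ⟨u, hu, v, hv, rfl⟩
  · rintro ⟨u, hu, v, hv, rfl⟩
    exact ⟨(u, v), ⟨hu, hv⟩, rfl⟩

theorem relIndex_pairLift_pairProd (V A B : Subgroup treeAut) :
    (pairLift V).relIndex (pairProd A B) = V.relIndex A * V.relIndex B := by
  rw [pairLift, pairProd, Subgroup.relIndex_map_map_of_injective _ _ pairHom_injective,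
    Subgroup.relIndex_prod]

/-- This lower bound comes from `γ₃ × γ₃ ≤ Γ`; the matching upper bound in `relIndex_pairLift_le`
comes from `Γ` being covered by two cosets of `Γ × Γ`. -/
theorem relIndex_pairLift_ge (V : Subgroup treeAut) (hV : V.relIndex Γ ≠ 0)
    (hV' : (pairLift V).relIndex Γ ≠ 0) :
    (V.relIndex Γ) ^ 2 ≤ ((grigSeries 3).relIndex Γ) ^ 2 * (pairLift V).relIndex Γ := by
  have h1 : V.relIndex Γ ≤ V.relIndex (grigSeries 3) * (grigSeries 3).relIndex Γ := by
    have hd : V.relIndex Γ ∣ (V ⊓ grigSeries 3).relIndex Γ :=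
      Subgroup.relIndex_dvd_of_le_left _ inf_le_left
    have he := Subgroup.relIndex_inf_mul_relIndex (H := V) (K := grigSeries 3) (L := Γ)
    rw [inf_eq_left.2 (grigSeries_le 3)] at he
    rw [he]
    refine Nat.le_of_dvd (Nat.pos_of_ne_zero ?_) hd
    exact Subgroup.relIndex_inf_ne_zero hV (grigSeries_relIndex_ne_zero 3)
  have h2 : (pairLift V).relIndex (pairProd (grigSeries 3) (grigSeries 3)) ≤
      (pairLift V).relIndex Γ :=
    Subgroup.relIndex_le_of_le_right (pairLift_grigSeries_three_le.trans (grigSeries_le 5)) hV'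
  rw [relIndex_pairLift_pairProd] at h2
  calc (V.relIndex Γ) ^ 2 ≤ (V.relIndex (grigSeries 3) * (grigSeries 3).relIndex Γ) ^ 2 :=
        Nat.pow_le_pow_left h1 2
    _ = ((grigSeries 3).relIndex Γ) ^ 2 * (V.relIndex (grigSeries 3) *
        V.relIndex (grigSeries 3)) := by ring
    _ ≤ _ := Nat.mul_le_mul_left _ h2

theorem cosetCover_grigorchukClosure_pairProd : CosetCover Γ (pairProd Γ Γ) 2 := by
  classical
  refine ⟨{1, grigA}, Finset.card_le_two, fun s hs => ?_⟩
  obtain ⟨u, hu, v, hv, rfl | rfl⟩ := exists_pair_of_mem hs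
  · exact ⟨1, by simp, mem_pairProd.2 ⟨u, hu, v, hv, by simp⟩⟩
  · exact ⟨grigA, by simp, mem_pairProd.2 ⟨u, hu, v, hv, by simp⟩⟩

theorem relIndex_pairLift_le {V : Subgroup treeAut} (hV : V.relIndex Γ ≠ 0) :
    (pairLift V).relIndex Γ ≠ 0 ∧ (pairLift V).relIndex Γ ≤ 2 * (V.relIndex Γ) ^ 2 := by
  have h : (pairLift V).relIndex (pairProd Γ Γ) ≠ 0 := by
    rw [relIndex_pairLift_pairProd]
    exact mul_ne_zero hV hV
  have := (cosetCover_grigorchukClosure_pairProd.trans (CosetCover.of_relIndex h)).relIndex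
  rwa [relIndex_pairLift_pairProd, ← pow_two] at this

/-! ### Self-similar sequences of subgroups and growth rates -/

/-- A sequence of subgroups of finite index in `Γ` in which the terms are, up to bounded index, the
products of two copies of earlier terms. -/
structure SelfSimilarSeries (F : ℕ → Subgroup treeAut) : Prop where
  relIndex_ne_zero : ∀ n, (F n).relIndex Γ ≠ 0
  tendsto_relIndex : Tendsto (fun n => (F n).relIndex Γ) atTop atTop
  exists_pairLift : ∃ C, ∀ M, ∀ᶠ n in atTop, ∃ m ≥ M, F n ≤ pairLift (F m) ∧
    CosetCover (pairLift (F m)) (F n) C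

/-- The logarithm of the relative index. -/
noncomputable def logRelIndex (V K : Subgroup treeAut) : ℝ := Real.log (V.relIndex K)

theorem logRelIndex_nonneg (V K : Subgroup treeAut) : 0 ≤ logRelIndex V K :=
  Real.log_natCast_nonneg _

/-- The logarithm of the index of `F n` in `K` grows at least like `σ` times that in `Γ`. -/
def GrowthGE (F : ℕ → Subgroup treeAut) (K : Subgroup treeAut) (σ : ℝ) : Prop :=
  ∃ c, ∀ᶠ n in atTop, (F n).relIndex K ≠ 0 ∧
    σ * logRelIndex (F n) Γ - c ≤ logRelIndex (F n) K

/-- The logarithm of the index of `F n` in `K` grows at most like `σ` times that in `Γ`. -/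
def GrowthLE (F : ℕ → Subgroup treeAut) (K : Subgroup treeAut) (σ : ℝ) : Prop :=
  ∃ c, ∀ᶠ n in atTop, (F n).relIndex K ≠ 0 ∧
    logRelIndex (F n) K ≤ σ * logRelIndex (F n) Γ + c

theorem CosetCover.relIndex_bounds {V W K : Subgroup treeAut} {C : ℕ} (hle : W ≤ V)
    (hc : CosetCover V W C) (hK : V.relIndex K ≠ 0) :
    W.relIndex K ≠ 0 ∧ logRelIndex V K ≤ logRelIndex W K ∧
      logRelIndex W K ≤ logRelIndex V K + Real.log C := by
  have he := Subgroup.relIndex_inf_mul_relIndex (H := W) (K := V) (L := K)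
  rw [inf_eq_left.2 hle] at he
  have h1 : W.relIndex (V ⊓ K) ≠ 0 := fun h =>
    hc.relIndex.1 (Subgroup.relIndex_eq_zero_of_le_right inf_le_left h)
  have h2 : W.relIndex (V ⊓ K) ≤ C :=
    (Subgroup.relIndex_le_of_le_right inf_le_left hc.relIndex.1).trans hc.relIndex.2
  have h3 : logRelIndex W K = Real.log (W.relIndex (V ⊓ K)) + logRelIndex V K := by
    rw [logRelIndex, ← he, Nat.cast_mul, Real.log_mul (by exact_mod_cast h1)
      (by exact_mod_cast hK), logRelIndex]
  refine ⟨he ▸ mul_ne_zero h1 hK, ?_, ?_⟩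
  · rw [h3]
    linarith [Real.log_natCast_nonneg (W.relIndex (V ⊓ K))]
  · rw [h3]
    have : Real.log (W.relIndex (V ⊓ K)) ≤ Real.log C :=
      Real.log_le_log (by exact_mod_cast Nat.pos_of_ne_zero h1) (by exact_mod_cast h2)
    linarith

theorem logRelIndex_pairLift_pairProd {V A B : Subgroup treeAut} (hA : V.relIndex A ≠ 0)
    (hB : V.relIndex B ≠ 0) :
    logRelIndex (pairLift V) (pairProd A B) = logRelIndex V A + logRelIndex V B := by
  rw [logRelIndex, relIndex_pairLift_pairProd, Nat.cast_mul, Real.log_mul (by exact_mod_cast hA)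
    (by exact_mod_cast hB), logRelIndex, logRelIndex]

theorem abs_logRelIndex_pairLift_sub_le : ∃ c, ∀ V : Subgroup treeAut, V.relIndex Γ ≠ 0 →
    |logRelIndex (pairLift V) Γ - 2 * logRelIndex V Γ| ≤ c := by
  have h3 := grigSeries_relIndex_ne_zero 3
  refine ⟨max (Real.log 2) (2 * logRelIndex (grigSeries 3) Γ), fun V hV => ?_⟩
  obtain ⟨h1, h2⟩ := relIndex_pairLift_le hV
  have h4 := relIndex_pairLift_ge V hV h1
  have hp : (0 : ℝ) < V.relIndex Γ := by exact_mod_cast Nat.pos_of_ne_zero hV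
  have hp1 : (0 : ℝ) < (pairLift V).relIndex Γ := by exact_mod_cast Nat.pos_of_ne_zero h1
  have hp3 : (0 : ℝ) < (grigSeries 3).relIndex Γ := by exact_mod_cast Nat.pos_of_ne_zero h3
  rw [abs_le]
  constructor
  · have : Real.log (((V.relIndex Γ : ℕ) : ℝ) ^ 2) ≤
        Real.log ((((grigSeries 3).relIndex Γ : ℕ) : ℝ) ^ 2 * (pairLift V).relIndex Γ) :=
      Real.log_le_log (by positivity) (by exact_mod_cast h4)
    rw [Real.log_mul (by positivity) (by positivity), Real.log_pow, Real.log_pow] at this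
    have hm := le_max_right (Real.log 2) (2 * logRelIndex (grigSeries 3) Γ)
    simp only [logRelIndex] at hm ⊢
    push_cast at this
    linarith
  · have : Real.log ((pairLift V).relIndex Γ) ≤ Real.log (2 * ((V.relIndex Γ : ℕ) : ℝ) ^ 2) :=
      Real.log_le_log (by positivity) (by exact_mod_cast h2)
    rw [Real.log_mul (by positivity) (by positivity), Real.log_pow] at this
    have hm := le_max_left (Real.log 2) (2 * logRelIndex (grigSeries 3) Γ)
    simp only [logRelIndex] at hm ⊢
    push_cast at this
    linarith

/-- `pairProd A B` need not lie in `Γ`, so finiteness of its relative indices has to be carried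
along: an infinite relative index has the value `0`, and the logarithm of `0` is `0`. -/
theorem SelfSimilarSeries.exists_log_bounds {F : ℕ → Subgroup treeAut} (hF : SelfSimilarSeries F)
    {A B : Subgroup treeAut} {p : ℕ → Prop} (hp : ∀ᶠ m in atTop, p m)
    (hA : ∀ m, p m → (F m).relIndex A ≠ 0) (hB : ∀ m, p m → (F m).relIndex B ≠ 0) :
    ∃ c, ∀ᶠ n in atTop, ∃ m, p m ∧ (F n).relIndex (pairProd A B) ≠ 0 ∧
      |logRelIndex (F n) Γ - 2 * logRelIndex (F m) Γ| ≤ c ∧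
      |logRelIndex (F n) (pairProd A B) - (logRelIndex (F m) A + logRelIndex (F m) B)| ≤ c := by
  obtain ⟨C, hC⟩ := hF.exists_pairLift
  obtain ⟨c, hc⟩ := abs_logRelIndex_pairLift_sub_le
  obtain ⟨M, hM⟩ := eventually_atTop.1 hp
  refine ⟨c + Real.log C, (hC M).mono fun n hn => ?_⟩
  obtain ⟨m, hm, hle, hcov⟩ := hn
  have hpm := hM m hm
  have hV := hF.relIndex_ne_zero m
  have h1 := hcov.relIndex_bounds hle (relIndex_pairLift_le hV).1
  have hAB : (pairLift (F m)).relIndex (pairProd A B) ≠ 0 := by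
    rw [relIndex_pairLift_pairProd]
    exact mul_ne_zero (hA m hpm) (hB m hpm)
  have h2 := hcov.relIndex_bounds hle hAB
  have h3 := abs_le.1 (hc (F m) hV)
  have h4 := logRelIndex_pairLift_pairProd (hA m hpm) (hB m hpm)
  refine ⟨m, hpm, h2.1, abs_le.2 ⟨?_, ?_⟩, abs_le.2 ⟨?_, ?_⟩⟩ <;>
    linarith [Real.log_natCast_nonneg C, h1.2.1, h1.2.2, h2.2.1, h2.2.2]

theorem GrowthGE.pairProd {F : ℕ → Subgroup treeAut} (hF : SelfSimilarSeries F)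
    {A B : Subgroup treeAut} {σ τ : ℝ} (hA : GrowthGE F A σ) (hB : GrowthGE F B τ) :
    GrowthGE F (pairProd A B) ((σ + τ) / 2) := by
  obtain ⟨c₁, h₁⟩ := hA
  obtain ⟨c₂, h₂⟩ := hB
  obtain ⟨c, h⟩ := hF.exists_log_bounds (h₁.and h₂) (fun _ h => h.1.1) (fun _ h => h.2.1)
  refine ⟨|(σ + τ) / 2| * c + c + c₁ + c₂, h.mono ?_⟩
  rintro n ⟨m, ⟨⟨-, hm₁⟩, -, hm₂⟩, hne, hc₁, hc₂⟩
  refine ⟨hne, ?_⟩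
  have h3 : (σ + τ) / 2 * (logRelIndex (F n) Γ - 2 * logRelIndex (F m) Γ) ≤
      |(σ + τ) / 2| * c := by
    refine (le_abs_self _).trans ?_
    rw [abs_mul]
    exact mul_le_mul_of_nonneg_left hc₁ (abs_nonneg _)
  have h4 := (abs_le.1 hc₂).1
  linarith

theorem GrowthLE.pairProd {F : ℕ → Subgroup treeAut} (hF : SelfSimilarSeries F)
    {A B : Subgroup treeAut} {σ τ : ℝ} (hA : GrowthLE F A σ) (hB : GrowthLE F B τ) :
    GrowthLE F (pairProd A B) ((σ + τ) / 2) := by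
  obtain ⟨c₁, h₁⟩ := hA
  obtain ⟨c₂, h₂⟩ := hB
  obtain ⟨c, h⟩ := hF.exists_log_bounds (h₁.and h₂) (fun _ h => h.1.1) (fun _ h => h.2.1)
  refine ⟨|(σ + τ) / 2| * c + c + c₁ + c₂, h.mono ?_⟩
  rintro n ⟨m, ⟨⟨-, hm₁⟩, -, hm₂⟩, hne, hc₁, hc₂⟩
  refine ⟨hne, ?_⟩
  have h3 : -((σ + τ) / 2 * (logRelIndex (F n) Γ - 2 * logRelIndex (F m) Γ)) ≤
      |(σ + τ) / 2| * c := by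
    refine (neg_le_abs _).trans ?_
    rw [abs_mul]
    exact mul_le_mul_of_nonneg_left hc₁ (abs_nonneg _)
  have h4 := (abs_le.1 hc₂).2
  linarith

theorem GrowthGE.bot (F : ℕ → Subgroup treeAut) {σ : ℝ} (hσ : σ ≤ 0) : GrowthGE F ⊥ σ := by
  refine ⟨0, Eventually.of_forall fun n => ⟨by simp, ?_⟩⟩
  have := mul_nonneg (neg_nonneg.2 hσ) (logRelIndex_nonneg (F n) Γ)
  linarith [logRelIndex_nonneg (F n) ⊥]

theorem GrowthLE.bot (F : ℕ → Subgroup treeAut) : GrowthLE F ⊥ 0 :=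
  ⟨0, Eventually.of_forall fun n => ⟨by simp, by simp [logRelIndex]⟩⟩

theorem GrowthLE.grigorchukClosure {F : ℕ → Subgroup treeAut} (hF : SelfSimilarSeries F) {σ : ℝ}
    (hσ : 1 ≤ σ) : GrowthLE F Γ σ := by
  refine ⟨0, Eventually.of_forall fun n => ⟨hF.relIndex_ne_zero n, ?_⟩⟩
  have := mul_nonneg (sub_nonneg.2 hσ) (logRelIndex_nonneg (F n) Γ)
  linarith

theorem GrowthGE.of_relIndex_ne_zero {F : ℕ → Subgroup treeAut} (hF : SelfSimilarSeries F)
    {M : Subgroup treeAut} (hM : M ≤ Γ) (hM' : M.relIndex Γ ≠ 0) : GrowthGE F M 1 := by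
  refine ⟨logRelIndex M Γ, Eventually.of_forall fun n => ?_⟩
  have hn := hF.relIndex_ne_zero n
  have h1 : (F n).relIndex M ≠ 0 := fun h => hn (Subgroup.relIndex_eq_zero_of_le_right hM h)
  refine ⟨h1, ?_⟩
  have h2 : (F n).relIndex Γ ≤ (F n).relIndex M * M.relIndex Γ := by
    have he := Subgroup.relIndex_inf_mul_relIndex (H := F n) (K := M) (L := Γ)
    rw [inf_eq_left.2 hM] at he
    rw [he]
    exact Subgroup.relIndex_le_of_le_left inf_le_left (he ▸ mul_ne_zero h1 hM')
  have h3 : Real.log ((F n).relIndex Γ) ≤ Real.log ((F n).relIndex M * M.relIndex Γ) :=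
    Real.log_le_log (by exact_mod_cast Nat.pos_of_ne_zero hn) (by exact_mod_cast h2)
  rw [Real.log_mul (by exact_mod_cast h1) (by exact_mod_cast hM')] at h3
  simp only [logRelIndex]
  linarith

theorem GrowthGE.mono_left {F : ℕ → Subgroup treeAut} (hF : SelfSimilarSeries F)
    {K H : Subgroup treeAut} {σ : ℝ} (h : GrowthGE F K σ) (hKH : K ≤ H) (hH : H ≤ Γ) :
    GrowthGE F H σ := by
  obtain ⟨c, h⟩ := h
  refine ⟨c, h.mono fun n hn => ?_⟩
  have h1 : (F n).relIndex H ≠ 0 := fun h =>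
    hF.relIndex_ne_zero n (Subgroup.relIndex_eq_zero_of_le_right hH h)
  refine ⟨h1, hn.2.trans (Real.log_le_log (by exact_mod_cast Nat.pos_of_ne_zero hn.1) ?_)⟩
  exact_mod_cast Subgroup.relIndex_le_of_le_right hKH h1

theorem GrowthLE.mono_left {F : ℕ → Subgroup treeAut}
    {K H : Subgroup treeAut} {σ : ℝ} (h : GrowthLE F K σ) (hHK : H ≤ K) :
    GrowthLE F H σ := by
  obtain ⟨c, h⟩ := h
  refine ⟨c, h.mono fun n hn => ?_⟩
  have h1 : (F n).relIndex H ≠ 0 := fun h =>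
    hn.1 (Subgroup.relIndex_eq_zero_of_le_right hHK h)
  refine ⟨h1, (Real.log_le_log (by exact_mod_cast Nat.pos_of_ne_zero h1) ?_).trans hn.2⟩
  exact_mod_cast Subgroup.relIndex_le_of_le_right hHK hn.1

/-! ### Products along the rightmost ray of the tree -/

/-- The product of subgroups acting on the subtrees that hang off the rightmost ray at the levels
`1, …, l`, and of a subgroup acting on the subtree below the vertex of level `l` of the ray. -/
def spineProd (R : Subgroup treeAut) : ℕ → (ℕ → Subgroup treeAut) → Subgroup treeAut
  | 0, _ => R
  | l + 1, N => pairProd (N 0) (spineProd R l fun i => N (i + 1))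

/-- At depth `l` the tail is replaced by the trivial group, whose rate `0` is at least `x l - 1`.
Each averaging step upwards halves this error. -/
theorem GrowthGE.spineProd {F : ℕ → Subgroup treeAut} (hF : SelfSimilarSeries F) (l : ℕ)
    {N : ℕ → Subgroup treeAut} {x d : ℕ → ℝ} (hx : ∀ i, x i ≤ 1)
    (hd : ∀ i, x i = (d i + x (i + 1)) / 2) (hN : ∀ i, GrowthGE F (N i) (d i)) :
    GrowthGE F (spineProd ⊥ l N) (x 0 - (1 / 2) ^ l) := by
  induction l generalizing N x d with
  | zero => exact GrowthGE.bot F (by simpa using hx 0)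
  | succ l ih =>
    have := (hN 0).pairProd hF (ih (fun i => hx (i + 1)) (fun i => hd (i + 1)) fun i => hN (i + 1))
    have e : x 0 - (1 / 2) ^ (l + 1) = (d 0 + (x (0 + 1) - (1 / 2) ^ l)) / 2 := by
      rw [hd 0]
      ring
    rw [e]
    exact this

/-- Here the tail is replaced by `Γ`, of rate `1 ≤ x l + 1`; again the error is halved at each
level. -/
theorem GrowthLE.spineProd {F : ℕ → Subgroup treeAut} (hF : SelfSimilarSeries F) (l : ℕ)
    {N : ℕ → Subgroup treeAut} {x d : ℕ → ℝ} (hx : ∀ i, 0 ≤ x i)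
    (hd : ∀ i, x i = (d i + x (i + 1)) / 2) (hN : ∀ i, GrowthLE F (N i) (d i)) :
    GrowthLE F (spineProd Γ l N) (x 0 + (1 / 2) ^ l) := by
  induction l generalizing N x d with
  | zero => exact GrowthLE.grigorchukClosure hF (by simpa using hx 0)
  | succ l ih =>
    have := (hN 0).pairProd hF (ih (fun i => hx (i + 1)) (fun i => hd (i + 1)) fun i => hN (i + 1))
    have e : x 0 + (1 / 2) ^ (l + 1) = (d 0 + (x (0 + 1) + (1 / 2) ^ l)) / 2 := by
      rw [hd 0]
      ring
    rw [e]
    exact this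

/-- The additive constants depend on `l`, but they disappear after division by the logarithm of the
index, which tends to infinity; only then is `l` allowed to grow. -/
theorem tendsto_div_of_growth {F : ℕ → Subgroup treeAut} (hF : SelfSimilarSeries F)
    {H : Subgroup treeAut} {η : ℝ} (h1 : ∀ l : ℕ, GrowthGE F H (η - (1 / 2) ^ l))
    (h2 : ∀ l : ℕ, GrowthLE F H (η + (1 / 2) ^ l)) :
    Tendsto (fun n => logRelIndex (F n) H / logRelIndex (F n) Γ) atTop (𝓝 η) := by
  have hlog : Tendsto (fun n => logRelIndex (F n) Γ) atTop atTop :=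
    Real.tendsto_log_atTop.comp (tendsto_natCast_atTop_atTop.comp hF.tendsto_relIndex)
  rw [Metric.tendsto_nhds]
  intro ε hε
  obtain ⟨l, hl⟩ := exists_pow_lt_of_lt_one (half_pos hε) (show (1 / 2 : ℝ) < 1 by norm_num)
  obtain ⟨c₁, h1⟩ := h1 l
  obtain ⟨c₂, h2⟩ := h2 l
  filter_upwards [h1, h2, hlog.eventually_gt_atTop 0,
    hlog.eventually_gt_atTop ((|c₁| + |c₂|) / (ε / 2))] with n hn₁ hn₂ hpos hbig
  rw [div_lt_iff₀ (half_pos hε)] at hbig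
  have := mul_lt_mul_of_pos_left hl hpos
  rw [Real.dist_eq, abs_lt]
  constructor
  · rw [lt_sub_iff_add_lt, lt_div_iff₀ hpos]
    linarith [hn₁.2, le_abs_self c₁, abs_nonneg c₂]
  · rw [sub_lt_iff_lt_add, div_lt_iff₀ hpos]
    linarith [hn₂.2, le_abs_self c₂, abs_nonneg c₁]

/-! ### Hausdorff dimension -/

theorem relIndex_map_subtype (M : Subgroup Γ) :
    (M.map (Subgroup.subtype Γ)).relIndex Γ = M.index := by
  have h : (⊤ : Subgroup Γ).map (Subgroup.subtype Γ) = Γ := by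
    rw [← MonoidHom.range_eq_map, Subgroup.range_subtype]
  have h' := Subgroup.relIndex_map_map_of_injective M ⊤ (Subgroup.subtype_injective Γ)
  rwa [h, Subgroup.relIndex_top_right] at h'

theorem hausdorffDim_eq_liminf {F : ℕ → Subgroup Γ} (hF : ∀ n, (F n).Normal) (H : Subgroup Γ) :
    hausdorffDim F H = liminf (fun n => logRelIndex ((F n).map (Subgroup.subtype Γ))
      (H.map (Subgroup.subtype Γ)) / logRelIndex ((F n).map (Subgroup.subtype Γ)) Γ) atTop := by
  unfold hausdorffDim logRelIndex
  congr 1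
  funext n
  have := hF n
  -- By normality `|H Fₙ : Fₙ| = |H : H ∩ Fₙ|`.
  rw [Subgroup.relIndex_sup_right, relIndex_map_subtype,
    Subgroup.relIndex_map_map_of_injective _ _ (Subgroup.subtype_injective Γ)]

theorem hausdorffDim_mem_Icc {F : ℕ → Subgroup Γ}
    (hfin : ∀ n, (F n).index ≠ 0) (H : Subgroup Γ) : hausdorffDim F H ∈ Set.Icc (0 : ℝ) 1 := by
  have h0 : ∀ n, (0 : ℝ) ≤
      Real.log ((F n).relIndex (H ⊔ F n) : ℝ) / Real.log ((F n).index : ℝ) := fun n =>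
    div_nonneg (Real.log_natCast_nonneg _) (Real.log_natCast_nonneg _)
  have h1 : ∀ n, Real.log ((F n).relIndex (H ⊔ F n) : ℝ) / Real.log ((F n).index : ℝ) ≤ 1 := by
    intro n
    refine div_le_one_of_le₀ ?_ (Real.log_natCast_nonneg _)
    have hne : (F n).relIndex (H ⊔ F n) ≠ 0 := fun h =>
      hfin n (Subgroup.index_eq_zero_of_relIndex_eq_zero h)
    refine Real.log_le_log (by exact_mod_cast Nat.pos_of_ne_zero hne) ?_
    have := Subgroup.relIndex_le_of_le_right (H := F n) (K := H ⊔ F n) le_top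
      (by rw [Subgroup.relIndex_top_right]; exact hfin n)
    rw [Subgroup.relIndex_top_right] at this
    exact_mod_cast this
  have hb : IsBoundedUnder (· ≤ ·) atTop fun n =>
      Real.log ((F n).relIndex (H ⊔ F n) : ℝ) / Real.log ((F n).index : ℝ) :=
    isBoundedUnder_of ⟨1, h1⟩
  have hb' : IsBoundedUnder (· ≥ ·) atTop fun n =>
      Real.log ((F n).relIndex (H ⊔ F n) : ℝ) / Real.log ((F n).index : ℝ) :=
    isBoundedUnder_of ⟨0, h0⟩
  exact ⟨le_liminf_of_le hb.isCoboundedUnder_ge (Eventually.of_forall h0),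
    liminf_le_of_frequently_le (Frequently.of_forall h1) hb'⟩

/-! ### The three series are filtrations -/

theorem grigX_ne_one : grigX ≠ 1 := by
  intro h
  have := congrArg (fun s : treeAut => s.1 [false, false]) h
  rw [grigX_eq] at this
  simp [grigA, grigC, autOfInvol, actA, actC] at this

/-- `γ₃ × γ₃` embeds in `γ₃`, which is impossible for a nontrivial finite group. -/
theorem infinite_grigSeries_three : Infinite (grigSeries 3) := by
  by_contra hinf
  rw [not_infinite_iff_finite] at hinf
  let f : grigSeries 3 × grigSeries 3 → grigSeries 3 := fun p => ⟨pair p.1 p.2,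
    grigSeries_antitone (by norm_num) (pairLift_grigSeries_three_le
      (pair_mem_pairLift.2 ⟨p.1.2, p.2.2⟩))⟩
  have hf : Function.Injective f := by
    intro p q h
    obtain ⟨h1, h2⟩ := pair_injective (congrArg Subtype.val h)
    exact Prod.ext (Subtype.ext h1) (Subtype.ext h2)
  have hcard := Nat.card_le_card_of_injective f hf
  rw [Nat.card_prod] at hcard
  have hpos : 0 < Nat.card (grigSeries 3) := Nat.card_pos
  have h1 : Nat.card (grigSeries 3) ≤ 1 := by nlinarith
  have : Subsingleton (grigSeries 3) := Finite.card_le_one_iff_subsingleton.1 h1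
  have h2 : (⟨pair grigX 1, pair_grigX_one_mem⟩ : grigSeries 3) = 1 := Subsingleton.elim _ _
  have h3 : pair grigX 1 = pair 1 1 := (congrArg Subtype.val h2).trans pair_one.symm
  exact grigX_ne_one (pair_injective h3).1

instance infinite_grigorchukClosure : Infinite Γ :=
  have := infinite_grigSeries_three
  Infinite.of_injective (Subgroup.inclusion (grigSeries_le 3)) (Subgroup.inclusion_injective _)

/-- Any finite set of elements of the infinite group `Γ` is separated modulo some `F N`, because the
intersection of the chain is trivial. -/
theorem IsFiltrationSeries.tendsto_index {F : ℕ → Subgroup Γ} (hF : IsFiltrationSeries F) :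
    Tendsto (fun n => (F n).index) atTop atTop := by
  have hne : ∀ n, (F n).index ≠ 0 := fun n => index_ne_zero_of_isOpen (hF.isOpen n)
  refine tendsto_atTop_atTop_of_monotone (fun m n h => ?_) fun k => ?_
  · exact Nat.le_of_dvd (Nat.pos_of_ne_zero (hne n)) (Subgroup.index_dvd_of_le (hF.antitone h))
  · obtain ⟨T, hT⟩ := Infinite.exists_subset_card_eq Γ k
    have h1 : ∀ g : Γ, ∃ n, g ∈ F n → g = 1 := by
      intro g
      by_contra! h
      have : g ∈ ⨅ n, F n := Subgroup.mem_iInf.2 fun n => (h n).1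
      rw [hF.iInf_eq, Subgroup.mem_bot] at this
      exact (h 0).2 this
    choose ν hν using h1
    set N := (T ×ˢ T).sup fun p => ν (p.1⁻¹ * p.2) with hN
    refine ⟨N, ?_⟩
    have hfin : Finite (Γ ⧸ F N) := Subgroup.finiteIndex_iff_finite_quotient.1 ⟨hne N⟩
    let f : T → Γ ⧸ F N := fun t => (t : Γ)
    have hf : Function.Injective f := by
      intro s t hst
      have h2 := QuotientGroup.eq.1 hst
      have h3 : ν ((s : Γ)⁻¹ * t) ≤ N :=
        Finset.le_sup (f := fun p : Γ × Γ => ν (p.1⁻¹ * p.2))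
          (Finset.mem_product.2 ⟨s.2, t.2⟩ : ((s : Γ), (t : Γ)) ∈ T ×ˢ T)
      exact Subtype.ext (inv_mul_eq_one.1 (hν _ (hF.antitone h3 h2)))
    have h4 := Nat.card_le_card_of_injective f hf
    rw [Nat.card_eq_fintype_card, Fintype.card_coe, hT] at h4
    exact h4

theorem grigSeries_le_levelStabilizer (k : ℕ) : grigSeries (2 ^ (k + 1) + 1) ≤ levelStabilizer k := by
  induction k with
  | zero => exact fun g _ => mem_levelStabilizer_zero g
  | succ k ih =>
    have hk : 2 ≤ 2 ^ (k + 1) := Nat.le_self_pow (by omega) 2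
    -- The sequence `2 ^ (k + 1) + 1` is an orbit of `m ↦ 2m - 1`, starting from `3`.
    have h1 : 2 ^ (k + 1 + 1) + 1 = 2 * (2 ^ (k + 1) + 1) - 1 := by
      rw [pow_succ 2 (k + 1)]
      omega
    rw [h1, grigSeries_odd (by omega)]
    intro s hs
    obtain ⟨u, hu, v, hv, rfl⟩ := mem_pairLift.1 hs
    exact pair_mem_levelStabilizer_succ.2 ⟨ih hu, ih hv⟩

theorem isFiltrationSeries_lowerTwoCentralSeries :
    IsFiltrationSeries (lowerTwoCentralSeries Γ) where
  zero := rfl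
  antitone := lowerTwoCentralSeries_antitone
  isOpen := isOpen_lowerTwoCentralSeries
  normal := lowerTwoCentralSeries_normal
  iInf_eq := by
    refine (Subgroup.eq_bot_iff_forall _).2 fun g hg => ?_
    rw [Subgroup.mem_iInf] at hg
    refine Subtype.ext (eq_one_of_mem_levelStabilizer fun k => ?_)
    exact grigSeries_le_levelStabilizer k (coe_mem_grigSeries.2 (hg _))

theorem isFiltrationSeries_jenningsZassenhausSeries :
    IsFiltrationSeries (jenningsZassenhausSeries Γ) where
  zero := by rw [jenningsZassenhausSeries]
  antitone := fun m n h => by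
    rw [jenningsZassenhausSeries_grigorchukClosure, jenningsZassenhausSeries_grigorchukClosure]
    exact lazardSubgroup_antitone h
  isOpen := fun n => Subgroup.isOpen_mono (lowerTwoCentralSeries_le_jenningsZassenhausSeries n)
    (isOpen_lowerTwoCentralSeries n)
  normal := jenningsZassenhausSeries_normal
  iInf_eq := by
    rw [eq_bot_iff, ← isFiltrationSeries_lowerTwoCentralSeries.iInf_eq]
    -- The term `D_{2n} = γ_{2n} γₙ²` is contained in `γₙ`.
    refine le_iInf fun n => (iInf_le _ (2 * n)).trans ?_
    rw [jenningsZassenhausSeries_grigorchukClosure]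
    refine (lazardSubgroup_le _).trans (lowerTwoCentralSeries_antitone (by omega))

theorem isFiltrationSeries_grigorchukLevelSeries : IsFiltrationSeries grigorchukLevelSeries where
  zero := by
    rw [grigorchukLevelSeries, Subgroup.subgroupOf_eq_top]
    exact fun g _ => mem_levelStabilizer_zero g
  antitone := fun _ _ h => Subgroup.comap_mono (levelStabilizer_antitone h)
  isOpen := fun n => (isOpen_levelStabilizer n).preimage continuous_subtype_val
  normal := fun n => (levelStabilizer_normal n).subgroupOf _
  iInf_eq := by
    refine (Subgroup.eq_bot_iff_forall _).2 fun g hg => ?_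
    rw [Subgroup.mem_iInf] at hg
    exact Subtype.ext (eq_one_of_mem_levelStabilizer fun k => hg k)

/-! ### The three series are self-similar -/

theorem IsFiltrationSeries.selfSimilarSeries {F : ℕ → Subgroup Γ} (hF : IsFiltrationSeries F)
    (C : ℕ) (h : ∀ M, ∀ᶠ n in atTop, ∃ m ≥ M, (F n).map (Subgroup.subtype Γ) ≤
      pairLift ((F m).map (Subgroup.subtype Γ)) ∧
      CosetCover (pairLift ((F m).map (Subgroup.subtype Γ))) ((F n).map (Subgroup.subtype Γ)) C) :
    SelfSimilarSeries fun n => (F n).map (Subgroup.subtype Γ) where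
  relIndex_ne_zero n := by
    rw [relIndex_map_subtype]
    exact index_ne_zero_of_isOpen (hF.isOpen n)
  tendsto_relIndex := by
    simp only [relIndex_map_subtype]
    exact hF.tendsto_index
  exists_pairLift := ⟨C, h⟩

theorem CosetCover.refl {G : Type*} [Group G] (H : Subgroup G) : CosetCover H H 1 :=
  ⟨{1}, by simp, fun h hh => ⟨1, by simp, by simpa using hh⟩⟩

theorem CosetCover.of_succ {G : Type*} [Group G] {F : ℕ → Subgroup G} {C : ℕ}
    (h : ∀ n, CosetCover (F n) (F (n + 1)) C) (a k : ℕ) : CosetCover (F a) (F (a + k)) (C ^ k) := by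
  induction k with
  | zero => exact CosetCover.refl _
  | succ k ih => exact ih.trans (h _)

theorem CosetCover.of_succ_of_le {G : Type*} [Group G] {F : ℕ → Subgroup G} {C : ℕ}
    (h : ∀ n, CosetCover (F n) (F (n + 1)) C) {a b k : ℕ} (hab : a ≤ b) (hb : b ≤ a + k) :
    CosetCover (F a) (F b) ((C + 1) ^ k) := by
  have h1 := CosetCover.of_succ h a (b - a)
  rw [Nat.add_sub_cancel' hab] at h1
  refine h1.mono ((Nat.pow_le_pow_left (Nat.le_succ C) _).trans ?_)
  exact Nat.pow_le_pow_right (Nat.succ_pos C) (by omega)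

theorem CosetCover.map_iff {G G' : Type*} [Group G] [Group G'] {f : G →* G'}
    (hf : Function.Injective f) {H K : Subgroup G} {C : ℕ} :
    CosetCover (H.map f) (K.map f) C ↔ CosetCover H K C := by
  constructor <;> intro h
  · have := h.relIndex
    rw [Subgroup.relIndex_map_map_of_injective _ _ hf] at this
    exact (CosetCover.of_relIndex this.1).mono this.2
  · have := h.relIndex
    rw [← Subgroup.relIndex_map_map_of_injective _ _ hf] at this
    exact (CosetCover.of_relIndex this.1).mono this.2

theorem selfSimilarSeries_lowerTwoCentralSeries :
    SelfSimilarSeries fun n => (lowerTwoCentralSeries Γ n).map (Subgroup.subtype Γ) := by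
  obtain ⟨C, hC⟩ := cosetCover_grigSeries
  refine isFiltrationSeries_lowerTwoCentralSeries.selfSimilarSeries ((C + 1) ^ 1) fun M => ?_
  filter_upwards [eventually_ge_atTop (2 * M + 6)] with n hn
  -- For `m = ⌈n/2⌉`, the index `2m - 1` is `n` or `n - 1`, so one step down the series suffices.
  refine ⟨(n + 1) / 2, by omega, ?_⟩
  change grigSeries n ≤ pairLift (grigSeries ((n + 1) / 2)) ∧
    CosetCover (pairLift (grigSeries ((n + 1) / 2))) (grigSeries n) _
  rw [← grigSeries_odd (by omega)]
  exact ⟨grigSeries_antitone (by omega), CosetCover.of_succ_of_le hC (by omega) (by omega)⟩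

theorem selfSimilarSeries_jenningsZassenhausSeries :
    SelfSimilarSeries fun n => (jenningsZassenhausSeries Γ n).map (Subgroup.subtype Γ) := by
  obtain ⟨C, hC⟩ := cosetCover_grigSeries
  have hC' : ∀ n, CosetCover (grigLazard n) (grigLazard (n + 1)) (C * C) := fun n =>
    (CosetCover.map_iff (Subgroup.subtype_injective Γ)).2 (CosetCover.lazardSubgroup
      ((CosetCover.map_iff (Subgroup.subtype_injective Γ)).1 (hC n))
      ((CosetCover.map_iff (Subgroup.subtype_injective Γ)).1 (hC _)))
  refine isFiltrationSeries_jenningsZassenhausSeries.selfSimilarSeries ((C * C + 1) ^ 3)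
    fun M => ?_
  filter_upwards [eventually_ge_atTop (4 * M + 9)] with n hn
  -- This `m` is odd, as required by `grigLazard_odd`, and `2m - 1` lies between `n - 3` and `n`;
  -- hence the exponent `3`.
  refine ⟨2 * ((n - 1) / 4) + 1, by omega, ?_⟩
  rw [jenningsZassenhausSeries_grigorchukClosure, jenningsZassenhausSeries_grigorchukClosure]
  change grigLazard n ≤ pairLift (grigLazard (2 * ((n - 1) / 4) + 1)) ∧
    CosetCover (pairLift (grigLazard (2 * ((n - 1) / 4) + 1))) (grigLazard n) _
  rw [← grigLazard_odd (by omega) (by omega)]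
  exact ⟨grigLazard_antitone (by omega), CosetCover.of_succ_of_le hC' (by omega) (by omega)⟩

theorem mem_map_grigorchukLevelSeries {n : ℕ} {s : treeAut} :
    s ∈ (grigorchukLevelSeries n).map (Subgroup.subtype Γ) ↔ s ∈ levelStabilizer n ∧ s ∈ Γ := by
  rw [grigorchukLevelSeries, Subgroup.subgroupOf_map_subtype, Subgroup.mem_inf]

/-- Deep level stabilizers lie in `γ₃`, and every pair of elements of `γ₃` belongs to `Γ`. So from
some level on the decomposition is an equality. -/
theorem selfSimilarSeries_grigorchukLevelSeries :
    SelfSimilarSeries fun n => (grigorchukLevelSeries n).map (Subgroup.subtype Γ) := by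
  obtain ⟨k, hk⟩ := exists_levelStabilizer_le (isOpen_lowerTwoCentralSeries 3)
  refine isFiltrationSeries_grigorchukLevelSeries.selfSimilarSeries 1 fun M => ?_
  filter_upwards [eventually_ge_atTop (M + k + 1)] with n hn
  obtain ⟨m, rfl⟩ : ∃ m, n = m + 1 := ⟨n - 1, by omega⟩
  refine ⟨m, by omega, ?_⟩
  have h : (grigorchukLevelSeries (m + 1)).map (Subgroup.subtype Γ) =
      pairLift ((grigorchukLevelSeries m).map (Subgroup.subtype Γ)) := by
    have h3 : (grigorchukLevelSeries m).map (Subgroup.subtype Γ) ≤ grigSeries 3 := by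
      intro g hg
      obtain ⟨h1, h2⟩ := mem_map_grigorchukLevelSeries.1 hg
      exact (coe_mem_grigSeries (g := ⟨g, h2⟩)).2
        (hk ⟨g, h2⟩ (levelStabilizer_antitone (by omega) h1))
    apply le_antisymm
    · intro s hs
      obtain ⟨h1, h2⟩ := mem_map_grigorchukLevelSeries.1 hs
      obtain ⟨u, v, rfl⟩ := exists_eq_pair (levelStabilizer_antitone (by omega) h1)
      obtain ⟨hu, hv⟩ := mem_of_pair_mem h2
      obtain ⟨hu', hv'⟩ := pair_mem_levelStabilizer_succ.1 h1
      exact pair_mem_pairLift.2 ⟨mem_map_grigorchukLevelSeries.2 ⟨hu', hu⟩,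
        mem_map_grigorchukLevelSeries.2 ⟨hv', hv⟩⟩
    · intro s hs
      refine mem_map_grigorchukLevelSeries.2 ⟨?_, ?_⟩
      · obtain ⟨u, hu, v, hv, rfl⟩ := mem_pairLift.1 hs
        exact pair_mem_levelStabilizer_succ.2 ⟨(mem_map_grigorchukLevelSeries.1 hu).1,
          (mem_map_grigorchukLevelSeries.1 hv).1⟩
      · exact grigSeries_le _ (pairLift_grigSeries_three_le (pairLift_mono h3 hs))
  rw [h]
  exact ⟨le_rfl, CosetCover.refl _⟩

/-! ### Subgroups of prescribed dimension -/

theorem exists_binary_digits {η : ℝ} (hη : η ∈ Set.Icc (0 : ℝ) 1) :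
    ∃ (I : ℕ → Bool) (x : ℕ → ℝ), x 0 = η ∧ (∀ i, x i ∈ Set.Icc (0 : ℝ) 1) ∧
      ∀ i, x i = ((if I i then 1 else 0) + x (i + 1)) / 2 := by
  classical
  -- The tails of a binary expansion, as the orbit of `η` under doubling with the digit subtracted;
  -- for `η = 1` all digits are `1`.
  let x : ℕ → ℝ := fun n => Nat.rec η (fun _ y => if 1 ≤ 2 * y then 2 * y - 1 else 2 * y) n
  have hx : ∀ i, x (i + 1) = if 1 ≤ 2 * x i then 2 * x i - 1 else 2 * x i := fun i => rfl
  refine ⟨fun i => decide (1 ≤ 2 * x i), x, rfl, fun i => ?_, fun i => ?_⟩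
  · induction i with
    | zero => exact hη
    | succ i ih =>
      rw [hx]
      obtain ⟨h0, h1⟩ := ih
      split_ifs with h
      · constructor <;> linarith
      · constructor <;> linarith
  · rw [hx]
    by_cases h : 1 ≤ 2 * x i <;> simp [h]

theorem hausdorffDim_eq_of_spineProd {F : ℕ → Subgroup Γ} (hF : IsFiltrationSeries F)
    (hF' : SelfSimilarSeries fun n => (F n).map (Subgroup.subtype Γ)) {H : Subgroup Γ}
    {I : ℕ → Bool} {x : ℕ → ℝ} (hx : ∀ i, x i ∈ Set.Icc (0 : ℝ) 1)
    (hI : ∀ i, x i = ((if I i then 1 else 0) + x (i + 1)) / 2) {M : ℕ → Subgroup treeAut}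
    (hM : ∀ i, M i ≤ Γ) (hM' : ∀ i, I i → (M i).relIndex Γ ≠ 0)
    (h1 : ∀ l, spineProd ⊥ l (fun i => if I i then M i else ⊥) ≤ H.map (Subgroup.subtype Γ))
    (h2 : ∀ l, H.map (Subgroup.subtype Γ) ≤ spineProd Γ l fun i => if I i then Γ else ⊥) :
    hausdorffDim F H = x 0 := by
  have hle : H.map (Subgroup.subtype Γ) ≤ Γ := by
    rintro _ ⟨g, -, rfl⟩
    exact g.2
  rw [hausdorffDim_eq_liminf hF.normal]
  refine (tendsto_div_of_growth hF' (fun l => ?_) fun l => ?_).liminf_eq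
  · refine (GrowthGE.spineProd hF' l (fun i => (hx i).2) hI fun i => ?_).mono_left hF' (h1 l) hle
    cases h : I i
    · simpa using GrowthGE.bot _ le_rfl
    · simpa using GrowthGE.of_relIndex_ne_zero hF' (hM i) (hM' i h)
  · refine (GrowthLE.spineProd hF' l (fun i => (hx i).1) hI fun i => ?_).mono_left (h2 l)
    cases h : I i
    · simpa using GrowthLE.bot _
    · simpa using GrowthLE.grigorchukClosure hF' le_rfl

/-! ### Automorphisms supported below a vertex -/

/-- The automorphism acting as `g` on the subtree below `p`, and trivially elsewhere. -/
def vertexEmb : List Bool → treeAut →* treeAut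
  | [] => MonoidHom.id _
  | false :: p => (pairHom.comp (MonoidHom.inl treeAut treeAut)).comp (vertexEmb p)
  | true :: p => (pairHom.comp (MonoidHom.inr treeAut treeAut)).comp (vertexEmb p)

theorem vertexEmb_false (p : List Bool) (g : treeAut) :
    vertexEmb (false :: p) g = pair (vertexEmb p g) 1 := rfl

theorem vertexEmb_true (p : List Bool) (g : treeAut) :
    vertexEmb (true :: p) g = pair 1 (vertexEmb p g) := rfl

theorem vertexEmb_append (p : List Bool) (g : treeAut) (w : List Bool) :
    (vertexEmb p g).1 (p ++ w) = p ++ g.1 w := by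
  induction p with
  | nil => rfl
  | cons x p ih =>
    cases x
    · rw [vertexEmb_false, List.cons_append, pair_false, ih, List.cons_append]
    · rw [vertexEmb_true, List.cons_append, pair_true, ih, List.cons_append]

theorem vertexEmb_apply_of_not_prefix {p w : List Bool} (h : ¬ p <+: w) (g : treeAut) :
    (vertexEmb p g).1 w = w := by
  induction p generalizing w with
  | nil => exact absurd List.nil_prefix h
  | cons x p ih =>
    rcases w with _ | ⟨y, w⟩
    · exact treeAut_map_nil _
    · rw [List.cons_prefix_cons, not_and] at h
      cases x <;> cases y
      · rw [vertexEmb_false, pair_false, ih (h rfl)]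
      · rw [vertexEmb_false, pair_true, treeAut_one_apply]
      · rw [vertexEmb_true, pair_false, treeAut_one_apply]
      · rw [vertexEmb_true, pair_true, ih (h rfl)]

theorem vertexEmb_injective (p : List Bool) : Function.Injective (vertexEmb p) := by
  intro g h H
  refine treeAut_ext fun w => ?_
  have := congrArg (fun s : treeAut => s.1 (p ++ w)) H
  simp only [vertexEmb_append] at this
  exact List.append_cancel_left this

theorem vertexEmb_conj (n : treeAut) (p : List Bool) (h : treeAut) :
    n * vertexEmb p h * n⁻¹ =
      vertexEmb (n.1 p) (treeSection n p * h * (treeSection n p)⁻¹) := by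
  rw [mul_inv_eq_iff_eq_mul]
  refine treeAut_ext fun w => ?_
  rw [treeAut_mul_apply, treeAut_mul_apply]
  by_cases hw : p <+: w
  · obtain ⟨w, rfl⟩ := hw
    rw [vertexEmb_append, treeSection_spec, treeSection_spec, vertexEmb_append,
      ← treeAut_mul_apply _ (treeSection n p), inv_mul_cancel_right, treeAut_mul_apply]
  · rw [vertexEmb_apply_of_not_prefix hw, vertexEmb_apply_of_not_prefix]
    rintro ⟨t, ht⟩
    obtain ⟨r, hr⟩ := treeAut_map_append_list n⁻¹ (n.1 p) t
    rw [ht, treeAut_inv_apply_self, treeAut_inv_apply_self] at hr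
    exact hw ⟨r, hr.symm⟩

theorem vertexEmb_commute {p q : List Bool} (hl : p.length = q.length) (hne : p ≠ q)
    (g h : treeAut) : Commute (vertexEmb p g) (vertexEmb q h) := by
  induction p generalizing q with
  | nil =>
    rw [List.length_nil, eq_comm, List.length_eq_zero_iff] at hl
    exact absurd hl.symm hne
  | cons x p ih =>
    rcases q with _ | ⟨y, q⟩
    · simp at hl
    · have hl' : p.length = q.length := by simpa using hl
      cases x <;> cases y
      · have := ih hl' (fun h => hne (by rw [h]))
        simp only [vertexEmb_false, Commute, SemiconjBy, pair_mul] at this ⊢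
        rw [this]
      · simp [vertexEmb_false, vertexEmb_true, Commute, SemiconjBy, pair_mul]
      · simp [vertexEmb_false, vertexEmb_true, Commute, SemiconjBy, pair_mul]
      · have := ih hl' (fun h => hne (by rw [h]))
        simp only [vertexEmb_true, Commute, SemiconjBy, pair_mul] at this ⊢
        rw [this]

theorem pair_mem_grigSeries_three {u v : treeAut} (hu : u ∈ grigSeries 3) (hv : v ∈ grigSeries 3) :
    pair u v ∈ grigSeries 3 :=
  grigSeries_antitone (by norm_num) (pairLift_grigSeries_three_le (pair_mem_pairLift.2 ⟨hu, hv⟩))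

theorem vertexEmb_mem (p : List Bool) {g : treeAut} (hg : g ∈ grigSeries 3) :
    vertexEmb p g ∈ grigSeries 3 := by
  induction p with
  | nil => exact hg
  | cons x p ih =>
    cases x
    · exact pair_mem_grigSeries_three ih (one_mem _)
    · exact pair_mem_grigSeries_three (one_mem _) ih

theorem continuous_vertexEmb (p : List Bool) : Continuous (vertexEmb p) := by
  induction p with
  | nil => exact continuous_id
  | cons x p ih =>
    cases x
    · exact continuous_pair.comp (ih.prodMk continuous_const)
    · exact continuous_pair.comp (continuous_const.prodMk ih)

/-- If `K` contains the copies of some `γ_m` at all vertices of some level, then `K` contains some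
term of the lower 2-central series. -/
theorem exists_grigSeries_le_of_vertexEmb_mem {m : ℕ} (hm : 3 ≤ m) (s : ℕ) {K : Subgroup treeAut}
    (h : ∀ q : List Bool, q.length = s → ∀ n ∈ grigSeries m, vertexEmb q n ∈ K) :
    ∃ k, 3 ≤ k ∧ grigSeries k ≤ K := by
  induction s generalizing K with
  | zero => exact ⟨m, hm, fun n hn => h [] rfl n hn⟩
  | succ s ih =>
    obtain ⟨k₀, h₀, hk₀⟩ := ih (K := K.comap (pairHom.comp (MonoidHom.inl treeAut treeAut)))
      fun q hq n hn => h (false :: q) (by simp [hq]) n hn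
    obtain ⟨k₁, h₁, hk₁⟩ := ih (K := K.comap (pairHom.comp (MonoidHom.inr treeAut treeAut)))
      fun q hq n hn => h (true :: q) (by simp [hq]) n hn
    refine ⟨2 * max k₀ k₁ - 1, by omega, ?_⟩
    rw [grigSeries_odd (by omega)]
    intro z hz
    obtain ⟨u, hu, v, hv, rfl⟩ := mem_pairLift.1 hz
    have h1 : pair u 1 ∈ K := hk₀ (grigSeries_antitone (le_max_left _ _) hu)
    have h2 : pair 1 v ∈ K := hk₁ (grigSeries_antitone (le_max_right _ _) hv)
    have := mul_mem h1 h2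
    rwa [pair_mul, mul_one, one_mul] at this

/-! ### Level transitivity -/

theorem exists_apply_eq_replicate (p : List Bool) :
    ∃ g ∈ grigorchukGroup, g.1 p = List.replicate p.length false := by
  induction p with
  | nil => exact ⟨1, one_mem _, rfl⟩
  | cons x p ih =>
    obtain ⟨g, hg, hp⟩ := ih
    obtain ⟨h, hh⟩ := exists_pair_mem_group hg
    cases x
    · refine ⟨_, hh, ?_⟩
      rw [pair_false, hp]
      rfl
    · refine ⟨_, mul_mem hh grigA_mem_group, ?_⟩
      rw [treeAut_mul_apply]
      change (pair g h).1 (false :: p) = _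
      rw [pair_false, hp]
      rfl

theorem exists_mem_grigorchukClosure_apply_eq {p q : List Bool} (h : p.length = q.length) : ∃ g ∈ Γ, g.1 p = q := by
  obtain ⟨g, hg, hp⟩ := exists_apply_eq_replicate p
  obtain ⟨g', hg', hq⟩ := exists_apply_eq_replicate q
  refine ⟨g'⁻¹ * g, grigorchukGroup_le_closure (mul_mem (inv_mem hg') hg), ?_⟩
  rw [treeAut_mul_apply, hp, h, ← hq, treeAut_inv_apply_self]

/-! ### Automorphisms supported along the rightmost ray -/

/-- The action of a sequence of automorphisms on the subtrees that hang off the rightmost ray. -/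
def spineAct : (ℕ → treeAut) → List Bool → List Bool
  | _, [] => []
  | g, false :: w => false :: (g 0).1 w
  | g, true :: w => true :: spineAct (fun i => g (i + 1)) w

theorem spineAct_mul (g h : ℕ → treeAut) (w : List Bool) :
    spineAct g (spineAct h w) = spineAct (g * h) w := by
  induction w generalizing g h with
  | nil => rfl
  | cons x w ih =>
    cases x
    · rfl
    · exact congrArg (List.cons true) (ih _ _)

theorem spineAct_one (w : List Bool) : spineAct 1 w = w := by
  induction w with
  | nil => rfl
  | cons x w ih =>
    cases x
    · rfl
    · exact congrArg (List.cons true) ih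

theorem spineAct_append (g : ℕ → treeAut) (w : List Bool) (x : Bool) :
    ∃ y, spineAct g (w ++ [x]) = spineAct g w ++ [y] := by
  induction w generalizing g with
  | nil =>
    cases x
    · exact ⟨false, congrArg _ (treeAut_map_nil (g 0))⟩
    · exact ⟨true, rfl⟩
  | cons z w ih =>
    cases z
    · obtain ⟨y, hy⟩ := treeAut_map_append (g 0) w x
      exact ⟨y, congrArg _ hy⟩
    · obtain ⟨y, hy⟩ := ih fun i => g (i + 1)
      exact ⟨y, congrArg _ hy⟩

/-- The automorphism acting as `g i` on the subtree that hangs off the rightmost ray at its vertex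
of level `i`. -/
def spine : (ℕ → treeAut) →* treeAut where
  toFun g := autOfInverse (spineAct g) (spineAct g⁻¹) rfl
    (fun w => by rw [spineAct_mul, inv_mul_cancel, spineAct_one])
    (fun w => by rw [spineAct_mul, mul_inv_cancel, spineAct_one])
    (spineAct_append g) (spineAct_append g⁻¹)
  map_one' := treeAut_ext spineAct_one
  map_mul' g h := treeAut_ext fun w => (spineAct_mul g h w).symm

theorem spine_eq (g : ℕ → treeAut) : spine g = pair (g 0) (spine fun i => g (i + 1)) := by
  refine treeAut_ext ?_
  rintro (_ | ⟨_ | _, w⟩) <;> rfl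

theorem spine_mem_levelStabilizer {n : ℕ} {g : ℕ → treeAut}
    (h : ∀ i < n, g i ∈ levelStabilizer n) : spine g ∈ levelStabilizer n := by
  induction n generalizing g with
  | zero => exact mem_levelStabilizer_zero _
  | succ n ih =>
    rw [spine_eq, pair_mem_levelStabilizer_succ]
    exact ⟨levelStabilizer_antitone (Nat.le_succ n) (h 0 (by omega)),
      ih fun i hi => levelStabilizer_antitone (Nat.le_succ n) (h (i + 1) (by omega))⟩

theorem continuous_spine : Continuous spine := by
  refine continuous_of_continuousAt_one _ ?_
  rw [ContinuousAt, map_one, (treeAut_nhds_hasBasis 1).tendsto_right_iff]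
  rintro n -
  have h : (Set.Iio n).pi (fun _ => (levelStabilizer n : Set treeAut)) ∈ 𝓝 (1 : ℕ → treeAut) :=
    set_pi_mem_nhds (Set.finite_Iio n) fun i _ =>
      (isOpen_levelStabilizer n).mem_nhds (one_mem _)
  filter_upwards [h] with g hg
  rw [inv_one, one_mul]
  exact spine_mem_levelStabilizer hg

/-- Finite products along the ray lie in `γ₃` because `γ₃ × γ₃ ≤ γ₃`; the infinite product is their
limit and `γ₃` is closed. -/
theorem spine_mem_grigSeries_three {g : ℕ → treeAut} (h : ∀ i, g i ∈ grigSeries 3) :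
    spine g ∈ grigSeries 3 := by
  refine mem_of_approx (closedNormal_grigSeries 3).isClosed fun n => ?_
  induction n generalizing g with
  | zero => exact ⟨1, one_mem _, mem_levelStabilizer_zero _⟩
  | succ n ih =>
    obtain ⟨k, hk, hn⟩ := ih fun i => h (i + 1)
    refine ⟨pair (g 0) k, pair_mem_grigSeries_three (h 0) hk, ?_⟩
    rw [spine_eq, pair_inv, pair_mul, pair_mem_levelStabilizer_succ, inv_mul_cancel]
    exact ⟨one_mem _, hn⟩

theorem spine_mulSingle_zero (g : treeAut) : spine (Pi.mulSingle 0 g) = pair g 1 := by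
  rw [spine_eq, Pi.mulSingle_eq_same]
  congr 1
  rw [← map_one spine]
  congr 1

theorem spine_mulSingle_succ (i : ℕ) (g : treeAut) :
    spine (Pi.mulSingle (i + 1) g) = pair 1 (spine (Pi.mulSingle i g)) := by
  rw [spine_eq]
  congr 1
  congr 1
  funext j
  simp [Pi.mulSingle_apply]

theorem spineProd_bot_le (l : ℕ) {N : ℕ → Subgroup treeAut} {K : Subgroup treeAut}
    (h : ∀ i, ∀ n ∈ N i, spine (Pi.mulSingle i n) ∈ K) : spineProd ⊥ l N ≤ K := by
  induction l generalizing N K with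
  | zero => exact bot_le
  | succ l ih =>
    intro z hz
    obtain ⟨u, hu, v, hv, rfl⟩ := mem_pairProd.1 hz
    have h1 := h 0 u hu
    rw [spine_mulSingle_zero] at h1
    have h2 : pair 1 v ∈ K := by
      refine ih (K := K.comap (pairHom.comp (MonoidHom.inr treeAut treeAut)))
        (fun i n hn => ?_) hv
      have := h (i + 1) n hn
      rwa [spine_mulSingle_succ] at this
    have := mul_mem h1 h2
    rwa [pair_mul, mul_one, one_mul] at this

theorem isClosed_pairProd {A B : Subgroup treeAut} (hA : IsClosed (A : Set treeAut))
    (hB : IsClosed (B : Set treeAut)) : IsClosed (pairProd A B : Set treeAut) := by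
  refine isClosed_of_approx fun s hs => ?_
  obtain ⟨u, v, rfl, h⟩ := pair_approx (s := (A : Set treeAut) ×ˢ (B : Set treeAut)) (k := s)
    fun n => by
      obtain ⟨t, ht, hn⟩ := hs n
      obtain ⟨u, hu, v, hv, rfl⟩ := mem_pairProd.1 ht
      exact ⟨(u, v), ⟨hu, hv⟩, hn⟩
  refine mem_pairProd.2 ⟨u, mem_of_approx hA fun n => ?_, v, mem_of_approx hB fun n => ?_, rfl⟩
  · obtain ⟨p, hp, h1, -⟩ := h n
    exact ⟨p.1, hp.1, h1⟩
  · obtain ⟨p, hp, -, h2⟩ := h n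
    exact ⟨p.2, hp.2, h2⟩

theorem isClosed_spineProd {R : Subgroup treeAut} (hR : IsClosed (R : Set treeAut)) (l : ℕ)
    {N : ℕ → Subgroup treeAut} (hN : ∀ i, IsClosed (N i : Set treeAut)) :
    IsClosed (spineProd R l N : Set treeAut) := by
  induction l generalizing N with
  | zero => exact hR
  | succ l ih => exact isClosed_pairProd (hN 0) (ih fun i => hN (i + 1))

theorem spine_mem_spineProd_grigorchukClosure (l : ℕ) {N : ℕ → Subgroup treeAut} {g : ℕ → treeAut}
    (hg : ∀ i, g i ∈ grigSeries 3) (hN : ∀ i, g i ∈ N i) : spine g ∈ spineProd Γ l N := by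
  induction l generalizing N g with
  | zero => exact grigSeries_le _ (spine_mem_grigSeries_three hg)
  | succ l ih =>
    rw [spine_eq]
    exact mem_pairProd.2 ⟨_, hN 0, _, ih (fun i => hg (i + 1)) (fun i => hN (i + 1)), rfl⟩

/-! ### Commutators of elements of the third term -/

theorem ClosedNormal.of_grigSeries_le {K : Subgroup treeAut} {k : ℕ} (hle : K ≤ Γ)
    (hk : grigSeries k ≤ K) (hconj : ∀ g ∈ Γ, ∀ m ∈ K, g * m * g⁻¹ ∈ K) : ClosedNormal K := by
  refine ⟨isClosed_of_approx fun g hg => ?_, hle, hconj⟩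
  have hgΓ : g ∈ Γ := mem_of_approx isClosed_grigorchukClosure fun n => by
    obtain ⟨h, hh, hn⟩ := hg n
    exact ⟨h, hle hh, hn⟩
  obtain ⟨n, hn⟩ := exists_levelStabilizer_le (isOpen_lowerTwoCentralSeries k)
  obtain ⟨h, hh, hgh⟩ := hg n
  have h1 : g⁻¹ * h ∈ grigSeries k := by
    have hΓ := mul_mem (inv_mem hgΓ) (hle hh)
    exact (coe_mem_grigSeries (g := ⟨_, hΓ⟩)).2 (hn ⟨_, hΓ⟩ hgh)
  have := mul_mem hh (inv_mem (hk h1))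
  rwa [mul_inv_rev, inv_inv, mul_inv_cancel_left] at this

/-- The product of a closed normal subgroup and a term of the lower 2-central series. -/
def ClosedNormal.mulGrigSeries {M : Subgroup treeAut} (hM : ClosedNormal M) (k : ℕ) :
    Subgroup treeAut where
  carrier := {g | ∃ m ∈ M, ∃ u ∈ grigSeries k, g = m * u}
  one_mem' := ⟨1, one_mem _, 1, one_mem _, by simp⟩
  mul_mem' := by
    rintro _ _ ⟨m, hm, u, hu, rfl⟩ ⟨m', hm', u', hu', rfl⟩
    refine ⟨m * m', mul_mem hm hm', m'⁻¹ * u * m'⁻¹⁻¹ * u', mul_mem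
      ((closedNormal_grigSeries k).conj _ (inv_mem (hM.le hm')) _ hu) hu', by group⟩
  inv_mem' := by
    rintro _ ⟨m, hm, u, hu, rfl⟩
    exact ⟨m⁻¹, inv_mem hm, m * u⁻¹ * m⁻¹,
      (closedNormal_grigSeries k).conj _ (hM.le hm) _ (inv_mem hu), by group⟩

theorem ClosedNormal.grigSeries_le_mulGrigSeries {M : Subgroup treeAut} (hM : ClosedNormal M)
    (k : ℕ) : grigSeries k ≤ hM.mulGrigSeries k :=
  fun u hu => ⟨1, one_mem _, u, hu, (one_mul u).symm⟩

theorem ClosedNormal.le_mulGrigSeries {M : Subgroup treeAut} (hM : ClosedNormal M)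
    (k : ℕ) : M ≤ hM.mulGrigSeries k :=
  fun m hm => ⟨m, hm, 1, one_mem _, (mul_one m).symm⟩

theorem ClosedNormal.closedNormal_mulGrigSeries {M : Subgroup treeAut} (hM : ClosedNormal M)
    (k : ℕ) : ClosedNormal (hM.mulGrigSeries k) := by
  refine ClosedNormal.of_grigSeries_le ?_ (hM.grigSeries_le_mulGrigSeries k) ?_
  · rintro _ ⟨m, hm, u, hu, rfl⟩
    exact mul_mem (hM.le hm) (grigSeries_le k hu)
  · rintro g hg _ ⟨m, hm, u, hu, rfl⟩
    exact ⟨_, hM.conj g hg m hm, _, (closedNormal_grigSeries k).conj g hg u hu, by group⟩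

/-- Iterating `commutatorGenerated` yields `γ₄ ≤ M γ_k` for every `k ≥ 4`; as the `γ_k` shrink into
the level stabilizers and `M` is closed, `γ₄ ≤ M`. -/
theorem ClosedNormal.grigSeries_four_le {M : Subgroup treeAut} (hM : ClosedNormal M)
    (h : ∀ n ∈ grigSeries 3, ⁅n, grigB⁆ ∈ M ∧ ⁅n, grigA * grigC⁆ ∈ M) : grigSeries 4 ≤ M := by
  have key : ∀ k, grigSeries 4 ≤ hM.mulGrigSeries (k + 4) := by
    intro k
    induction k with
    | zero => exact hM.grigSeries_le_mulGrigSeries 4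
    | succ k ih =>
      have h1 : grigSeries (k + 4) ≤ hM.mulGrigSeries (k + 5) := by
        refine commutatorGenerated (m := k + 3) (by omega) _ (hM.closedNormal_mulGrigSeries _)
          (hM.grigSeries_le_mulGrigSeries _) fun n hn => ?_
        have := h n (grigSeries_antitone (by omega) hn)
        exact ⟨hM.le_mulGrigSeries _ this.1, hM.le_mulGrigSeries _ this.2⟩
      intro g hg
      obtain ⟨m, hm, u, hu, rfl⟩ := ih hg
      exact mul_mem (hM.le_mulGrigSeries _ hm) (h1 hu)
  intro g hg
  refine mem_of_approx hM.isClosed fun n => ?_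
  obtain ⟨m, hm, u, hu, rfl⟩ := key (2 ^ (n + 1) + 1) hg
  refine ⟨m, hm, ?_⟩
  rw [mul_inv_rev, inv_mul_cancel_right]
  exact inv_mem (grigSeries_le_levelStabilizer n (grigSeries_antitone (by omega) hu))

/-- The elements of `Γ` whose commutators with `γ₃` lie in `M`. -/
def ClosedNormal.relCentralizer {M : Subgroup treeAut} (hM : ClosedNormal M) :
    Subgroup treeAut where
  carrier := {w | w ∈ Γ ∧ ∀ u ∈ grigSeries 3, ⁅u, w⁆ ∈ M}
  one_mem' := ⟨one_mem _, fun u _ => by rw [commutatorElement_one_right]; exact one_mem _⟩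
  mul_mem' := by
    rintro g h ⟨hg, hg'⟩ ⟨hh, hh'⟩
    refine ⟨mul_mem hg hh, fun u hu => ?_⟩
    have : ⁅u, g * h⁆ = ⁅u, g⁆ * (g * ⁅u, h⁆ * g⁻¹) := by
      simp only [commutatorElement_def]; group
    rw [this]
    exact mul_mem (hg' u hu) (hM.conj g hg _ (hh' u hu))
  inv_mem' := by
    rintro g ⟨hg, hg'⟩
    refine ⟨inv_mem hg, fun u hu => ?_⟩
    have : ⁅u, g⁻¹⁆ = g⁻¹ * ⁅u, g⁆⁻¹ * g⁻¹⁻¹ := by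
      simp only [commutatorElement_def]; group
    rw [this]
    exact hM.conj _ (inv_mem hg) _ (inv_mem (hg' u hu))

theorem ClosedNormal.closedNormal_relCentralizer {M : Subgroup treeAut} (hM : ClosedNormal M) :
    ClosedNormal hM.relCentralizer := by
  refine ⟨?_, fun w hw => hw.1, ?_⟩
  · have : (hM.relCentralizer : Set treeAut) = (Γ : Set treeAut) ∩
        ⋂ u ∈ (grigSeries 3 : Set treeAut), (fun w => ⁅u, w⁆) ⁻¹' (M : Set treeAut) := by
      ext w
      simp [ClosedNormal.relCentralizer]
    rw [this]
    refine isClosed_grigorchukClosure.inter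
      (isClosed_biInter fun u _ => hM.isClosed.preimage ?_)
    simp only [commutatorElement_def]
    fun_prop
  · rintro g hg w ⟨hw, hw'⟩
    refine ⟨mul_mem (mul_mem hg hw) (inv_mem hg), fun u hu => ?_⟩
    have : ⁅u, g * w * g⁻¹⁆ = g * ⁅g⁻¹ * u * g⁻¹⁻¹, w⁆ * g⁻¹ := by
      simp only [commutatorElement_def]; group
    rw [this]
    exact hM.conj g hg _ (hw' _ ((closedNormal_grigSeries 3).conj _ (inv_mem hg) u hu))

theorem ClosedNormal.pairLift_le {M N : Subgroup treeAut} (hM : ClosedNormal M)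
    (h : N ≤ _root_.leftPart M) : _root_.pairLift N ≤ M := by
  intro z hz
  obtain ⟨u, hu, v, hv, rfl⟩ := mem_pairLift.1 hz
  have := mul_mem (hM.mem_leftPart.1 (h hu)) (hM.pair_swap_mem (hM.mem_leftPart.1 (h hv)))
  rwa [pair_mul, mul_one, one_mul] at this

/-- A closed normal subgroup containing the commutators of elements of `γ₃` contains `γ₁₃`. -/
theorem ClosedNormal.grigSeries_thirteen_le {M : Subgroup treeAut} (hM : ClosedNormal M)
    (h : ∀ u ∈ grigSeries 3, ∀ v ∈ grigSeries 3, ⁅u, v⁆ ∈ M) : grigSeries 13 ≤ M := by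
  have hL := hM.leftPart
  have hP := hL.closedNormal_relCentralizer
  -- Test commutators of `(u, 1)`, `u ∈ γ₃`, with `(grigX, 1)` and `grigX²` show that `grigX` and
  -- `(ac)²` centralize `γ₃` modulo `leftPart M`. These two yield `grigY`, hence all of `γ₂`.
  have hx : grigX ∈ hL.relCentralizer := by
    refine ⟨grigSeries_le _ grigX_mem, fun u hu => hM.mem_leftPart.2 ?_⟩
    have := h _ (pair_mem_grigSeries_three hu (one_mem _)) _ pair_grigX_one_mem
    rwa [pair_commutator, commutatorElement_self] at this
  have hac : (grigA * grigC) ^ 2 ∈ hL.relCentralizer := by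
    rw [← inv_mem_iff]
    refine ⟨inv_mem (pow_mem (mul_mem grigA_mem grigC_mem) 2), fun u hu => hM.mem_leftPart.2 ?_⟩
    have := h _ (pair_mem_grigSeries_three hu (one_mem _)) _ grigX_sq_mem
    rwa [grigX_eq, pair_pow, pair_commutator, commutatorElement_one_left, grigC_mul_grigA_eq_inv,
      inv_pow] at this
  have hy : grigY ∈ hL.relCentralizer := by
    have h1 : (grigA * grigC) ^ 2 = grigX * (grigB * grigY * grigB⁻¹) := by
      rw [grigA_mul_grigC_sq, commutator_grigC_eq, grigX, grigY]
    rw [h1, Subgroup.mul_mem_cancel_left _ hx] at hac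
    exact hP.mem_of_conj_mem grigB_mem hac
  have h2 : grigSeries 2 ≤ hL.relCentralizer := by
    refine generatedBy_grigSeries_two _ hP ?_
    rintro z (rfl | rfl)
    exacts [hx, hy]
  have hLL := hL.leftPart
  -- The same test one level down, against `grigY = (b, b)` and `grigX = (ca, ac)`, produces
  -- precisely the commutators with `b` and `ac` that generate `γ₄`. Undoing the two passages to the
  -- left part takes `4` to `7` and `7` to `13`.
  have h4 : grigSeries 4 ≤ _root_.leftPart (_root_.leftPart M) := by
    refine hLL.grigSeries_four_le fun n hn => ⟨hL.mem_leftPart.2 ?_, ?_⟩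
    · have := (h2 grigY_mem).2 _ (pair_mem_grigSeries_three hn (one_mem _))
      rwa [grigY_eq, pair_commutator, commutatorElement_one_left] at this
    · have h5 : ⁅n, grigC * grigA⁆ ∈ _root_.leftPart (_root_.leftPart M) := by
        refine hL.mem_leftPart.2 ?_
        have := (h2 grigX_mem).2 _ (pair_mem_grigSeries_three hn (one_mem _))
        rwa [grigX_eq, pair_commutator, commutatorElement_one_left] at this
      have h6 : ⁅n, grigA * grigC⁆ = grigA * grigC * ⁅n, grigC * grigA⁆⁻¹ *
          (grigA * grigC)⁻¹ := by
        rw [grigC_mul_grigA_eq_inv]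
        simp only [commutatorElement_def]
        group
      rw [h6]
      exact hLL.conj _ (mul_mem grigA_mem grigC_mem) _ (inv_mem h5)
  have h7 : grigSeries 7 ≤ _root_.leftPart M := by
    rw [show 7 = 2 * 4 - 1 from rfl, grigSeries_odd (by norm_num)]
    exact hL.pairLift_le h4
  rw [show 13 = 2 * 7 - 1 from rfl, grigSeries_odd (by norm_num)]
  exact hM.pairLift_le h7

theorem closedNormal_commutator_grigSeries_three :
    ClosedNormal ⁅grigSeries 3, grigSeries 3⁆.topologicalClosure := by
  refine ⟨Subgroup.isClosed_topologicalClosure _, ?_, fun g hg => ?_⟩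
  · refine Subgroup.topologicalClosure_minimal _ ?_ isClosed_grigorchukClosure
    exact Subgroup.commutator_le.2 fun u hu v hv =>
      (closedNormal_grigorchukClosure).commutator_mem (grigSeries_le _ hu) (grigSeries_le _ hv)
  · have h : ⁅grigSeries 3, grigSeries 3⁆.topologicalClosure ≤
        ⁅grigSeries 3, grigSeries 3⁆.topologicalClosure.comap (MulAut.conj g).toMonoidHom := by
      refine Subgroup.topologicalClosure_minimal _ ?_ ?_
      · refine Subgroup.commutator_le.2 fun u hu v hv => ?_
        rw [Subgroup.mem_comap, map_commutatorElement]
        exact Subgroup.le_topologicalClosure _ (Subgroup.commutator_mem_commutator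
          ((closedNormal_grigSeries 3).conj g hg u hu) ((closedNormal_grigSeries 3).conj g hg v hv))
      · refine (Subgroup.isClosed_topologicalClosure _).preimage
          (f := fun m : treeAut => g * m * g⁻¹) (by fun_prop)
    exact fun m hm => h hm

/-- If `γ₃` were abelian, the trivial subgroup would contain `γ₁₃`, which has finite index in the
infinite group `Γ`. -/
theorem exists_commutator_ne_one : ∃ f ∈ grigSeries 3, ∃ g ∈ grigSeries 3, ⁅f, g⁆ ≠ 1 := by
  by_contra! h
  have hbot : ClosedNormal ⊥ := ⟨by simp, bot_le, fun g _ m hm => by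
    rw [Subgroup.mem_bot] at hm ⊢
    rw [hm, mul_one, mul_inv_cancel]⟩
  have h1 : grigSeries 13 ≤ ⊥ := hbot.grigSeries_thirteen_le fun u hu v hv => h u hu v hv
  have h2 := grigSeries_relIndex_ne_zero 13
  rw [le_bot_iff.1 h1, Subgroup.relIndex_bot_left, Nat.card_eq_zero_of_infinite] at h2
  exact h2 rfl

/-! ### Subgroups normalized by the third term -/

/-- Because `e` moves `p`, the commutator of `e` with the copy of `f⁻¹` at `p` is the copy of `f` at
`p` times an element supported below another vertex of the same level. The latter disappears on
taking the commutator with the copy of `g` at `p`. -/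
theorem vertexEmb_commutator_mem {M : Subgroup treeAut}
    (hM : ∀ n ∈ grigSeries 3, ∀ m ∈ M, n * m * n⁻¹ ∈ M) {e : treeAut} (he : e ∈ M)
    {p : List Bool} (hp : e.1 p ≠ p) {f g : treeAut} (hf : f ∈ grigSeries 3)
    (hg : g ∈ grigSeries 3) : vertexEmb p ⁅f, g⁆ ∈ M := by
  have key : ∀ m ∈ M, ∀ n ∈ grigSeries 3, ⁅m, n⁆ ∈ M := by
    intro m hm n hn
    rw [commutatorElement_def, mul_assoc, mul_assoc, ← mul_assoc n]
    exact mul_mem hm (hM n hn _ (inv_mem hm))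
  have h1 := key _ (key e he (vertexEmb p f⁻¹) (vertexEmb_mem p (inv_mem hf))) (vertexEmb p g)
    (vertexEmb_mem p hg)
  have hc := vertexEmb_commute (treeAut_length e p) hp
    (treeSection e p * f⁻¹ * (treeSection e p)⁻¹) g
  have h2 : ⁅e, vertexEmb p f⁻¹⁆ = vertexEmb (e.1 p)
      (treeSection e p * f⁻¹ * (treeSection e p)⁻¹) * vertexEmb p f := by
    rw [commutatorElement_def, vertexEmb_conj, ← map_inv (vertexEmb p), inv_inv]
  rw [h2, commutatorElement_mul_left_eq_conj_mul, commutatorElement_eq_one_iff_commute.2 hc,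
    mul_one, ← map_commutatorElement] at h1
  have hc' := vertexEmb_commute (treeAut_length e p) hp
    (treeSection e p * f⁻¹ * (treeSection e p)⁻¹) ⁅f, g⁆
  rwa [hc'.eq, mul_inv_cancel_right] at h1

/-- A closed subgroup that is normalized by `γ₃` and contains all conjugates in `Γ` of a nontrivial
element contains some term of the lower 2-central series. -/
theorem exists_grigSeries_le_of_conj_mem {M : Subgroup treeAut} (hcl : IsClosed (M : Set treeAut))
    (hM : ∀ n ∈ grigSeries 3, ∀ m ∈ M, n * m * n⁻¹ ∈ M) {e : treeAut} (he : e ≠ 1)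
    (heM : ∀ g ∈ Γ, g * e * g⁻¹ ∈ M) : ∃ k, grigSeries k ≤ M := by
  obtain ⟨p, hp⟩ : ∃ p, e.1 p ≠ p := by
    by_contra! h
    exact he (treeAut_ext h)
  -- Level transitivity supplies, for each vertex `q` of the level of `p`, a conjugate of `e` that
  -- moves `q`.
  have h1 : ∀ q : List Bool, q.length = p.length → ∀ n ∈ grigSeries 13, vertexEmb q n ∈ M := by
    intro q hq
    obtain ⟨g, hg, hgp⟩ :=
      exists_mem_grigorchukClosure_apply_eq hq.symm
    have hmove : (g * e * g⁻¹).1 q ≠ q := by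
      rw [treeAut_mul_apply, treeAut_mul_apply, ← hgp, treeAut_inv_apply_self]
      exact fun h => hp (g.1.injective h)
    have hle : ⁅grigSeries 3, grigSeries 3⁆.topologicalClosure ≤ M.comap (vertexEmb q) := by
      refine Subgroup.topologicalClosure_minimal _ ?_ (hcl.preimage (continuous_vertexEmb q))
      exact Subgroup.commutator_le.2 fun u hu v hv =>
        vertexEmb_commutator_mem hM (heM g hg) hmove hu hv
    intro n hn
    refine hle (closedNormal_commutator_grigSeries_three.grigSeries_thirteen_le ?_ hn)
    exact fun u hu v hv => Subgroup.le_topologicalClosure _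
      (Subgroup.commutator_mem_commutator hu hv)
  obtain ⟨k, -, hk⟩ := exists_grigSeries_le_of_vertexEmb_mem (by norm_num) p.length h1
  exact ⟨k, hk⟩

/-! ### Elements of growing order -/

theorem exists_involution : ∃ s ∈ grigSeries 3, s ^ 2 = 1 ∧ ∃ v, s.1 v ≠ v := by
  refine ⟨pair grigY grigY, ?_, ?_, [false, false, false, false], ?_⟩
  · rw [← grigA_mul_grigC_pow_four]
    exact sq_mem_grigSeries grigA_mul_grigC_sq_mem
  · rw [pair_pow, grigY_sq, pair_one]
  · rw [grigY_eq]
    simp [grigB, autOfInvol, actA, actB]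

/-- With `s` an involution moving `v`, set `t (i + 1) = s · (t i at v)`. Its square acts as `t i`
below `v` and as a conjugate of `t i` below `s v`, so the order doubles at each step. -/
theorem exists_dyadic_family : ∃ (t : ℕ → treeAut) (z : ℕ → List Bool), ∀ i,
    t i ∈ grigSeries 3 ∧ t i ^ 2 ^ (i + 1) = 1 ∧ (t i ^ 2 ^ i).1 (z i) ≠ z i := by
  obtain ⟨s, hs, hs2, v, hv⟩ := exists_involution
  let t : ℕ → treeAut := fun i => Nat.rec s (fun _ t => s * vertexEmb v t) i
  have ht : ∀ i, t (i + 1) = s * vertexEmb v (t i) := fun i => rfl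
  let z : ℕ → List Bool := fun i => Nat.rec v (fun _ z => v ++ z) i
  have hz : ∀ i, z (i + 1) = v ++ z i := fun i => rfl
  have hs' : s⁻¹ = s := inv_eq_of_mul_eq_one_left (by rw [← pow_two, hs2])
  have hpow : ∀ i k, t (i + 1) ^ (2 * k) = vertexEmb (s.1 v)
      (treeSection s v * t i ^ k * (treeSection s v)⁻¹) * vertexEmb v (t i ^ k) := by
    intro i k
    have h1 : t (i + 1) ^ 2 = vertexEmb (s.1 v) (treeSection s v * t i * (treeSection s v)⁻¹) *
        vertexEmb v (t i) := by
      rw [ht, ← vertexEmb_conj, hs', pow_two, ← mul_assoc]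
    rw [pow_mul, h1, (vertexEmb_commute (treeAut_length s v) hv _ _).mul_pow, ← map_pow, ← map_pow,
      conj_pow]
  refine ⟨t, z, fun i => ?_⟩
  induction i with
  | zero =>
    refine ⟨hs, hs2, ?_⟩
    rw [pow_zero, pow_one]
    exact hv
  | succ i ih =>
    obtain ⟨h1, h2, h3⟩ := ih
    refine ⟨mul_mem hs (vertexEmb_mem v h1), ?_, ?_⟩
    · rw [pow_succ' 2 (i + 1), hpow, h2, mul_one, mul_inv_cancel, map_one, map_one, mul_one]
    · rw [pow_succ' 2 i, hpow, hz, treeAut_mul_apply, vertexEmb_append,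
        vertexEmb_apply_of_not_prefix]
      · exact fun h => h3 (List.append_cancel_left h)
      · intro h
        have h4 := List.prefix_of_prefix_length_le h (List.prefix_append v _)
          (treeAut_length s v).le
        exact hv (h4.eq_of_length (treeAut_length s v))

/-- Sequences `t`, `x`, `y` of elements of `γ₃` such that the commutators of `x i` and of the
conjugate of `y i` by the power of `t i` of exponent `2 ^ m` are trivial exactly if `m ≤ i`. -/
theorem exists_separating_family : ∃ t x y e : ℕ → treeAut,
    (∀ i, t i ∈ grigSeries 3) ∧ (∀ i, x i ∈ grigSeries 3) ∧ (∀ i, y i ∈ grigSeries 3) ∧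
    (∀ i, e i ≠ 1) ∧
    ∀ i m, ⁅x i, t i ^ 2 ^ m * y i * (t i ^ 2 ^ m)⁻¹⁆ = if i < m then e i else 1 := by
  obtain ⟨t, z, h⟩ := exists_dyadic_family
  obtain ⟨f, hf, g, hg, hfg⟩ := exists_commutator_ne_one
  refine ⟨t, fun i => vertexEmb (z i) f, fun i => vertexEmb (z i) g,
    fun i => vertexEmb (z i) ⁅f, g⁆, fun i => (h i).1, fun i => vertexEmb_mem _ hf,
    fun i => vertexEmb_mem _ hg, fun i hi => ?_, fun i m => ?_⟩
  · exact hfg (vertexEmb_injective _ (hi.trans (map_one _).symm))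
  · obtain ⟨-, h1, h2⟩ := h i
    split_ifs with him
    · obtain ⟨k, rfl⟩ : ∃ k, m = (i + 1) + k := ⟨m - (i + 1), by omega⟩
      rw [pow_add, pow_mul, h1, one_pow, one_mul, inv_one, mul_one, ← map_commutatorElement]
    · rw [vertexEmb_conj, commutatorElement_eq_one_iff_commute]
      -- For `m ≤ i`, `t i ^ 2 ^ i` is a power of `t i ^ 2 ^ m`, so a vertex moved by the former is
      -- moved by the latter; the two supports are then disjoint.
      have hmove : (t i ^ 2 ^ m).1 (z i) ≠ z i := by
        intro hfix
        obtain ⟨k, rfl⟩ : ∃ k, i = m + k := ⟨i - m, by omega⟩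
        apply h2
        rw [pow_add, pow_mul]
        generalize 2 ^ k = j
        induction j with
        | zero => rfl
        | succ j ih => rw [pow_succ, treeAut_mul_apply, hfix, ih]
      exact vertexEmb_commute (treeAut_length _ _).symm hmove.symm _ _

/-! ### Finitely generated subgroups along the ray -/

/-- The sequence `g`, replaced by `1` at the indices outside `I`. -/
def restrictHom (I : ℕ → Bool) : (ℕ → treeAut) →* (ℕ → treeAut) where
  toFun g i := if I i then g i else 1
  map_one' := by funext i; simp
  map_mul' g h := by funext i; by_cases hi : I i <;> simp [hi]

theorem restrictHom_apply (I : ℕ → Bool) (g : ℕ → treeAut) (i : ℕ) :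
    restrictHom I g i = if I i then g i else 1 := rfl

theorem restrictHom_mem {I : ℕ → Bool} {N : Subgroup treeAut} {g : ℕ → treeAut}
    (h : ∀ i, g i ∈ N) (i : ℕ) : restrictHom I g i ∈ N := by
  rw [restrictHom_apply]
  split_ifs
  exacts [h i, one_mem _]

theorem restrictHom_mulSingle {I : ℕ → Bool} {i : ℕ} (hi : I i) (g : treeAut) :
    restrictHom I (Pi.mulSingle i g) = Pi.mulSingle i g := by
  funext j
  rw [restrictHom_apply]
  split_ifs with hj
  · rfl
  · rw [Pi.mulSingle_eq_of_ne]
    rintro rfl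
    exact hj hi

/-- For each `m` one commutator of elements of `H` is the sequence `e` cut off at the index `m`. The
quotient of two consecutive truncations lives at a single index. -/
theorem spine_mulSingle_mem_of_separating {H : Subgroup treeAut} {I : ℕ → Bool}
    {t x y e : ℕ → treeAut}
    (h : ∀ i m, ⁅x i, t i ^ 2 ^ m * y i * (t i ^ 2 ^ m)⁻¹⁆ = if i < m then e i else 1)
    (ht : spine (restrictHom I t) ∈ H) (hx : spine (restrictHom I x) ∈ H)
    (hy : spine (restrictHom I y) ∈ H) {i : ℕ} (hi : I i) : spine (Pi.mulSingle i (e i)) ∈ H := by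
  have h1 : ∀ m, spine (restrictHom I fun i => if i < m then e i else 1) ∈ H := by
    intro m
    have e1 : (fun i => if i < m then e i else 1) = ⁅x, t ^ 2 ^ m * y * (t ^ 2 ^ m)⁻¹⁆ := by
      funext i
      exact (h i m).symm
    rw [e1, map_commutatorElement, map_commutatorElement]
    simp only [map_mul, map_inv, map_pow]
    have h2 := mul_mem (mul_mem (pow_mem ht (2 ^ m)) hy) (inv_mem (pow_mem ht (2 ^ m)))
    rw [commutatorElement_def]
    exact mul_mem (mul_mem (mul_mem hx h2) (inv_mem hx)) (inv_mem h2)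
  have h3 := mul_mem (h1 (i + 1)) (inv_mem (h1 i))
  rw [← map_inv, ← map_mul, ← map_inv, ← map_mul] at h3
  rw [← restrictHom_mulSingle hi]
  convert h3 using 3
  funext j
  rcases lt_trichotomy j i with hj | rfl | hj
  · simp [Pi.mulSingle_eq_of_ne hj.ne, hj, hj.le]
  · simp
  · simp [Pi.mulSingle_eq_of_ne hj.ne', hj.not_gt, hj.not_ge]

/-- A subgroup of finite index in the finitely generated group `grigorchukGroup` is finitely
generated, and its intersection with the open subgroup `γ₃` is dense in `γ₃`. -/
theorem exists_finset_dense_grigSeries_three : ∃ K : Finset treeAut, (∀ k ∈ K, k ∈ grigSeries 3) ∧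
    grigSeries 3 ≤ (Subgroup.closure (K : Set treeAut)).topologicalClosure := by
  classical
  set V := (grigSeries 3).subgroupOf grigorchukGroup with hV
  have : V.FiniteIndex := ⟨grigSeries_subgroupOf_index_ne_zero 3⟩
  have hfg : Group.FG V := inferInstance
  obtain ⟨S, hS⟩ := (Group.fg_iff_subgroup_fg V).1 hfg
  refine ⟨S.image Subtype.val, fun k hk => ?_, fun n hn => ?_⟩
  · obtain ⟨s, hs, rfl⟩ := Finset.mem_image.1 hk
    have : s ∈ V := hS ▸ Subgroup.subset_closure hs
    exact this
  · obtain ⟨k, hk⟩ := exists_levelStabilizer_le (isOpen_lowerTwoCentralSeries 3)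
    refine mem_closure_treeAut.2 fun j => ?_
    obtain ⟨g, hg, hng⟩ := mem_closure_treeAut.1 (grigSeries_le 3 hn) (max j k)
    refine ⟨g, ?_, levelStabilizer_antitone (le_max_left j k) hng⟩
    have hΓ := mul_mem (inv_mem (grigSeries_le 3 hn)) (grigorchukGroup_le_closure hg)
    have h1 : n⁻¹ * g ∈ grigSeries 3 := (coe_mem_grigSeries (g := ⟨_, hΓ⟩)).2
      (hk ⟨_, hΓ⟩ (levelStabilizer_antitone (le_max_right j k) hng))
    have h2 : g ∈ grigSeries 3 := by
      have := mul_mem hn h1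
      rwa [mul_inv_cancel_left] at this
    have h3 : (⟨g, hg⟩ : grigorchukGroup) ∈ Subgroup.closure (S : Set grigorchukGroup) :=
      hS ▸ h2
    have h4 := Subgroup.mem_map_of_mem (Subgroup.subtype grigorchukGroup) h3
    rw [MonoidHom.map_closure] at h4
    simpa using h4

theorem exists_finset_coset_reps : ∃ R : Finset treeAut, (∀ r ∈ R, r ∈ Γ) ∧
    ∀ g ∈ Γ, ∃ r ∈ R, g * r⁻¹ ∈ grigSeries 3 := by
  classical
  obtain ⟨R, -, hR⟩ := CosetCover.of_relIndex (grigSeries_relIndex_ne_zero 3)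
  refine ⟨R.filter (· ∈ Γ), fun r hr => (Finset.mem_filter.1 hr).2, fun g hg => ?_⟩
  obtain ⟨r, hr, hrg⟩ := hR g hg
  have hrΓ : r ∈ Γ := by
    have := mul_mem hg (inv_mem (grigSeries_le 3 hrg))
    rwa [mul_inv_rev, inv_inv, mul_inv_cancel_left] at this
  refine ⟨r, Finset.mem_filter.2 ⟨hr, hrΓ⟩, ?_⟩
  have := (closedNormal_grigSeries 3).conj r hrΓ _ hrg
  rwa [mul_inv_cancel_left] at this

/-- A closed subgroup that contains enough elements along the ray contains, for each index `i` in
`I`, a subgroup of finite index of the copy of `Γ` at the `i`th subtree hanging off the ray. -/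
theorem exists_grigSeries_le_of_spine_mem {H : Subgroup treeAut} (hH : IsClosed (H : Set treeAut))
    {I : ℕ → Bool} {K R : Finset treeAut}
    (hK : grigSeries 3 ≤ (Subgroup.closure (K : Set treeAut)).topologicalClosure)
    (hR : ∀ g ∈ Γ, ∃ r ∈ R, g * r⁻¹ ∈ grigSeries 3)
    (hKH : ∀ k ∈ K, spine (restrictHom I fun _ => k) ∈ H)
    {e : ℕ → treeAut} (he : ∀ i, e i ≠ 1)
    (heH : ∀ r ∈ R, ∀ i, I i → spine (Pi.mulSingle i (r * e i * r⁻¹)) ∈ H) {i : ℕ} (hi : I i) :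
    ∃ k, ∀ n ∈ grigSeries k, spine (Pi.mulSingle i n) ∈ H := by
  let φ : treeAut →* treeAut := spine.comp (MonoidHom.mulSingle (fun _ : ℕ => treeAut) i)
  have hφ : Continuous φ :=
    continuous_spine.comp (continuous_mulSingle (A := fun _ : ℕ => treeAut) i)
  let ψ : treeAut →* treeAut := (spine.comp (restrictHom I)).comp (Pi.constMonoidHom ℕ treeAut)
  have hψ : Continuous ψ := by
    refine continuous_spine.comp (continuous_pi fun j => ?_)
    change Continuous fun k : treeAut => if I j then k else 1
    split_ifs
    exacts [continuous_id, continuous_const]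
  have hψH : ∀ n ∈ grigSeries 3, ψ n ∈ H := by
    have h1 : (Subgroup.closure (K : Set treeAut)).topologicalClosure ≤ H.comap ψ :=
      Subgroup.topologicalClosure_minimal _ ((Subgroup.closure_le _).2 fun k hk => hKH k hk)
        (hH.preimage hψ)
    exact fun n hn => h1 (hK hn)
  -- Since `i` is in `I`, the constant sequence `n` along the ray acts on the coordinate `i` as
  -- conjugation by `n`.
  have hconj : ∀ n m, φ (n * m * n⁻¹) = ψ n * φ m * (ψ n)⁻¹ := by
    intro n m
    change spine (Pi.mulSingle i (n * m * n⁻¹)) = spine (restrictHom I fun _ => n) *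
      spine (Pi.mulSingle i m) * (spine (restrictHom I fun _ => n))⁻¹
    rw [← map_inv, ← map_mul, ← map_mul]
    congr 1
    funext j
    by_cases hj : j = i
    · subst hj
      simp [restrictHom_apply, hi]
    · simp [Pi.mulSingle_eq_of_ne hj]
  have hM : ∀ n ∈ grigSeries 3, ∀ m ∈ H.comap φ, n * m * n⁻¹ ∈ H.comap φ := by
    intro n hn m hm
    rw [Subgroup.mem_comap, hconj]
    exact mul_mem (mul_mem (hψH n hn) hm) (inv_mem (hψH n hn))
  refine exists_grigSeries_le_of_conj_mem (M := H.comap φ) (hH.preimage hφ) hM (he i)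
    fun g hg => ?_
  obtain ⟨r, hr, hgr⟩ := hR g hg
  have := hM _ hgr _ (heH r hr i hi)
  -- Write `g = (g r⁻¹) r` with `g r⁻¹ ∈ γ₃`: the finitely many conjugates by `R` and normalization
  -- by `γ₃` give all `Γ`-conjugates of `e i`.
  have e1 : g * r⁻¹ * (r * e i * r⁻¹) * (g * r⁻¹)⁻¹ = g * e i * g⁻¹ := by group
  rwa [e1] at this

theorem exists_subgroup_along_ray : ∃ b : ℕ, 2 ≤ b ∧ ∀ I : ℕ → Bool, ∃ H : Subgroup Γ,
    IsClosed (H : Set Γ) ∧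
    (∃ S : Finset Γ, S.card ≤ b ∧ (Subgroup.closure (S : Set Γ)).topologicalClosure = H) ∧
    ∃ M : ℕ → Subgroup treeAut, (∀ i, M i ≤ Γ) ∧ (∀ i, I i → (M i).relIndex Γ ≠ 0) ∧
      (∀ l, spineProd ⊥ l (fun i => if I i then M i else ⊥) ≤ H.map (Subgroup.subtype Γ)) ∧
      ∀ l, H.map (Subgroup.subtype Γ) ≤ spineProd Γ l fun i => if I i then Γ else ⊥ := by
  classical
  obtain ⟨K, hK, hKd⟩ := exists_finset_dense_grigSeries_three
  obtain ⟨R, hR, hRΓ⟩ := exists_finset_coset_reps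
  obtain ⟨t, x, y, e, ht, hx, hy, he, htxy⟩ := exists_separating_family
  -- One generator for each element of `K` and three for each element of `R`, whatever `I` is; the
  -- summand `2` only ensures `2 ≤ b`.
  refine ⟨K.card + (R.card + R.card + R.card) + 2, by omega, fun I => ?_⟩
  let c : (ℕ → treeAut) → treeAut → treeAut := fun u r => spine (restrictHom I fun i => r * u i * r⁻¹)
  let T : Finset treeAut := K.image (fun k => spine (restrictHom I fun _ => k)) ∪
    (R.image (c t) ∪ R.image (c x) ∪ R.image (c y))
  have hTcard : T.card ≤ K.card + (R.card + R.card + R.card) := by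
    refine (Finset.card_union_le _ _).trans (Nat.add_le_add Finset.card_image_le ?_)
    refine (Finset.card_union_le _ _).trans (Nat.add_le_add ?_ Finset.card_image_le)
    exact (Finset.card_union_le _ _).trans (Nat.add_le_add Finset.card_image_le
      Finset.card_image_le)
  have hT : ∀ s ∈ T, ∃ g : ℕ → treeAut, (∀ i, g i ∈ grigSeries 3) ∧ s = spine (restrictHom I g) := by
    have hc : ∀ u : ℕ → treeAut, (∀ i, u i ∈ grigSeries 3) → ∀ s ∈ R.image (c u),
        ∃ g : ℕ → treeAut, (∀ i, g i ∈ grigSeries 3) ∧ s = spine (restrictHom I g) := by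
      intro u hu s hs
      obtain ⟨r, hr, rfl⟩ := Finset.mem_image.1 hs
      exact ⟨_, fun i => (closedNormal_grigSeries 3).conj r (hR r hr) _ (hu i), rfl⟩
    intro s hs
    rcases Finset.mem_union.1 hs with hs | hs
    · obtain ⟨k, hk, rfl⟩ := Finset.mem_image.1 hs
      exact ⟨_, fun _ => hK k hk, rfl⟩
    · rcases Finset.mem_union.1 hs with hs | hs
      · rcases Finset.mem_union.1 hs with hs | hs
        exacts [hc t ht s hs, hc x hx s hs]
      · exact hc y hy s hs
  have hTΓ : ∀ s ∈ T, s ∈ Γ := by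
    intro s hs
    obtain ⟨g, hg, rfl⟩ := hT s hs
    exact grigSeries_le 3 (spine_mem_grigSeries_three (restrictHom_mem hg))
  let S : Finset Γ := T.subtype (· ∈ Γ)
  set H := (Subgroup.closure (S : Set Γ)).topologicalClosure with hH
  have hHcl : IsClosed (H : Set Γ) := Subgroup.isClosed_topologicalClosure _
  have hHcl' := isClosed_map_grigorchukClosure hHcl
  have hTH : ∀ s ∈ T, s ∈ H.map (Subgroup.subtype Γ) := fun s hs =>
    ⟨⟨s, hTΓ s hs⟩, Subgroup.le_topologicalClosure _
      (Subgroup.subset_closure (Finset.mem_subtype.2 hs)), rfl⟩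
  have hcT : ∀ r ∈ R, c t r ∈ H.map (Subgroup.subtype Γ) ∧ c x r ∈ H.map (Subgroup.subtype Γ) ∧
      c y r ∈ H.map (Subgroup.subtype Γ) := by
    intro r hr
    refine ⟨hTH _ ?_, hTH _ ?_, hTH _ ?_⟩
    · exact Finset.mem_union_right _ (Finset.mem_union_left _ (Finset.mem_union_left _
        (Finset.mem_image_of_mem _ hr)))
    · exact Finset.mem_union_right _ (Finset.mem_union_left _ (Finset.mem_union_right _
        (Finset.mem_image_of_mem _ hr)))
    · exact Finset.mem_union_right _ (Finset.mem_union_right _ (Finset.mem_image_of_mem _ hr))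
  have hfin : ∀ i, ∃ k, I i → ∀ n ∈ grigSeries k,
      spine (Pi.mulSingle i n) ∈ H.map (Subgroup.subtype Γ) := by
    intro i
    by_cases hi : I i
    · obtain ⟨k, hk⟩ := exists_grigSeries_le_of_spine_mem hHcl' hKd hRΓ
        (fun k hk => hTH _ (Finset.mem_union_left _ (Finset.mem_image_of_mem _ hk))) he
        (fun r hr i hi => by
          obtain ⟨h1, h2, h3⟩ := hcT r hr
          refine spine_mulSingle_mem_of_separating (e := fun i => r * e i * r⁻¹)
            (fun i m => ?_) h1 h2 h3 hi
          -- Conjugation by `r` turns the separating family for `e` into one for the conjugates `r *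
          -- e i * r⁻¹`.
          have h4 : ⁅r * x i * r⁻¹, (r * t i * r⁻¹) ^ 2 ^ m * (r * y i * r⁻¹) *
              ((r * t i * r⁻¹) ^ 2 ^ m)⁻¹⁆ =
              r * ⁅x i, t i ^ 2 ^ m * y i * (t i ^ 2 ^ m)⁻¹⁆ * r⁻¹ := by
            rw [conj_pow]
            simp only [commutatorElement_def]
            group
          rw [h4, htxy]
          split_ifs <;> simp) hi
      exact ⟨k, fun _ => hk⟩
    · exact ⟨0, fun h => absurd h hi⟩
  choose k hk using hfin
  refine ⟨H, hHcl, ⟨S, ?_, rfl⟩, fun i => grigSeries (k i), fun i => grigSeries_le _,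
    fun i _ => grigSeries_relIndex_ne_zero _, fun l => spineProd_bot_le l fun i n hn => ?_,
    fun l => ?_⟩
  · refine le_trans ?_ (hTcard.trans (Nat.le_add_right _ 2))
    rw [Finset.card_subtype]
    exact Finset.card_filter_le _ _
  · split_ifs at hn with hi
    · exact hk i hi n hn
    · rw [Subgroup.mem_bot.1 hn, Pi.mulSingle_one, map_one]
      exact one_mem _
  · rw [Subgroup.map_le_iff_le_comap]
    refine Subgroup.topologicalClosure_minimal _ ((Subgroup.closure_le _).2 fun s hs => ?_) ?_
    · obtain ⟨g, hg, hs'⟩ := hT s (Finset.mem_subtype.1 hs)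
      change (s : treeAut) ∈ spineProd _ _ _
      rw [hs']
      refine spine_mem_spineProd_grigorchukClosure l (restrictHom_mem hg) fun i => ?_
      rw [restrictHom_apply]
      split_ifs
      exacts [grigSeries_le 3 (hg i), one_mem _]
    · refine (isClosed_spineProd isClosed_grigorchukClosure l fun i => ?_).preimage
        continuous_subtype_val
      split_ifs
      exacts [isClosed_grigorchukClosure, by simp]

/-! ### The bounded Hausdorff spectra -/

theorem boundedHausdorffSpectrum_eq {b : ℕ} (hb : ∀ I : ℕ → Bool, ∃ H : Subgroup Γ,
    IsClosed (H : Set Γ) ∧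
    (∃ S : Finset Γ, S.card ≤ b ∧ (Subgroup.closure (S : Set Γ)).topologicalClosure = H) ∧
    ∃ M : ℕ → Subgroup treeAut, (∀ i, M i ≤ Γ) ∧ (∀ i, I i → (M i).relIndex Γ ≠ 0) ∧
      (∀ l, spineProd ⊥ l (fun i => if I i then M i else ⊥) ≤ H.map (Subgroup.subtype Γ)) ∧
      ∀ l, H.map (Subgroup.subtype Γ) ≤ spineProd Γ l fun i => if I i then Γ else ⊥)
    {F : ℕ → Subgroup Γ} (hF : IsFiltrationSeries F)
    (hF' : SelfSimilarSeries fun n => (F n).map (Subgroup.subtype Γ)) :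
    boundedHausdorffSpectrum F b = Set.Icc (0 : ℝ) 1 := by
  apply Set.Subset.antisymm
  · rintro _ ⟨H, -, -, rfl⟩
    exact hausdorffDim_mem_Icc (fun n => index_ne_zero_of_isOpen (hF.isOpen n)) H
  · intro η hη
    obtain ⟨I, x, rfl, hx, hI⟩ := exists_binary_digits hη
    obtain ⟨H, hcl, hS, M, hM, hM', h1, h2⟩ := hb I
    exact ⟨H, hcl, hS, hausdorffDim_eq_of_spineProd hF hF' hx hI hM hM' h1 h2⟩

theorem mainTheorem4 :
    IsFiltrationSeries (lowerTwoCentralSeries grigorchukClosure) ∧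
    IsFiltrationSeries (jenningsZassenhausSeries grigorchukClosure) ∧
    IsFiltrationSeries grigorchukLevelSeries ∧
    ∃ b : ℕ, 2 ≤ b ∧
      boundedHausdorffSpectrum (lowerTwoCentralSeries grigorchukClosure) b = Set.Icc (0 : ℝ) 1 ∧
      boundedHausdorffSpectrum (jenningsZassenhausSeries grigorchukClosure) b =
        Set.Icc (0 : ℝ) 1 ∧
      boundedHausdorffSpectrum grigorchukLevelSeries b = Set.Icc (0 : ℝ) 1 := by
  obtain ⟨b, hb2, hb⟩ := exists_subgroup_along_ray
  exact ⟨isFiltrationSeries_lowerTwoCentralSeries, isFiltrationSeries_jenningsZassenhausSeries,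
    isFiltrationSeries_grigorchukLevelSeries, b, hb2,
    boundedHausdorffSpectrum_eq hb isFiltrationSeries_lowerTwoCentralSeries
      selfSimilarSeries_lowerTwoCentralSeries,
    boundedHausdorffSpectrum_eq hb isFiltrationSeries_jenningsZassenhausSeries
      selfSimilarSeries_jenningsZassenhausSeries,
    boundedHausdorffSpectrum_eq hb isFiltrationSeries_grigorchukLevelSeries
      selfSimilarSeries_grigorchukLevelSeries⟩
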